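/- All tensor products of C*-algebras are minimal, $M(A)$ is the multiplier algebra of a C*-algebra $A$, $[\,\cdot\,]$ is the closed linear span, and $0\cdot\infty=0$. Let $I$ be a set. A *C\*-algebraic $I$-partial compact quantum semigroup* is a triple $(A,\Delta,\{1_{kl}\}_{k,l\in I})$ consisting of a (not necessarily unital) C*-algebra $A$, mutually orthogonal self-adjoint projections $1_{kl}\in A$ (some of which may be zero), and a (not necessarily unital) $*$-homomorphism $\Delta:A\to M(A\otimes A)$, such that * (U1) $\sum_{k,l}1_{kl}$ converges strictly to the unit of $M(A)$; * (U2) $\Delta(1_{kl})=\sum_{m}1_{km}\otimes 1_{ml}$ strictly, for all $k,l\in I$; * (C) $(\Delta\otimes\mathrm{id})\circ\Delta=(\mathrm{id}\otimes\Delta)\circ\Delta$, where $\Delta\otimes\mathrm{id}$ and $\mathrm{id}\otimes\Delta$ denote the unique strictly continuous extensions to $M(A\otimes A)$. Put $\Delta(1)=\sum_{k,l,m}1_{km}\otimes 1_{ml}\in M(A\otimes A)$, $P=\sum_k 1_{kk}\in M(A)$, $A_P=PAP$, $\lambda_k=\sum_m 1_{km}$ and $\rho_m=\sum_k 1_{km}$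 in $M(A)$ (strictly convergent sums). Functionals $\omega\in A^*$ and their slice maps $\omega\otimes\mathrm{id}$, $\mathrm{id}\otimes\omega$ are extended to multipliers by strict continuity. The triple is a *C\*-algebraic $I$-partial compact quantum group* if moreover * (U3) $1_{kk}\neq 0$ for all $k\in I$; * (D1) $(A\otimes A)\Delta(1)=[(A\otimes 1)\Delta(A)]=[(1\otimes A)\Delta(A)]$; * (D2) $A=[(\omega\otimes\mathrm{id})\Delta(A_P)\mid\omega\in A^*]=[(\mathrm{id}\otimes\omega)\Delta(A_P)\mid\omega\in A^*]$. An *invariant integral* is a weight $\varphi:A^+\to[0,+\infty]$ (an additive, positively homogeneous map) such that * (I1) $\varphi(1_{km})=1$ whenever $1_{km}\neq 0$; * (I2) $\varphi(a)=\sum_{k,m\in I}\varphi(1_{km}\,a\,1_{km})$ for all $a\in A^+$; * (I3) for all $a\in A^+$ and all states $\omega$ of $A$, the slices $(\omega\otimes\mathrm{id})\Delta(a)$ and $(\mathrm{id}\otimes\omega)\Delta(a)$ lie in $A^+$ and $$\varphi\big((\omega\otimes\mathrm{id})\Delta(a)\big)=\sum_{k}\omega(\lambda_k)\,\varphi(\lambda_k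 a\lambda_k),\qquad \varphi\big((\mathrm{id}\otimes\omega)\Delta(a)\big)=\sum_{m}\omega(\rho_m)\,\varphi(\rho_m a\rho_m).$$ **Theorem.** Each C*-algebraic $I$-partial compact quantum group admits a unique invariant integral. -/

import Mathlib

open scoped ComplexOrder MultiplierAlgebra TensorProduct ENNReal
open Filter

universe u v w

namespace PartialCQG

section Separation

variable {A : Type*} [NonUnitalCStarAlgebra A] [PartialOrder A] [StarOrderedRing A]

/-- Positive functionals detect positive elements. -/
theorem exists_positive_apply_ne_zero {a : A} (ha : 0 ≤ a) (h0 : a ≠ 0) :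
    ∃ f : A →ₚ[ℂ] ℂ, f a ≠ 0 := by
  let C : ProperCone ℝ A :=
    { carrier := {x | 0 ≤ x}
      add_mem' := fun hx hy => add_nonneg hx hy
      zero_mem' := le_rfl
      smul_mem' := fun c x hx => smul_nonneg c.2 hx
      isClosed' := CStarAlgebra.isClosed_nonneg }
  have hmem : -a ∉ C := fun h => h0 (le_antisymm (by simpa using (show (0 : A) ≤ -a from h)) ha)
  obtain ⟨g, hg, hga⟩ := C.hyperplane_separation_point hmem
  let gr : A →ₗ[ℝ] ℂ := Complex.ofRealCLM.toLinearMap ∘ₗ g.toLinearMap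
  let f : A →ₗ[ℂ] ℂ :=
    { toFun := fun x => (g (realPart x : A) : ℂ) + Complex.I * (g (imaginaryPart x : A) : ℂ)
      map_add' := fun x y => by simp [mul_add, add_add_add_comm]
      map_smul' := fun c x => by
        simp [realPart_smul, imaginaryPart_smul]
        apply Complex.ext <;> simp }
  refine ⟨PositiveLinearMap.mk₀ f fun x hx => ?_, ?_⟩
  · have hs : IsSelfAdjoint x := .of_nonneg hx
    have : f x = (g x : ℂ) := by simp [f, hs.coe_realPart, hs.imaginaryPart]
    rw [this]
    exact_mod_cast hg x hx
  · have hs : IsSelfAdjoint a := .of_nonneg ha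
    have : f a = (g a : ℂ) := by simp [f, hs.coe_realPart, hs.imaginaryPart]
    change f a ≠ 0
    rw [this]
    have : 0 < g a := by simpa using hga
    exact_mod_cast this.ne'

/-- The GNS representations of all positive functionals, as one representation. -/
noncomputable def gnsAll : A →⋆ₙₐ[ℂ] lp (fun f : A →ₚ[ℂ] ℂ => f.GNS →L[ℂ] f.GNS) ∞ where
  toFun a := ⟨fun f => f.gnsNonUnitalStarAlgHom a, memℓp_infty ⟨‖a‖, by
    rintro _ ⟨f, rfl⟩
    exact NonUnitalStarAlgHom.norm_apply_le f.gnsNonUnitalStarAlgHom a⟩⟩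
  map_smul' c a := by ext1; funext f; exact map_smul f.gnsNonUnitalStarAlgHom c a
  map_zero' := by ext1; funext f; exact map_zero f.gnsNonUnitalStarAlgHom
  map_add' a b := by ext1; funext f; exact map_add f.gnsNonUnitalStarAlgHom a b
  map_mul' a b := by ext1; funext f; exact map_mul f.gnsNonUnitalStarAlgHom a b
  map_star' a := by ext1; funext f; exact map_star f.gnsNonUnitalStarAlgHom a

theorem gnsAll_injective : Function.Injective (gnsAll (A := A)) := by
  rw [injective_iff_map_eq_zero]
  intro a h
  by_contra h0
  have hc : a * star a ≠ 0 := by rwa [Ne, CStarRing.mul_star_self_eq_zero_iff]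
  have hd : star (a * star a) * (a * star a) ≠ 0 := by
    rwa [Ne, CStarRing.star_mul_self_eq_zero_iff]
  obtain ⟨f, hf⟩ := exists_positive_apply_ne_zero (star_mul_self_nonneg (a * star a)) hd
  have h1 : f.gnsNonUnitalStarAlgHom a = 0 := congrArg (fun z => z.1 f) h
  apply hf
  have h2 : (f.toPreGNS (a * star a) : f.GNS) = 0 := by
    have := congrArg (fun T => T (f.toPreGNS (star a) : f.GNS)) h1
    simpa using this
  have h3 : ‖(f.toPreGNS (a * star a) : f.GNS)‖ ^ 2 = 0 := by rw [h2]; simp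
  rw [UniformSpace.Completion.norm_coe] at h3
  have := f.preGNS_norm_sq (f.toPreGNS (a * star a))
  rw [PositiveLinearMap.ofPreGNS_toPreGNS] at this
  rw [← this]
  exact_mod_cast h3

theorem norm_le_of_gns {a : A} {c : ℝ} (hc : 0 ≤ c)
    (h : ∀ f : A →ₚ[ℂ] ℂ, ‖f.gnsNonUnitalStarAlgHom a‖ ≤ c) : ‖a‖ ≤ c := by
  rw [← NonUnitalStarAlgHom.norm_map gnsAll gnsAll_injective a]
  exact lp.norm_le_of_forall_le hc h

end Separation

section HilbertTensor

variable (H K : Type*) [NormedAddCommGroup H] [InnerProductSpace ℂ H]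
  [NormedAddCommGroup K] [InnerProductSpace ℂ K]

/-- The Hilbert space tensor product. -/
def HTensor : Type _ := UniformSpace.Completion (H ⊗[ℂ] K)

noncomputable instance : NormedAddCommGroup (HTensor H K) :=
  inferInstanceAs (NormedAddCommGroup (UniformSpace.Completion (H ⊗[ℂ] K)))

noncomputable instance : InnerProductSpace ℂ (HTensor H K) :=
  inferInstanceAs (InnerProductSpace ℂ (UniformSpace.Completion (H ⊗[ℂ] K)))

instance : CompleteSpace (HTensor H K) :=
  inferInstanceAs (CompleteSpace (UniformSpace.Completion (H ⊗[ℂ] K)))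

variable {H K}

/-- The canonical isometry from the algebraic tensor product. -/
noncomputable def HTensor.ofAlg : H ⊗[ℂ] K →ₗᵢ[ℂ] HTensor H K :=
  UniformSpace.Completion.toComplₗᵢ

theorem HTensor.denseRange_ofAlg : DenseRange (HTensor.ofAlg (H := H) (K := K)) :=
  UniformSpace.Completion.denseRange_coe

/-- The elementary vector `ξ ⊗ η`. -/
noncomputable def hvec (ξ : H) (η : K) : HTensor H K := HTensor.ofAlg (ξ ⊗ₜ[ℂ] η)

theorem inner_hvec (ξ ξ' : H) (η η' : K) :
    inner ℂ (hvec ξ η) (hvec ξ' η') = inner ℂ ξ ξ' * inner ℂ η η' := by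
  simp [hvec, LinearIsometry.inner_map_map]

theorem norm_hvec (ξ : H) (η : K) : ‖hvec ξ η‖ = ‖ξ‖ * ‖η‖ := by
  simp [hvec]

theorem hvec_add_left (ξ ξ' : H) (η : K) : hvec (ξ + ξ') η = hvec ξ η + hvec ξ' η := by
  rw [hvec, TensorProduct.add_tmul, map_add]; rfl

theorem hvec_add_right (ξ : H) (η η' : K) : hvec ξ (η + η') = hvec ξ η + hvec ξ η' := by
  rw [hvec, TensorProduct.tmul_add, map_add]; rfl

theorem hvec_smul_left (c : ℂ) (ξ : H) (η : K) : hvec (c • ξ) η = c • hvec ξ η := by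
  rw [hvec, ← TensorProduct.smul_tmul', map_smul]; rfl

theorem hvec_smul_right (c : ℂ) (ξ : H) (η : K) : hvec ξ (c • η) = c • hvec ξ η := by
  rw [hvec, TensorProduct.tmul_smul, map_smul]; rfl

/-- Elementary vectors span a dense subspace. -/
theorem dense_span_hvec :
    Dense (Submodule.span ℂ {x : HTensor H K | ∃ ξ η, x = hvec ξ η} : Set (HTensor H K)) := by
  refine HTensor.denseRange_ofAlg.mono ?_
  rintro _ ⟨z, rfl⟩
  induction z using TensorProduct.induction_on with
  | zero => rw [map_zero]; exact zero_mem _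
  | tmul ξ η => exact Submodule.subset_span ⟨ξ, η, rfl⟩
  | add x y hx hy => rw [map_add]; exact add_mem hx hy

/-- Operators on the tensor product are determined on elementary vectors. -/
theorem op_ext {E : Type*} [NormedAddCommGroup E] [NormedSpace ℂ E]
    {S T : HTensor H K →L[ℂ] E} (h : ∀ ξ η, S (hvec ξ η) = T (hvec ξ η)) : S = T := by
  refine ContinuousLinearMap.ext_on dense_span_hvec ?_
  rintro _ ⟨ξ, η, rfl⟩
  exact h ξ η

/-- Operators on the tensor product are determined by matrix coefficients. -/
theorem op_ext_inner {S T : HTensor H K →L[ℂ] HTensor H K}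
    (h : ∀ ξ η ξ' η', inner ℂ (hvec ξ' η') (S (hvec ξ η)) = inner ℂ (hvec ξ' η') (T (hvec ξ η))) :
    S = T := by
  refine op_ext fun ξ η => ?_
  have : innerSL ℂ (S (hvec ξ η)) = innerSL ℂ (T (hvec ξ η)) := by
    refine op_ext fun ξ' η' => ?_
    simpa using congrArg (starRingEnd ℂ) (h ξ η ξ' η')
  exact innerSL_inj.1 this

/-- The operator `S ⊗ T` on the Hilbert space tensor product. -/
noncomputable def opTensor (S : H →L[ℂ] H) (T : K →L[ℂ] K) : HTensor H K →L[ℂ] HTensor H K :=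
  (TensorProduct.mapL S T).completion

theorem opTensor_ofAlg (S : H →L[ℂ] H) (T : K →L[ℂ] K) (z : H ⊗[ℂ] K) :
    opTensor S T (HTensor.ofAlg z) = HTensor.ofAlg (TensorProduct.mapL S T z) :=
  (TensorProduct.mapL S T).completion_apply_coe z

@[simp] theorem opTensor_hvec (S : H →L[ℂ] H) (T : K →L[ℂ] K) (ξ : H) (η : K) :
    opTensor S T (hvec ξ η) = hvec (S ξ) (T η) :=
  opTensor_ofAlg S T (ξ ⊗ₜ η)

theorem norm_opTensor_le (S : H →L[ℂ] H) (T : K →L[ℂ] K) : ‖opTensor S T‖ ≤ ‖S‖ * ‖T‖ := by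
  refine ContinuousLinearMap.opNorm_le_bound _ (by positivity) fun x => ?_
  refine HTensor.denseRange_ofAlg.induction_on
    (p := fun x => ‖opTensor S T x‖ ≤ ‖S‖ * ‖T‖ * ‖x‖) x
    (isClosed_le (by fun_prop) (by fun_prop)) fun z => ?_
  rw [opTensor_ofAlg, LinearIsometry.norm_map, LinearIsometry.norm_map]
  exact ((TensorProduct.mapL S T).le_opNorm z).trans
    (mul_le_mul_of_nonneg_right (TensorProduct.norm_mapL_le S T) (norm_nonneg _))

theorem opTensor_add_left (S S' : H →L[ℂ] H) (T : K →L[ℂ] K) :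
    opTensor (S + S') T = opTensor S T + opTensor S' T :=
  op_ext fun ξ η => by simp [hvec_add_left]

theorem opTensor_add_right (S : H →L[ℂ] H) (T T' : K →L[ℂ] K) :
    opTensor S (T + T') = opTensor S T + opTensor S T' :=
  op_ext fun ξ η => by simp [hvec_add_right]

theorem opTensor_smul_left (c : ℂ) (S : H →L[ℂ] H) (T : K →L[ℂ] K) :
    opTensor (c • S) T = c • opTensor S T :=
  op_ext fun ξ η => by simp [hvec_smul_left]

theorem opTensor_smul_right (c : ℂ) (S : H →L[ℂ] H) (T : K →L[ℂ] K) :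
    opTensor S (c • T) = c • opTensor S T :=
  op_ext fun ξ η => by simp [hvec_smul_right]

theorem opTensor_mul (S S' : H →L[ℂ] H) (T T' : K →L[ℂ] K) :
    opTensor S T * opTensor S' T' = opTensor (S * S') (T * T') :=
  op_ext fun ξ η => by simp

theorem star_opTensor [CompleteSpace H] [CompleteSpace K] (S : H →L[ℂ] H) (T : K →L[ℂ] K) :
    star (opTensor S T) = opTensor (star S) (star T) :=
  op_ext_inner fun ξ η ξ' η' => by
    simp [ContinuousLinearMap.star_eq_adjoint, ContinuousLinearMap.adjoint_inner_right, inner_hvec]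

end HilbertTensor

section AlgSlice

variable {A B : Type*} [AddCommGroup A] [Module ℂ A] [AddCommGroup B] [Module ℂ B]

/-- `θ ⊗ id` on the algebraic tensor product. -/
noncomputable def algSliceLeft (θ : A →ₗ[ℂ] ℂ) : A ⊗[ℂ] B →ₗ[ℂ] B :=
  (TensorProduct.lid ℂ B).toLinearMap ∘ₗ LinearMap.rTensor B θ

/-- `id ⊗ θ` on the algebraic tensor product. -/
noncomputable def algSliceRight (θ : B →ₗ[ℂ] ℂ) : A ⊗[ℂ] B →ₗ[ℂ] A :=
  (TensorProduct.rid ℂ A).toLinearMap ∘ₗ LinearMap.lTensor A θ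

@[simp] theorem algSliceLeft_tmul (θ : A →ₗ[ℂ] ℂ) (a : A) (b : B) :
    algSliceLeft θ (a ⊗ₜ[ℂ] b) = θ a • b := by simp [algSliceLeft]

@[simp] theorem algSliceRight_tmul (θ : B →ₗ[ℂ] ℂ) (a : A) (b : B) :
    algSliceRight θ (a ⊗ₜ[ℂ] b) = θ b • a := by simp [algSliceRight]

theorem apply_algSlice (θ : A →ₗ[ℂ] ℂ) (θ' : B →ₗ[ℂ] ℂ) (x : A ⊗[ℂ] B) :
    θ' (algSliceLeft θ x) = θ (algSliceRight θ' x) := by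
  induction x using TensorProduct.induction_on with
  | zero => simp
  | add x y hx hy => simp only [map_add, hx, hy]
  | tmul a b => simp [mul_comm]

end AlgSlice

section MinTensor

variable (A : Type u) (B : Type v) [NonUnitalCStarAlgebra A] [PartialOrder A] [StarOrderedRing A]
  [NonUnitalCStarAlgebra B] [PartialOrder B] [StarOrderedRing B]

/-- The `ℓ^∞`-product of the algebras `B(H_f ⊗ K_g)`, with `H_f`, `K_g` the GNS spaces of the
positive functionals `f` on `A` and `g` on `B`. -/
def TensorAmbient : Type (max u v) :=
  lp (fun p : (A →ₚ[ℂ] ℂ) × (B →ₚ[ℂ] ℂ) =>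
    HTensor p.1.GNS p.2.GNS →L[ℂ] HTensor p.1.GNS p.2.GNS) ∞

noncomputable instance : NonUnitalCStarAlgebra (TensorAmbient A B) :=
  inferInstanceAs (NonUnitalCStarAlgebra (lp (fun p : (A →ₚ[ℂ] ℂ) × (B →ₚ[ℂ] ℂ) =>
    HTensor p.1.GNS p.2.GNS →L[ℂ] HTensor p.1.GNS p.2.GNS) ∞))

variable {A B}

/-- The component of an element of the product at a pair of positive functionals. -/
noncomputable def TensorAmbient.comp (f : A →ₚ[ℂ] ℂ) (g : B →ₚ[ℂ] ℂ) :
    TensorAmbient A B →⋆ₙₐ[ℂ] (HTensor f.GNS g.GNS →L[ℂ] HTensor f.GNS g.GNS) where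
  toFun z := z.1 (f, g)
  map_smul' _ _ := rfl
  map_zero' := rfl
  map_add' _ _ := rfl
  map_mul' _ _ := rfl
  map_star' _ := rfl

theorem TensorAmbient.ext {z w : TensorAmbient A B}
    (h : ∀ f g, TensorAmbient.comp f g z = TensorAmbient.comp f g w) : z = w :=
  lp.ext (funext fun p => h p.1 p.2)

/-- An element of the product from a bounded family. -/
noncomputable def TensorAmbient.mk
    (T : ∀ (f : A →ₚ[ℂ] ℂ) (g : B →ₚ[ℂ] ℂ), HTensor f.GNS g.GNS →L[ℂ] HTensor f.GNS g.GNS)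
    (c : ℝ) (h : ∀ f g, ‖T f g‖ ≤ c) : TensorAmbient A B :=
  ⟨fun p => T p.1 p.2, memℓp_infty ⟨c, by rintro _ ⟨p, rfl⟩; exact h p.1 p.2⟩⟩

@[simp] theorem TensorAmbient.comp_mk
    (T : ∀ (f : A →ₚ[ℂ] ℂ) (g : B →ₚ[ℂ] ℂ), HTensor f.GNS g.GNS →L[ℂ] HTensor f.GNS g.GNS)
    (c : ℝ) (h : ∀ f g, ‖T f g‖ ≤ c) (f : A →ₚ[ℂ] ℂ) (g : B →ₚ[ℂ] ℂ) :
    TensorAmbient.comp f g (TensorAmbient.mk T c h) = T f g := rfl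

/-- The family `(π_f(a) ⊗ π_g(b))_{f,g}`. -/
noncomputable def ambientTmul (a : A) (b : B) : TensorAmbient A B :=
  TensorAmbient.mk
    (fun f g => opTensor (f.gnsNonUnitalStarAlgHom a) (g.gnsNonUnitalStarAlgHom b))
    (‖a‖ * ‖b‖) fun f g => (norm_opTensor_le _ _).trans (mul_le_mul
        (NonUnitalStarAlgHom.norm_apply_le f.gnsNonUnitalStarAlgHom a)
        (NonUnitalStarAlgHom.norm_apply_le g.gnsNonUnitalStarAlgHom b)
        (norm_nonneg _) (norm_nonneg _))

@[simp] theorem comp_ambientTmul (a : A) (b : B) (f : A →ₚ[ℂ] ℂ) (g : B →ₚ[ℂ] ℂ) :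
    TensorAmbient.comp f g (ambientTmul a b) =
      opTensor (f.gnsNonUnitalStarAlgHom a) (g.gnsNonUnitalStarAlgHom b) := rfl

/-- The algebraic tensor product mapped into the ambient product algebra. -/
noncomputable def ambientLin : A ⊗[ℂ] B →ₗ[ℂ] TensorAmbient A B :=
  TensorProduct.lift (LinearMap.mk₂ ℂ ambientTmul
    (fun a a' b => TensorAmbient.ext fun f g => by simp [opTensor_add_left])
    (fun c a b => TensorAmbient.ext fun f g => by simp [opTensor_smul_left])
    (fun a b b' => TensorAmbient.ext fun f g => by simp [opTensor_add_right])
    (fun c a b => TensorAmbient.ext fun f g => by simp [opTensor_smul_right]))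

@[simp] theorem ambientLin_tmul (a : A) (b : B) : ambientLin (a ⊗ₜ b) = ambientTmul a b := rfl

theorem ambientTmul_mul (a a' : A) (b b' : B) :
    ambientTmul a b * ambientTmul a' b' = ambientTmul (a * a') (b * b') := 
  TensorAmbient.ext fun f g => by simp [opTensor_mul]

theorem star_ambientTmul (a : A) (b : B) :
    star (ambientTmul a b) = ambientTmul (star a) (star b) := 
  TensorAmbient.ext fun f g => by simp [star_opTensor, map_star]

variable (A B)

/-- The algebraic tensor product as a `*`-subalgebra of the ambient product algebra. -/
noncomputable def algTensor : NonUnitalStarSubalgebra ℂ (TensorAmbient A B) where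
  __ := LinearMap.range (ambientLin (A := A) (B := B))
  mul_mem' := by
    rintro _ _ ⟨x, rfl⟩ ⟨y, rfl⟩
    induction x using TensorProduct.induction_on with
    | zero => rw [map_zero, zero_mul]; exact zero_mem (LinearMap.range ambientLin)
    | add x x' hx hx' =>
      rw [map_add, add_mul]; exact add_mem (S := Submodule ℂ _) hx hx'
    | tmul a b =>
      induction y using TensorProduct.induction_on with
      | zero => rw [map_zero, mul_zero]; exact zero_mem (LinearMap.range ambientLin)
      | add y y' hy hy' =>
        rw [map_add, mul_add]; exact add_mem (S := Submodule ℂ _) hy hy'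
      | tmul a' b' => exact ⟨(a * a') ⊗ₜ (b * b'), by simp [ambientTmul_mul]⟩
  star_mem' := by
    rintro _ ⟨x, rfl⟩
    induction x using TensorProduct.induction_on with
    | zero => rw [map_zero, star_zero]; exact zero_mem (LinearMap.range ambientLin)
    | add x x' hx hx' => rw [map_add, star_add]; exact add_mem (S := Submodule ℂ _) hx hx'
    | tmul a b => exact ⟨star a ⊗ₜ star b, by simp [star_ambientTmul]⟩

/-- The minimal C*-tensor product: the completion of the algebraic tensor product in the norm
`‖∑ aᵢ ⊗ bᵢ‖ = sup_{f,g} ‖∑ π_f(aᵢ) ⊗ π_g(bᵢ)‖`, with `f` and `g` running over the positive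
functionals on `A` and on `B` and with `π_f`, `π_g` their GNS representations. -/
def MinTensor : Type (max u v) := (algTensor A B).topologicalClosure

noncomputable instance : NonUnitalCStarAlgebra (MinTensor A B) :=
  haveI : IsClosed ((algTensor A B).topologicalClosure : Set (TensorAmbient A B)) :=
    (algTensor A B).isClosed_topologicalClosure
  inferInstanceAs (NonUnitalCStarAlgebra (algTensor A B).topologicalClosure)

noncomputable instance : PartialOrder (MinTensor A B) := CStarAlgebra.spectralOrder _

instance : StarOrderedRing (MinTensor A B) := CStarAlgebra.spectralOrderedRing _

/-- The inclusion of the minimal tensor product into the ambient product algebra. -/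
noncomputable def MinTensor.incl : MinTensor A B →⋆ₙₐ[ℂ] TensorAmbient A B :=
  NonUnitalStarSubalgebraClass.subtype (algTensor A B).topologicalClosure

variable {A B}

theorem MinTensor.incl_injective : Function.Injective (MinTensor.incl A B) :=
  Subtype.val_injective

theorem MinTensor.norm_incl (z : MinTensor A B) : ‖MinTensor.incl A B z‖ = ‖z‖ := rfl

variable (A B) in
/-- The embedding of the algebraic tensor product into the minimal tensor product. -/
noncomputable def MinTensor.ofAlg : A ⊗[ℂ] B →ₗ[ℂ] MinTensor A B where
  toFun x := ⟨ambientLin x, (algTensor A B).le_topologicalClosure ⟨x, rfl⟩⟩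
  map_add' x y := Subtype.ext (map_add ambientLin x y)
  map_smul' c x := Subtype.ext (map_smul ambientLin c x)

/-- The elementary tensor `a ⊗ b` in the minimal tensor product. -/
noncomputable def MinTensor.tmul (a : A) (b : B) : MinTensor A B := MinTensor.ofAlg A B (a ⊗ₜ b)

@[simp] theorem MinTensor.incl_ofAlg (x : A ⊗[ℂ] B) :
    MinTensor.incl A B (MinTensor.ofAlg A B x) = ambientLin x := rfl

@[simp] theorem MinTensor.ofAlg_tmul (a : A) (b : B) :
    MinTensor.ofAlg A B (a ⊗ₜ b) = MinTensor.tmul a b := rfl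

@[simp] theorem MinTensor.incl_tmul (a : A) (b : B) :
    MinTensor.incl A B (MinTensor.tmul a b) = ambientTmul a b := rfl

theorem MinTensor.tmul_mul (a a' : A) (b b' : B) :
    MinTensor.tmul a b * MinTensor.tmul a' b' = MinTensor.tmul (a * a') (b * b') :=
  MinTensor.incl_injective (by rw [map_mul]; exact ambientTmul_mul a a' b b')

theorem MinTensor.star_tmul (a : A) (b : B) :
    star (MinTensor.tmul a b) = MinTensor.tmul (star a) (star b) :=
  MinTensor.incl_injective (by rw [map_star]; exact star_ambientTmul a b)

theorem MinTensor.tmul_add_left (a a' : A) (b : B) :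
    MinTensor.tmul (a + a') b = MinTensor.tmul a b + MinTensor.tmul a' b := by
  rw [MinTensor.tmul, TensorProduct.add_tmul, map_add]; rfl

theorem MinTensor.tmul_add_right (a : A) (b b' : B) :
    MinTensor.tmul a (b + b') = MinTensor.tmul a b + MinTensor.tmul a b' := by
  rw [MinTensor.tmul, TensorProduct.tmul_add, map_add]; rfl

theorem MinTensor.tmul_smul_left (c : ℂ) (a : A) (b : B) :
    MinTensor.tmul (c • a) b = c • MinTensor.tmul a b := by
  rw [MinTensor.tmul, ← TensorProduct.smul_tmul', map_smul]; rfl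

theorem MinTensor.tmul_smul_right (c : ℂ) (a : A) (b : B) :
    MinTensor.tmul a (c • b) = c • MinTensor.tmul a b := by
  rw [MinTensor.tmul, TensorProduct.tmul_smul, map_smul]; rfl

theorem MinTensor.denseRange_ofAlg : DenseRange (MinTensor.ofAlg A B) := by
  intro z
  have hz : (z.1 : TensorAmbient A B) ∈ closure (LinearMap.range (ambientLin (A := A) (B := B)) :
    Set (TensorAmbient A B)) := z.2
  rw [Metric.mem_closure_iff] at hz ⊢
  intro ε hε
  obtain ⟨_, ⟨x, rfl⟩, hx⟩ := hz ε hε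
  exact ⟨_, ⟨x, rfl⟩, hx⟩

/-- Continuous linear maps on the minimal tensor product are determined on elementary tensors. -/
theorem MinTensor.clm_ext {E : Type*} [NormedAddCommGroup E] [NormedSpace ℂ E]
    {S T : MinTensor A B →L[ℂ] E}
    (h : ∀ a b, S (MinTensor.tmul a b) = T (MinTensor.tmul a b)) : S = T := by
  ext z
  have : S.toLinearMap ∘ₗ MinTensor.ofAlg A B = T.toLinearMap ∘ₗ MinTensor.ofAlg A B :=
    TensorProduct.ext' h
  refine congrFun (MinTensor.denseRange_ofAlg.equalizer S.continuous T.continuous ?_) z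
  funext x
  exact LinearMap.congr_fun this x

/-! ### Slice maps -/

/-- The matrix coefficient `b ↦ ⟨η, π_g(b) ξ⟩`. -/
noncomputable def coeff (g : B →ₚ[ℂ] ℂ) (ξ η : g.GNS) : B →ₗ[ℂ] ℂ where
  toFun b := inner ℂ η (g.gnsNonUnitalStarAlgHom b ξ)
  map_add' a b := by simp [inner_add_right]
  map_smul' c a := by simp [inner_smul_right]

theorem coeff_slice (f : A →ₚ[ℂ] ℂ) (g : B →ₚ[ℂ] ℂ) (ξ ξ' : f.GNS) (η η' : g.GNS)
    (x : A ⊗[ℂ] B) :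
    inner ℂ (hvec ξ' η') (TensorAmbient.comp f g (ambientLin x) (hvec ξ η)) =
      coeff f ξ ξ' (algSliceRight (coeff g η η') x) ∧
    inner ℂ (hvec ξ' η') (TensorAmbient.comp f g (ambientLin x) (hvec ξ η)) =
      coeff g η η' (algSliceLeft (coeff f ξ ξ') x) := by
  induction x using TensorProduct.induction_on with
  | zero => simp
  | add x y hx hy =>
    simp only [map_add, add_apply, inner_add_right]
    exact ⟨by rw [hx.1, hy.1], by rw [hx.2, hy.2]⟩
  | tmul a b => simp [coeff, inner_hvec, mul_comm]

theorem opNorm_le_of_inner {H : Type*} [NormedAddCommGroup H] [InnerProductSpace ℂ H]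
    (T : H →L[ℂ] H) {c : ℝ} (hc : 0 ≤ c) (h : ∀ ξ η, ‖inner ℂ η (T ξ)‖ ≤ c * ‖ξ‖ * ‖η‖) :
    ‖T‖ ≤ c := by
  refine T.opNorm_le_bound hc fun ξ => ?_
  have := h ξ (T ξ)
  rw [inner_self_eq_norm_sq_to_K] at this
  by_cases h0 : ‖T ξ‖ = 0
  · rw [h0]; positivity
  · have hp : 0 < ‖T ξ‖ := lt_of_le_of_ne (norm_nonneg _) (Ne.symm h0)
    have h2 : ‖T ξ‖ * ‖T ξ‖ ≤ c * ‖ξ‖ * ‖T ξ‖ := by simpa [sq] using this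
    exact le_of_mul_le_mul_right h2 hp

theorem norm_coeff_ambient_le (f : A →ₚ[ℂ] ℂ) (g : B →ₚ[ℂ] ℂ) (ξ ξ' : f.GNS) (η η' : g.GNS)
    (x : A ⊗[ℂ] B) :
    ‖inner ℂ (hvec ξ' η') (TensorAmbient.comp f g (ambientLin x) (hvec ξ η))‖ ≤
      ‖MinTensor.ofAlg A B x‖ * (‖ξ‖ * ‖η‖) * (‖ξ'‖ * ‖η'‖) := by
  refine (norm_inner_le_norm _ _).trans ?_
  rw [norm_hvec, mul_comm]
  refine mul_le_mul_of_nonneg_right ?_ (by positivity)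
  refine ((TensorAmbient.comp f g (ambientLin x)).le_opNorm _).trans ?_
  rw [norm_hvec]
  refine mul_le_mul_of_nonneg_right ?_ (by positivity)
  exact NonUnitalStarAlgHom.norm_apply_le (TensorAmbient.comp f g) (ambientLin x)

theorem norm_algSliceRight_coeff_le (g : B →ₚ[ℂ] ℂ) (η η' : g.GNS) (x : A ⊗[ℂ] B) :
    ‖algSliceRight (coeff g η η') x‖ ≤ ‖MinTensor.ofAlg A B x‖ * ‖η‖ * ‖η'‖ :=
  norm_le_of_gns (by positivity) fun f => opNorm_le_of_inner _ (by positivity) fun ξ ξ' => by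
    refine (le_of_eq ?_).trans
      ((norm_coeff_ambient_le f g ξ ξ' η η' x).trans (le_of_eq (by ring)))
    rw [(coeff_slice f g ξ ξ' η η' x).1]; rfl

theorem norm_algSliceLeft_coeff_le (f : A →ₚ[ℂ] ℂ) (ξ ξ' : f.GNS) (x : A ⊗[ℂ] B) :
    ‖algSliceLeft (coeff f ξ ξ') x‖ ≤ ‖MinTensor.ofAlg A B x‖ * ‖ξ‖ * ‖ξ'‖ :=
  norm_le_of_gns (by positivity) fun g => opNorm_le_of_inner _ (by positivity) fun η η' => by
    refine (le_of_eq ?_).trans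
      ((norm_coeff_ambient_le f g ξ ξ' η η' x).trans (le_of_eq (by ring)))
    rw [(coeff_slice f g ξ ξ' η η' x).2]; rfl

theorem norm_algSliceLeft_le (ω : A →L[ℂ] ℂ) (x : A ⊗[ℂ] B) :
    ‖algSliceLeft (ω : A →ₗ[ℂ] ℂ) x‖ ≤ ‖ω‖ * ‖MinTensor.ofAlg A B x‖ := by
  refine norm_le_of_gns (by positivity) fun g => opNorm_le_of_inner _ (by positivity) fun η η' => ?_
  change ‖coeff g η η' (algSliceLeft (ω : A →ₗ[ℂ] ℂ) x)‖ ≤ _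
  rw [apply_algSlice]
  refine (ω.le_opNorm _).trans ?_
  calc _ ≤ ‖ω‖ * (‖MinTensor.ofAlg A B x‖ * ‖η‖ * ‖η'‖) :=
        mul_le_mul_of_nonneg_left (norm_algSliceRight_coeff_le g η η' x) (norm_nonneg _)
    _ = _ := by ring

theorem norm_algSliceRight_le (ω : B →L[ℂ] ℂ) (x : A ⊗[ℂ] B) :
    ‖algSliceRight (ω : B →ₗ[ℂ] ℂ) x‖ ≤ ‖ω‖ * ‖MinTensor.ofAlg A B x‖ := by
  refine norm_le_of_gns (by positivity) fun f => opNorm_le_of_inner _ (by positivity) fun ξ ξ' => ?_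
  change ‖coeff f ξ ξ' (algSliceRight (ω : B →ₗ[ℂ] ℂ) x)‖ ≤ _
  rw [← apply_algSlice]
  refine (ω.le_opNorm _).trans ?_
  calc _ ≤ ‖ω‖ * (‖MinTensor.ofAlg A B x‖ * ‖ξ‖ * ‖ξ'‖) :=
        mul_le_mul_of_nonneg_left (norm_algSliceLeft_coeff_le f ξ ξ' x) (norm_nonneg _)
    _ = _ := by ring

/-- The slice map `ω ⊗ id`, for a bounded functional `ω`. -/
noncomputable def sliceLeft (ω : A →L[ℂ] ℂ) : MinTensor A B →L[ℂ] B :=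
  (algSliceLeft (ω : A →ₗ[ℂ] ℂ)).extendOfNorm (MinTensor.ofAlg A B)

/-- The slice map `id ⊗ ω`, for a bounded functional `ω`. -/
noncomputable def sliceRight (ω : B →L[ℂ] ℂ) : MinTensor A B →L[ℂ] A :=
  (algSliceRight (ω : B →ₗ[ℂ] ℂ)).extendOfNorm (MinTensor.ofAlg A B)

@[simp] theorem sliceLeft_tmul (ω : A →L[ℂ] ℂ) (a : A) (b : B) :
    sliceLeft ω (MinTensor.tmul a b) = ω a • b := by
  rw [sliceLeft, MinTensor.tmul, LinearMap.extendOfNorm_eq MinTensor.denseRange_ofAlg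
    ⟨‖ω‖, norm_algSliceLeft_le ω⟩, algSliceLeft_tmul]; rfl

@[simp] theorem sliceRight_tmul (ω : B →L[ℂ] ℂ) (a : A) (b : B) :
    sliceRight ω (MinTensor.tmul a b) = ω b • a := by
  rw [sliceRight, MinTensor.tmul, LinearMap.extendOfNorm_eq MinTensor.denseRange_ofAlg
    ⟨‖ω‖, norm_algSliceRight_le ω⟩, algSliceRight_tmul]; rfl

/-- The matrix coefficient as a bounded functional. -/
noncomputable def coeffL (g : B →ₚ[ℂ] ℂ) (ξ η : g.GNS) : B →L[ℂ] ℂ :=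
  (coeff g ξ η).mkContinuous (‖ξ‖ * ‖η‖) fun b => by
    refine (norm_inner_le_norm (𝕜 := ℂ) η (g.gnsNonUnitalStarAlgHom b ξ)).trans ?_
    refine (mul_le_mul_of_nonneg_left (ContinuousLinearMap.le_opNorm _ _) (norm_nonneg _)).trans ?_
    have := NonUnitalStarAlgHom.norm_apply_le g.gnsNonUnitalStarAlgHom b
    calc ‖η‖ * (‖g.gnsNonUnitalStarAlgHom b‖ * ‖ξ‖) ≤ ‖η‖ * (‖b‖ * ‖ξ‖) := by gcongr
      _ = _ := by ring

/-- Product functionals separate the points of the minimal tensor product. -/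
theorem MinTensor.eq_zero_of_slices {z : MinTensor A B}
    (h : ∀ (ω : A →L[ℂ] ℂ) (χ : B →L[ℂ] ℂ), χ (sliceLeft ω z) = 0) : z = 0 := by
  apply MinTensor.incl_injective
  rw [map_zero]
  refine TensorAmbient.ext fun f g => op_ext_inner fun ξ η ξ' η' => ?_
  rw [map_zero]
  have key : (innerSL ℂ (hvec ξ' η')) ∘L
      (ContinuousLinearMap.apply ℂ (HTensor f.GNS g.GNS) (hvec ξ η)) ∘L
      ((TensorAmbient.comp f g : TensorAmbient A B →ₗ[ℂ] _).mkContinuous 1 (fun x => by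
        rw [one_mul]; exact NonUnitalStarAlgHom.norm_apply_le (TensorAmbient.comp f g) x)) ∘L
      ((MinTensor.incl A B : MinTensor A B →ₗ[ℂ] _).mkContinuous 1 (fun x => by
        rw [one_mul]; exact (MinTensor.norm_incl x).le)) =
      (coeffL g η η') ∘L sliceLeft (coeffL f ξ ξ') := by
    refine MinTensor.clm_ext fun a b => ?_
    have := (coeff_slice f g ξ ξ' η η' (a ⊗ₜ b)).2
    rw [algSliceLeft_tmul] at this
    rw [ContinuousLinearMap.comp_apply (coeffL g η η'), sliceLeft_tmul]
    exact this
  have h0 : (coeffL g η η' ∘L sliceLeft (coeffL f ξ ξ')) z = 0 :=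
    h (coeffL f ξ ξ') (coeffL g η η')
  have h1 := (DFunLike.congr_fun key z).trans h0
  exact h1.trans (by simp)

theorem MinTensor.eq_zero_of_slices_right {z : MinTensor A B}
    (h : ∀ χ : B →L[ℂ] ℂ, sliceRight χ z = 0) : z = 0 := by
  refine MinTensor.eq_zero_of_slices fun ω χ => ?_
  have : χ ∘L sliceLeft ω = ω ∘L sliceRight χ :=
    MinTensor.clm_ext fun a b => by simp [mul_comm]
  have := congrArg (fun T => T z) this
  exact this.trans (by simp [h])

theorem MinTensor.eq_zero_of_slices_left {z : MinTensor A B}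
    (h : ∀ ω : A →L[ℂ] ℂ, sliceLeft ω z = 0) : z = 0 :=
  MinTensor.eq_zero_of_slices fun ω χ => by rw [h, map_zero]

end MinTensor

/-! ### Tensor products of multipliers -/

section Multipliers

variable {A : Type u} [NonUnitalCStarAlgebra A]

theorem multiplier_ext {X Y : 𝓜(ℂ, A)} (h : ∀ a, X.fst a = Y.fst a) : X = Y := by
  refine DoubleCentralizer.ext ℂ A X Y (Prod.ext (ContinuousLinearMap.ext h)
    (ContinuousLinearMap.ext fun a => ?_))
  have h1 : ∀ b, (X.snd a - Y.snd a) * b = 0 := fun b => by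
    rw [sub_mul, X.central, Y.central, h, sub_self]
  have h2 := h1 (star (X.snd a - Y.snd a))
  rw [CStarRing.mul_star_self_eq_zero_iff] at h2
  exact sub_eq_zero.1 h2

theorem multiplier_fst_mul (X : 𝓜(ℂ, A)) (a b : A) : X.fst (a * b) = X.fst a * b := by
  have h : ∀ c, c * (X.fst (a * b) - X.fst a * b) = 0 := fun c => by
    rw [mul_sub, ← mul_assoc c, ← X.central, ← X.central, mul_assoc, sub_self]
  have h2 := h (star (X.fst (a * b) - X.fst a * b))
  rw [CStarRing.star_mul_self_eq_zero_iff] at h2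
  exact sub_eq_zero.1 h2

variable [PartialOrder A] [StarOrderedRing A]

theorem star_fst_mul_fst_le (X : 𝓜(ℂ, A)) (c : A) :
    star (X.fst c) * X.fst c ≤ (‖X‖ ^ 2) • (star c * c) := by
  let _ : PartialOrder 𝓜(ℂ, A) := CStarAlgebra.spectralOrder _
  have _ : StarOrderedRing 𝓜(ℂ, A) := CStarAlgebra.spectralOrderedRing _
  have h1 : (0 : 𝓜(ℂ, A)) ≤ algebraMap ℝ 𝓜(ℂ, A) (‖X‖ ^ 2) - star X * X := by
    rw [sub_nonneg]
    exact CStarAlgebra.star_mul_le_algebraMap_norm_sq (a := X)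
  obtain ⟨Y, hY⟩ := CStarAlgebra.nonneg_iff_eq_star_mul_self.1 h1
  have h2 := congrArg (fun Z : 𝓜(ℂ, A) => star c * Z.fst c) hY
  have h3 : ∀ Z : 𝓜(ℂ, A), star c * (star Z * Z).fst c = star (Z.fst c) * Z.fst c := fun Z => by
    have : (star Z * Z).fst c = star (Z.snd (star (Z.fst c))) := by
      rw [DoubleCentralizer.mul_fst]
      exact DoubleCentralizer.star_fst Z (Z.fst c)
    rw [this, ← star_mul, Z.central, star_mul, star_star]
  have h4 : (algebraMap ℝ 𝓜(ℂ, A) (‖X‖ ^ 2)).fst c = (‖X‖ ^ 2) • c := rfl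
  simp only [DoubleCentralizer.sub_fst, sub_apply, mul_sub, h3, h4, mul_smul_comm] at h2
  rw [← sub_nonneg, h2]
  exact star_mul_self_nonneg _

/-- The action of a multiplier on the GNS space of a positive functional. -/
noncomputable def gnsMultiplier (f : A →ₚ[ℂ] ℂ) (X : 𝓜(ℂ, A)) : f.GNS →L[ℂ] f.GNS :=
  (((f.toPreGNS.toLinearMap ∘ₗ X.fst.toLinearMap ∘ₗ f.ofPreGNS.toLinearMap).mkContinuous ‖X‖
    fun x => by
      rw [← sq_le_sq₀ (by positivity) (by positivity), mul_pow]
      have h1 := f.preGNS_norm_sq x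
      have h2 := f.preGNS_norm_sq (f.toPreGNS (X.fst (f.ofPreGNS x)))
      have h3 := OrderHomClass.mono f (star_fst_mul_fst_le X (f.ofPreGNS x))
      rw [PositiveLinearMap.ofPreGNS_toPreGNS] at h2
      rw [← h2] at h3
      have h4 : f ((‖X‖ ^ 2) • (star (f.ofPreGNS x) * f.ofPreGNS x)) =
          ((‖X‖ ^ 2 * ‖x‖ ^ 2 : ℝ) : ℂ) := by
        rw [← Complex.coe_smul, map_smul, ← h1]; simp
      rw [h4] at h3
      exact_mod_cast h3) : f.PreGNS →L[ℂ] f.PreGNS).completion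

theorem norm_gnsMultiplier_le (f : A →ₚ[ℂ] ℂ) (X : 𝓜(ℂ, A)) : ‖gnsMultiplier f X‖ ≤ ‖X‖ := by
  refine ContinuousLinearMap.opNorm_le_bound _ (norm_nonneg _) fun x => ?_
  induction x using UniformSpace.Completion.induction_on with
  | hp => exact isClosed_le (by fun_prop) (by fun_prop)
  | ih z =>
    rw [gnsMultiplier, ContinuousLinearMap.completion_apply_coe, UniformSpace.Completion.norm_coe,
      UniformSpace.Completion.norm_coe]
    exact (ContinuousLinearMap.le_opNorm _ z).trans
      (mul_le_mul_of_nonneg_right (LinearMap.mkContinuous_norm_le _ (norm_nonneg _) _)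
        (norm_nonneg _))

theorem gnsMultiplier_coe (f : A →ₚ[ℂ] ℂ) (X : 𝓜(ℂ, A)) (a : A) :
    gnsMultiplier f X (f.toPreGNS a : f.GNS) = (f.toPreGNS (X.fst a) : f.GNS) := by
  rw [gnsMultiplier, ContinuousLinearMap.completion_apply_coe]; rfl

theorem gns_ext (f : A →ₚ[ℂ] ℂ) {S T : f.GNS →L[ℂ] f.GNS}
    (h : ∀ a, S (f.toPreGNS a : f.GNS) = T (f.toPreGNS a : f.GNS)) : S = T := by
  ext x
  induction x using UniformSpace.Completion.induction_on with
  | hp => exact isClosed_eq S.continuous T.continuous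
  | ih z => exact h (f.ofPreGNS z)

theorem gnsMultiplier_mul (f : A →ₚ[ℂ] ℂ) (X : 𝓜(ℂ, A)) (a : A) :
    gnsMultiplier f X * f.gnsNonUnitalStarAlgHom a = f.gnsNonUnitalStarAlgHom (X.fst a) :=
  gns_ext f fun b => by
    rw [mul_apply_eq_comp, PositiveLinearMap.gnsNonUnitalStarAlgHom_apply_coe,
      PositiveLinearMap.gnsNonUnitalStarAlgHom_apply_coe,
      PositiveLinearMap.leftMulMapPreGNS_apply, PositiveLinearMap.leftMulMapPreGNS_apply]
    simp [gnsMultiplier_coe, multiplier_fst_mul]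

theorem gns_mul_gnsMultiplier (f : A →ₚ[ℂ] ℂ) (X : 𝓜(ℂ, A)) (a : A) :
    f.gnsNonUnitalStarAlgHom a * gnsMultiplier f X = f.gnsNonUnitalStarAlgHom (X.snd a) :=
  gns_ext f fun b => by
    rw [mul_apply_eq_comp, gnsMultiplier_coe,
      PositiveLinearMap.gnsNonUnitalStarAlgHom_apply_coe,
      PositiveLinearMap.gnsNonUnitalStarAlgHom_apply_coe,
      PositiveLinearMap.leftMulMapPreGNS_apply, PositiveLinearMap.leftMulMapPreGNS_apply]
    simp [X.central]

variable {B : Type v} [NonUnitalCStarAlgebra B] [PartialOrder B] [StarOrderedRing B]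

/-- The family of operators representing `X ⊗ Y`, for multipliers `X` and `Y`. -/
noncomputable def ambientMul (X : 𝓜(ℂ, A)) (Y : 𝓜(ℂ, B)) : TensorAmbient A B :=
  TensorAmbient.mk (fun f g => opTensor (gnsMultiplier f X) (gnsMultiplier g Y)) (‖X‖ * ‖Y‖)
    fun f g => (norm_opTensor_le _ _).trans (mul_le_mul (norm_gnsMultiplier_le f X)
      (norm_gnsMultiplier_le g Y) (norm_nonneg _) (norm_nonneg _))

theorem ambientMul_mul_tmul (X : 𝓜(ℂ, A)) (Y : 𝓜(ℂ, B)) (a : A) (b : B) :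
    ambientMul X Y * ambientTmul a b = ambientTmul (X.fst a) (Y.fst b) :=
  TensorAmbient.ext fun f g => by
    rw [map_mul, comp_ambientTmul, comp_ambientTmul, ambientMul, TensorAmbient.comp_mk,
      opTensor_mul, gnsMultiplier_mul, gnsMultiplier_mul]

theorem tmul_mul_ambientMul (X : 𝓜(ℂ, A)) (Y : 𝓜(ℂ, B)) (a : A) (b : B) :
    ambientTmul a b * ambientMul X Y = ambientTmul (X.snd a) (Y.snd b) :=
  TensorAmbient.ext fun f g => by
    rw [map_mul, comp_ambientTmul, comp_ambientTmul, ambientMul, TensorAmbient.comp_mk,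
      opTensor_mul, gns_mul_gnsMultiplier, gns_mul_gnsMultiplier]

theorem mem_of_tmul_mem {T : TensorAmbient A B →L[ℂ] TensorAmbient A B}
    (h : ∀ a b, T (ambientTmul a b) ∈ (algTensor A B).topologicalClosure)
    (z : MinTensor A B) : T (MinTensor.incl A B z) ∈ (algTensor A B).topologicalClosure := by
  refine MinTensor.denseRange_ofAlg.induction_on
    (p := fun z => T (MinTensor.incl A B z) ∈ (algTensor A B).topologicalClosure) z
    ?_ fun x => ?_
  · refine (algTensor A B).isClosed_topologicalClosure.preimage (T.continuous.comp ?_)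
    exact continuous_subtype_val
  · rw [MinTensor.incl_ofAlg]
    induction x using TensorProduct.induction_on with
    | zero => rw [map_zero, map_zero]; exact zero_mem _
    | add x y hx hy => rw [map_add, map_add]; exact add_mem hx hy
    | tmul a b => exact h a b

/-- The restriction to the minimal tensor product of an operator on the ambient algebra. -/
noncomputable def restrictAmbient (T : TensorAmbient A B →L[ℂ] TensorAmbient A B)
    (h : ∀ a b, T (ambientTmul a b) ∈ (algTensor A B).topologicalClosure) :
    MinTensor A B →L[ℂ] MinTensor A B :=
  LinearMap.mkContinuous
    { toFun := fun z => ⟨T (MinTensor.incl A B z), mem_of_tmul_mem h z⟩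
      map_add' := fun z w => Subtype.ext (map_add T (MinTensor.incl A B z) (MinTensor.incl A B w))
      map_smul' := fun c z => Subtype.ext (map_smul T c (MinTensor.incl A B z)) }
    ‖T‖ fun z => T.le_opNorm (MinTensor.incl A B z)

/-- The multiplier `X ⊗ Y` of the minimal tensor product, for multipliers `X` and `Y`. -/
noncomputable def multTensor (X : 𝓜(ℂ, A)) (Y : 𝓜(ℂ, B)) : 𝓜(ℂ, MinTensor A B) where
  fst := restrictAmbient (ContinuousLinearMap.mul ℂ _ (ambientMul X Y)) fun a b => by
    rw [ContinuousLinearMap.mul_apply', ambientMul_mul_tmul]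
    exact (MinTensor.tmul (X.fst a) (Y.fst b)).2
  snd := restrictAmbient ((ContinuousLinearMap.mul ℂ _).flip (ambientMul X Y)) fun a b => by
    rw [ContinuousLinearMap.flip_apply, ContinuousLinearMap.mul_apply', tmul_mul_ambientMul]
    exact (MinTensor.tmul (X.snd a) (Y.snd b)).2
  central z w := Subtype.ext
    (mul_assoc (MinTensor.incl A B z) (ambientMul X Y) (MinTensor.incl A B w))

theorem multTensor_fst_tmul (X : 𝓜(ℂ, A)) (Y : 𝓜(ℂ, B)) (a : A) (b : B) :
    (multTensor X Y).fst (MinTensor.tmul a b) = MinTensor.tmul (X.fst a) (Y.fst b) :=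
  Subtype.ext (ambientMul_mul_tmul X Y a b)

theorem multTensor_snd_tmul (X : 𝓜(ℂ, A)) (Y : 𝓜(ℂ, B)) (a : A) (b : B) :
    (multTensor X Y).snd (MinTensor.tmul a b) = MinTensor.tmul (X.snd a) (Y.snd b) :=
  Subtype.ext (tmul_mul_ambientMul X Y a b)

theorem multiplier_ext_tmul {X Y : 𝓜(ℂ, MinTensor A B)}
    (h : ∀ a b, X.fst (MinTensor.tmul a b) = Y.fst (MinTensor.tmul a b)) : X = Y :=
  multiplier_ext fun z => DFunLike.congr_fun (MinTensor.clm_ext h) z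

theorem multTensor_mul (X X' : 𝓜(ℂ, A)) (Y Y' : 𝓜(ℂ, B)) :
    multTensor X Y * multTensor X' Y' = multTensor (X * X') (Y * Y') :=
  multiplier_ext_tmul fun a b => by
    simp [DoubleCentralizer.mul_fst, multTensor_fst_tmul]

theorem star_multTensor (X : 𝓜(ℂ, A)) (Y : 𝓜(ℂ, B)) :
    star (multTensor X Y) = multTensor (star X) (star Y) :=
  multiplier_ext_tmul fun a b => by
    rw [DoubleCentralizer.star_fst, MinTensor.star_tmul, multTensor_snd_tmul, MinTensor.star_tmul,
      multTensor_fst_tmul, DoubleCentralizer.star_fst, DoubleCentralizer.star_fst]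

theorem multTensor_add_left (X X' : 𝓜(ℂ, A)) (Y : 𝓜(ℂ, B)) :
    multTensor (X + X') Y = multTensor X Y + multTensor X' Y :=
  multiplier_ext_tmul fun a b => by
    rw [DoubleCentralizer.add_fst, add_apply, multTensor_fst_tmul, multTensor_fst_tmul,
      multTensor_fst_tmul, DoubleCentralizer.add_fst, add_apply, MinTensor.tmul_add_left]

theorem multTensor_add_right (X : 𝓜(ℂ, A)) (Y Y' : 𝓜(ℂ, B)) :
    multTensor X (Y + Y') = multTensor X Y + multTensor X Y' :=
  multiplier_ext_tmul fun a b => by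
    rw [DoubleCentralizer.add_fst, add_apply, multTensor_fst_tmul, multTensor_fst_tmul,
      multTensor_fst_tmul, DoubleCentralizer.add_fst, add_apply, MinTensor.tmul_add_right]

end Multipliers

/-! ### Homomorphisms on minimal tensor products -/

section Hom

/-- A `*`-homomorphism is determined by, and exists for, prescribed values `v i` on elements `u i`
that are closed under products and adjoints and span a dense subspace, provided that the pairs
`(u i, v i)` are compatible with a separating family of functionals. -/
theorem exists_starHom {S T F : Type*} [NonUnitalCStarAlgebra S] [NonUnitalCStarAlgebra T]
    [NormedAddCommGroup F] [NormedSpace ℂ F] {ι J : Type*} (p : ι → S) (q : ι → T)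
    (hmul : ∀ i j, ∃ k, p i * p j = p k ∧ q i * q j = q k)
    (hstar : ∀ i, ∃ k, star (p i) = p k ∧ star (q i) = q k)
    (hdense : Dense (Submodule.span ℂ (Set.range p) : Set S))
    (s : J → S →L[ℂ] F) (t : J → T →L[ℂ] F) (hst : ∀ j i, s j (p i) = t j (q i))
    (hsep : ∀ y, (∀ j, t j y = 0) → y = 0) :
    ∃ Φ : S →⋆ₙₐ[ℂ] T, ∀ i, Φ (p i) = q i := by
  let M : Submodule ℂ (S × T) := Submodule.span ℂ (Set.range fun i => (p i, q i))
  have key : ∀ x ∈ M, star x ∈ M := by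
    intro x hx
    induction hx using Submodule.span_induction with
    | zero => rw [star_zero]; exact zero_mem _
    | add x x' _ _ hx hx' => rw [star_add]; exact add_mem hx hx'
    | smul c x _ hx => rw [star_smul]; exact M.smul_mem _ hx
    | mem x hx =>
      obtain ⟨i, rfl⟩ := hx
      obtain ⟨k, h1, h2⟩ := hstar i
      exact Submodule.subset_span ⟨k, Prod.ext h1.symm h2.symm⟩
  let G : NonUnitalStarSubalgebra ℂ (S × T) :=
    { M with
      mul_mem' := by
        intro x y hx hy
        change x * y ∈ M
        induction hx using Submodule.span_induction with
        | zero => rw [zero_mul]; exact zero_mem _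
        | add x x' _ _ hx hx' => rw [add_mul]; exact add_mem hx hx'
        | smul c x _ hx => rw [smul_mul_assoc]; exact M.smul_mem c hx
        | mem x hx =>
          obtain ⟨i, rfl⟩ := hx
          induction hy using Submodule.span_induction with
          | zero => rw [mul_zero]; exact zero_mem _
          | add x x' _ _ hx hx' => rw [mul_add]; exact add_mem hx hx'
          | smul c x _ hx => rw [mul_smul_comm]; exact M.smul_mem c hx
          | mem y hy =>
            obtain ⟨j, rfl⟩ := hy
            obtain ⟨k, h1, h2⟩ := hmul i j
            exact Submodule.subset_span ⟨k, Prod.ext h1.symm h2.symm⟩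
      star_mem' := fun hx => key _ hx }
  have hGc : IsClosed (G.topologicalClosure : Set (S × T)) := G.isClosed_topologicalClosure
  have hG : ∀ x ∈ G.topologicalClosure, ∀ j, s j x.1 = t j x.2 := by
    intro x hx j
    have hx' : x ∈ closure (M : Set (S × T)) := hx
    refine closure_minimal (s := (M : Set (S × T))) (t := {x | s j x.1 = t j x.2}) ?_
      (isClosed_eq (by fun_prop) (by fun_prop)) hx'
    intro x hx
    induction hx using Submodule.span_induction with
    | zero => simp
    | add x y _ _ hx hy => simp_all
    | smul c x _ hx => simp_all
    | mem x hx => obtain ⟨i, rfl⟩ := hx; exact hst j i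
  let π₁ : G.topologicalClosure →⋆ₙₐ[ℂ] S :=
    (NonUnitalStarAlgHom.fst ℂ S T).comp
      (NonUnitalStarSubalgebraClass.subtype G.topologicalClosure)
  let π₂ : G.topologicalClosure →⋆ₙₐ[ℂ] T :=
    (NonUnitalStarAlgHom.snd ℂ S T).comp
      (NonUnitalStarSubalgebraClass.subtype G.topologicalClosure)
  have hinj : Function.Injective π₁ := by
    rw [injective_iff_map_eq_zero]
    rintro ⟨⟨x, y⟩, hxy⟩ h
    have hx : x = 0 := h
    subst hx
    have hy : y = 0 := hsep y fun j => by
      have := hG _ hxy j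
      simpa using this.symm
    subst hy
    rfl
  have hiso : Isometry π₁ := NonUnitalStarAlgHom.isometry π₁ hinj
  have hsurj : Function.Surjective π₁ := by
    have hcl : IsClosed (Set.range π₁) := hiso.isClosedEmbedding.isClosed_range
    have hsub : (Submodule.span ℂ (Set.range p) : Set S) ⊆ Set.range π₁ := by
      intro x hx
      induction hx using Submodule.span_induction with
      | zero => exact ⟨0, map_zero _⟩
      | add x y _ _ hx hy =>
        obtain ⟨a, rfl⟩ := hx
        obtain ⟨b, rfl⟩ := hy
        exact ⟨a + b, map_add _ _ _⟩
      | smul c x _ hx =>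
        obtain ⟨a, rfl⟩ := hx
        exact ⟨c • a, map_smul _ _ _⟩
      | mem x hx =>
        obtain ⟨i, rfl⟩ := hx
        exact ⟨⟨(p i, q i), G.le_topologicalClosure (Submodule.subset_span ⟨i, rfl⟩)⟩, rfl⟩
    intro x
    exact hcl.closure_subset_iff.2 hsub (hdense x)
  let e := StarAlgEquiv.ofBijective π₁ ⟨hinj, hsurj⟩
  refine ⟨π₂.comp (e.symm : S →⋆ₙₐ[ℂ] G.topologicalClosure), fun i => ?_⟩
  let g : G.topologicalClosure :=
    ⟨(p i, q i), G.le_topologicalClosure (Submodule.subset_span ⟨i, rfl⟩)⟩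
  have : e.symm (p i) = g := by
    rw [StarAlgEquiv.symm_apply_eq]; rfl
  change π₂ (e.symm (p i)) = q i
  rw [this]
  rfl



/-- Evaluation `X ↦ X z` of multipliers. -/
noncomputable def multEval {T : Type*} [NonUnitalCStarAlgebra T] (z : T) : 𝓜(ℂ, T) →L[ℂ] T :=
  LinearMap.mkContinuous
    { toFun := fun X => X.fst z
      map_add' := fun _ _ => rfl
      map_smul' := fun _ _ => rfl } ‖z‖ fun X => by
    rw [mul_comm, ← DoubleCentralizer.norm_fst]; exact X.fst.le_opNorm z

@[simp] theorem multEval_apply {T : Type*} [NonUnitalCStarAlgebra T] (z : T) (X : 𝓜(ℂ, T)) :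
    multEval z X = X.fst z := rfl

/-- A `*`-homomorphism between C*-algebras as a continuous linear map. -/
noncomputable def homCLM {S T : Type*} [NonUnitalCStarAlgebra S] [NonUnitalCStarAlgebra T]
    (φ : S →⋆ₙₐ[ℂ] T) : S →L[ℂ] T :=
  LinearMap.mkContinuous
    { toFun := φ
      map_add' := map_add φ
      map_smul' := map_smul φ } 1 fun x => by
    rw [one_mul]; exact NonUnitalStarAlgHom.norm_apply_le φ x

@[simp] theorem homCLM_apply {S T : Type*} [NonUnitalCStarAlgebra S] [NonUnitalCStarAlgebra T]
    (φ : S →⋆ₙₐ[ℂ] T) (x : S) : homCLM φ x = φ x := rfl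

theorem coe_mult_mul {A : Type*} [NonUnitalCStarAlgebra A] (a b : A) :
    ((a * b : A) : 𝓜(ℂ, A)) = (a : 𝓜(ℂ, A)) * (b : 𝓜(ℂ, A)) :=
  map_mul (DoubleCentralizer.coeHom (𝕜 := ℂ) (A := A)) a b

theorem coe_mult_star {A : Type*} [NonUnitalCStarAlgebra A] (a : A) :
    ((star a : A) : 𝓜(ℂ, A)) = star (a : 𝓜(ℂ, A)) :=
  map_star (DoubleCentralizer.coeHom (𝕜 := ℂ) (A := A)) a

variable {A B C : Type*} [NonUnitalCStarAlgebra A] [PartialOrder A] [StarOrderedRing A]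
  [NonUnitalCStarAlgebra B] [PartialOrder B] [StarOrderedRing B]
  [NonUnitalCStarAlgebra C] [PartialOrder C] [StarOrderedRing C]

theorem dense_span_tmul : Dense (Submodule.span ℂ
    (Set.range fun i : A × B => MinTensor.tmul i.1 i.2) : Set (MinTensor A B)) := by
  refine MinTensor.denseRange_ofAlg.mono ?_
  rintro _ ⟨x, rfl⟩
  induction x using TensorProduct.induction_on with
  | zero => rw [map_zero]; exact zero_mem _
  | add x y hx hy => rw [map_add]; exact add_mem hx hy
  | tmul a b => exact Submodule.subset_span ⟨(a, b), rfl⟩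

theorem exists_homTensorId (φ : A →⋆ₙₐ[ℂ] 𝓜(ℂ, C)) :
    ∃ Φ : MinTensor A B →⋆ₙₐ[ℂ] 𝓜(ℂ, MinTensor C B), ∀ i : A × B,
      Φ (MinTensor.tmul i.1 i.2) = multTensor (φ i.1) (i.2 : 𝓜(ℂ, B)) := by
  refine exists_starHom (F := C) (J := (B →L[ℂ] ℂ) × C × B) _ _ ?_ ?_ dense_span_tmul
    (fun j => multEval j.2.1 ∘L homCLM φ ∘L
      sliceRight (j.1 ∘L (ContinuousLinearMap.mul ℂ B).flip j.2.2))
    (fun j => sliceRight j.1 ∘L multEval (MinTensor.tmul j.2.1 j.2.2)) ?_ ?_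
  · intro i j
    refine ⟨(i.1 * j.1, i.2 * j.2), MinTensor.tmul_mul _ _ _ _, ?_⟩
    rw [multTensor_mul, map_mul, coe_mult_mul]
  · intro i
    refine ⟨(star i.1, star i.2), MinTensor.star_tmul _ _, ?_⟩
    rw [star_multTensor, map_star, coe_mult_star]
  · rintro ⟨χ, c, d⟩ ⟨a, b⟩
    simp [multTensor_fst_tmul]
  · intro Y hY
    refine multiplier_ext_tmul fun c d => ?_
    exact MinTensor.eq_zero_of_slices_right fun χ => hY (χ, c, d)

/-- The homomorphism `φ ⊗ id : A ⊗ B → M(C ⊗ B)` for a homomorphism `φ : A → M(C)`. -/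
noncomputable def homTensorId (φ : A →⋆ₙₐ[ℂ] 𝓜(ℂ, C)) :
    MinTensor A B →⋆ₙₐ[ℂ] 𝓜(ℂ, MinTensor C B) :=
  (exists_homTensorId φ).choose

theorem homTensorId_tmul (φ : A →⋆ₙₐ[ℂ] 𝓜(ℂ, C)) (a : A) (b : B) :
    homTensorId φ (MinTensor.tmul a b) = multTensor (φ a) (b : 𝓜(ℂ, B)) :=
  (exists_homTensorId φ).choose_spec (a, b)

theorem exists_idTensorHom (φ : B →⋆ₙₐ[ℂ] 𝓜(ℂ, C)) :
    ∃ Φ : MinTensor A B →⋆ₙₐ[ℂ] 𝓜(ℂ, MinTensor A C), ∀ i : A × B,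
      Φ (MinTensor.tmul i.1 i.2) = multTensor (i.1 : 𝓜(ℂ, A)) (φ i.2) := by
  refine exists_starHom (F := C) (J := (A →L[ℂ] ℂ) × A × C) _ _ ?_ ?_ dense_span_tmul
    (fun j => multEval j.2.2 ∘L homCLM φ ∘L
      sliceLeft (j.1 ∘L (ContinuousLinearMap.mul ℂ A).flip j.2.1))
    (fun j => sliceLeft j.1 ∘L multEval (MinTensor.tmul j.2.1 j.2.2)) ?_ ?_
  · intro i j
    refine ⟨(i.1 * j.1, i.2 * j.2), MinTensor.tmul_mul _ _ _ _, ?_⟩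
    rw [multTensor_mul, map_mul, coe_mult_mul]
  · intro i
    refine ⟨(star i.1, star i.2), MinTensor.star_tmul _ _, ?_⟩
    rw [star_multTensor, map_star, coe_mult_star]
  · rintro ⟨χ, c, d⟩ ⟨a, b⟩
    simp [multTensor_fst_tmul]
  · intro Y hY
    refine multiplier_ext_tmul fun c d => ?_
    exact MinTensor.eq_zero_of_slices_left fun χ => hY (χ, c, d)

/-- The homomorphism `id ⊗ φ : A ⊗ B → M(A ⊗ C)` for a homomorphism `φ : B → M(C)`. -/
noncomputable def idTensorHom (φ : B →⋆ₙₐ[ℂ] 𝓜(ℂ, C)) :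
    MinTensor A B →⋆ₙₐ[ℂ] 𝓜(ℂ, MinTensor A C) :=
  (exists_idTensorHom φ).choose

theorem idTensorHom_tmul (φ : B →⋆ₙₐ[ℂ] 𝓜(ℂ, C)) (a : A) (b : B) :
    idTensorHom φ (MinTensor.tmul a b) = multTensor (a : 𝓜(ℂ, A)) (φ b) :=
  (exists_idTensorHom φ).choose_spec (a, b)

theorem MinTensor.norm_tmul_le (a : A) (b : B) : ‖MinTensor.tmul a b‖ ≤ ‖a‖ * ‖b‖ := by
  rw [← MinTensor.norm_incl, MinTensor.incl_tmul]
  exact lp.norm_le_of_forall_le (by positivity) fun p => (norm_opTensor_le _ _).trans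
    (mul_le_mul (NonUnitalStarAlgHom.norm_apply_le p.1.gnsNonUnitalStarAlgHom a)
        (NonUnitalStarAlgHom.norm_apply_le p.2.gnsNonUnitalStarAlgHom b)
        (norm_nonneg _) (norm_nonneg _))

/-- The map `(a, b) ↦ a ⊗ b` as a continuous bilinear map. -/
noncomputable def MinTensor.tmulL : A →L[ℂ] B →L[ℂ] MinTensor A B :=
  LinearMap.mkContinuous₂ (LinearMap.mk₂ ℂ MinTensor.tmul MinTensor.tmul_add_left
    MinTensor.tmul_smul_left MinTensor.tmul_add_right MinTensor.tmul_smul_right) 1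
    fun a b => by rw [one_mul]; exact MinTensor.norm_tmul_le a b

@[simp] theorem MinTensor.tmulL_apply (a : A) (b : B) :
    MinTensor.tmulL a b = MinTensor.tmul a b := rfl

theorem dense_span_tmul_tmul : Dense (Submodule.span ℂ
    (Set.range fun i : A × B × C => MinTensor.tmul (MinTensor.tmul i.1 i.2.1) i.2.2) :
    Set (MinTensor (MinTensor A B) C)) := by
  set M := Submodule.span ℂ
    (Set.range fun i : A × B × C => MinTensor.tmul (MinTensor.tmul i.1 i.2.1) i.2.2)
  have h1 : ∀ (z : MinTensor A B) (c : C), MinTensor.tmul z c ∈ M.topologicalClosure := by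
    intro z c
    refine MinTensor.denseRange_ofAlg.induction_on
      (p := fun z => MinTensor.tmul z c ∈ M.topologicalClosure) z ?_ fun x => ?_
    · exact M.isClosed_topologicalClosure.preimage
        ((MinTensor.tmulL (A := MinTensor A B) (B := C)).flip c).continuous
    · induction x using TensorProduct.induction_on with
      | zero => 
        rw [map_zero, ← zero_smul ℂ (0 : MinTensor A B), MinTensor.tmul_smul_left, zero_smul]
        exact zero_mem _
      | add x y hx hy => rw [map_add, MinTensor.tmul_add_left]; exact add_mem hx hy
      | tmul a b => exact M.le_topologicalClosure (Submodule.subset_span ⟨(a, b, c), rfl⟩)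
  have h2 : Submodule.span ℂ (Set.range fun i : MinTensor A B × C => MinTensor.tmul i.1 i.2) ≤
      M.topologicalClosure :=
    Submodule.span_le.2 (by rintro _ ⟨⟨z, c⟩, rfl⟩; exact h1 z c)
  intro x
  have h3 := closure_mono (SetLike.coe_subset_coe.2 h2) (dense_span_tmul x)
  rwa [Submodule.topologicalClosure_coe, closure_closure] at h3

variable (A B C) in
theorem exists_assocHom :
    ∃ Φ : MinTensor (MinTensor A B) C →⋆ₙₐ[ℂ] MinTensor A (MinTensor B C), ∀ i : A × B × C,
      Φ (MinTensor.tmul (MinTensor.tmul i.1 i.2.1) i.2.2) =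
        MinTensor.tmul i.1 (MinTensor.tmul i.2.1 i.2.2) := by
  refine exists_starHom (F := C) (J := (A →L[ℂ] ℂ) × (B →L[ℂ] ℂ)) _ _ ?_ ?_ dense_span_tmul_tmul
    (fun j => sliceLeft (j.2 ∘L sliceLeft j.1))
    (fun j => sliceLeft j.2 ∘L sliceLeft j.1) ?_ ?_
  · intro i j
    refine ⟨(i.1 * j.1, i.2.1 * j.2.1, i.2.2 * j.2.2), ?_, ?_⟩
    · rw [MinTensor.tmul_mul, MinTensor.tmul_mul]
    · rw [MinTensor.tmul_mul, MinTensor.tmul_mul]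
  · intro i
    refine ⟨(star i.1, star i.2.1, star i.2.2), ?_, ?_⟩
    · rw [MinTensor.star_tmul, MinTensor.star_tmul]
    · rw [MinTensor.star_tmul, MinTensor.star_tmul]
  · rintro ⟨χ, χ'⟩ ⟨a, b, c⟩
    simp [mul_smul]
  · intro y hy
    exact MinTensor.eq_zero_of_slices_left fun χ =>
      MinTensor.eq_zero_of_slices_left fun χ' => hy (χ, χ')

variable (A B C) in
/-- The associativity isomorphism `(A ⊗ B) ⊗ C → A ⊗ (B ⊗ C)`. -/
noncomputable def assocHom : MinTensor (MinTensor A B) C →⋆ₙₐ[ℂ] MinTensor A (MinTensor B C) :=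
  (exists_assocHom A B C).choose

theorem assocHom_tmul (a : A) (b : B) (c : C) :
    assocHom A B C (MinTensor.tmul (MinTensor.tmul a b) c) =
      MinTensor.tmul a (MinTensor.tmul b c) :=
  (exists_assocHom A B C).choose_spec (a, b, c)

theorem assocHom_injective : Function.Injective (assocHom A B C) := by
  rw [injective_iff_map_eq_zero]
  intro z hz
  refine MinTensor.eq_zero_of_slices_right fun χ => MinTensor.eq_zero_of_slices_right fun χ' =>
    (DFunLike.ext_iff.1 (?_ : sliceRight χ' ∘L sliceRight χ =
      sliceRight (χ ∘L sliceLeft χ') ∘L homCLM (assocHom A B C)) z).trans ?_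
  · have h : ∀ i : A × B × C, (sliceRight χ' ∘L sliceRight χ)
        (MinTensor.tmul (MinTensor.tmul i.1 i.2.1) i.2.2) =
        (sliceRight (χ ∘L sliceLeft χ') ∘L homCLM (assocHom A B C))
        (MinTensor.tmul (MinTensor.tmul i.1 i.2.1) i.2.2) := by
      rintro ⟨a, b, c⟩
      simp [assocHom_tmul, smul_smul, mul_comm]
    refine ContinuousLinearMap.ext_on dense_span_tmul_tmul ?_
    rintro _ ⟨i, rfl⟩
    exact h i
  · rw [ContinuousLinearMap.comp_apply, homCLM_apply, hz, map_zero]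

end Hom

/-! ### The strict topology -/

section Strict

variable {A : Type u} [NonUnitalCStarAlgebra A]

/-- Strict convergence in the multiplier algebra: `f i * a → m * a` and `a * f i → a * m` in norm
for all `a` in the algebra. -/
def StrictTendsto {ι : Type*} (f : ι → 𝓜(ℂ, A)) (l : Filter ι) (m : 𝓜(ℂ, A)) : Prop :=
  ∀ a : A, Tendsto (fun i => (f i).fst a) l (nhds (m.fst a)) ∧
    Tendsto (fun i => (f i).snd a) l (nhds (m.snd a))

theorem StrictTendsto.unique {ι : Type*} {f : ι → 𝓜(ℂ, A)} {l : Filter ι} [l.NeBot]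
    {m m' : 𝓜(ℂ, A)} (h : StrictTendsto f l m) (h' : StrictTendsto f l m') : m = m' :=
  multiplier_ext fun a => tendsto_nhds_unique (h a).1 (h' a).1

/-- The strict limit of a family of multipliers, if it exists. -/
noncomputable def strictLim {ι : Type*} (l : Filter ι) (f : ι → 𝓜(ℂ, A)) : 𝓜(ℂ, A) :=
  Classical.epsilon fun m => StrictTendsto f l m

theorem StrictTendsto.strictLim_eq {ι : Type*} {f : ι → 𝓜(ℂ, A)} {l : Filter ι} [l.NeBot]
    {m : 𝓜(ℂ, A)} (h : StrictTendsto f l m) : strictLim l f = m :=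
  (Classical.epsilon_spec (p := fun m => StrictTendsto f l m) ⟨m, h⟩).unique h

/-- The unordered sum of the family `f` converges strictly to `m`. -/
def HasStrictSum {ι : Type*} (f : ι → 𝓜(ℂ, A)) (m : 𝓜(ℂ, A)) : Prop :=
  StrictTendsto (fun s : Finset ι => ∑ i ∈ s, f i) atTop m

/-- The sum of a family of multipliers in the strict topology, if it converges. -/
noncomputable def strictSum {ι : Type*} (f : ι → 𝓜(ℂ, A)) : 𝓜(ℂ, A) :=
  strictLim atTop fun s : Finset ι => ∑ i ∈ s, f i

variable [PartialOrder A] [StarOrderedRing A]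

/-- The value at a multiplier `m` of the strictly continuous extension to the multiplier algebra of
a map `f : A → M(B)`: the strict limit of `f (m * e)`, with `e` running through the canonical
approximate unit of `A`. -/
noncomputable def strictExt {B : Type*} [NonUnitalCStarAlgebra B] (f : A → 𝓜(ℂ, B))
    (m : 𝓜(ℂ, A)) : 𝓜(ℂ, B) :=
  strictLim (CStarAlgebra.approximateUnit A) fun e => f (m.fst e)

/-- The value at a multiplier of the strictly continuous extension of a bounded functional. -/
noncomputable def evalMult (ω : A →L[ℂ] ℂ) (m : 𝓜(ℂ, A)) : ℂ :=
  limUnder (CStarAlgebra.approximateUnit A) fun e => ω (m.fst e)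

variable {B : Type v} [NonUnitalCStarAlgebra B] [PartialOrder B] [StarOrderedRing B]

/-- The slice `(ω ⊗ id)(X)` of a multiplier `X` of `A ⊗ B`. -/
noncomputable def sliceMultLeft (ω : A →L[ℂ] ℂ) (X : 𝓜(ℂ, MinTensor A B)) : 𝓜(ℂ, B) :=
  strictExt (fun z : MinTensor A B => ((sliceLeft ω z : B) : 𝓜(ℂ, B))) X

/-- The slice `(id ⊗ ω)(X)` of a multiplier `X` of `A ⊗ B`. -/
noncomputable def sliceMultRight (ω : B →L[ℂ] ℂ) (X : 𝓜(ℂ, MinTensor A B)) : 𝓜(ℂ, A) :=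
  strictExt (fun z : MinTensor A B => ((sliceRight ω z : A) : 𝓜(ℂ, A))) X

/-- The element `m* a m`, for a multiplier `m`. -/
noncomputable def compress (m : 𝓜(ℂ, A)) (a : A) : A := (star m).fst (m.snd a)

theorem compress_nonneg (m : 𝓜(ℂ, A)) {a : A} (ha : 0 ≤ a) : 0 ≤ compress m a := by
  obtain ⟨b, rfl⟩ := CStarAlgebra.nonneg_iff_eq_star_mul_self.1 ha
  have h : m.snd (star b * b) = star b * m.snd b := by
    refine sub_eq_zero.1 ?_
    have h1 : ∀ c, (m.snd (star b * b) - star b * m.snd b) * c = 0 := fun c => by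
      rw [sub_mul, m.central, mul_assoc, mul_assoc, m.central, sub_self]
    rw [← CStarRing.mul_star_self_eq_zero_iff]
    exact h1 _
  rw [compress, h, multiplier_fst_mul, DoubleCentralizer.star_fst, star_star]
  exact star_mul_self_nonneg _

end Strict

/-! ### Partial compact quantum groups -/

section Main

variable (I : Type v) (A : Type u) [NonUnitalCStarAlgebra A] [PartialOrder A] [StarOrderedRing A]

/-- A C*-algebraic `I`-partial compact quantum semigroup with underlying C*-algebra `A`. -/
structure PartialCompactQuantumSemigroup where
  /-- The projections `1_{kl}`. -/
  unit : I → I → A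
  /-- The comultiplication `Δ`. -/
  comul : A →⋆ₙₐ[ℂ] 𝓜(ℂ, MinTensor A A)
  isStarProjection_unit : ∀ k l, IsStarProjection (unit k l)
  unit_mul_unit : ∀ k l k' l', (k, l) ≠ (k', l') → unit k l * unit k' l' = 0
  hasStrictSum_unit : HasStrictSum (fun p : I × I => (unit p.1 p.2 : 𝓜(ℂ, A))) 1
  comul_unit : ∀ k l, HasStrictSum
    (fun m => (MinTensor.tmul (unit k m) (unit m l) : 𝓜(ℂ, MinTensor A A))) (comul (unit k l))
  /-- `(Δ ⊗ id)Δ(a) = (id ⊗ Δ)Δ(a)`, where the multipliers of `(A ⊗ A) ⊗ A` and of `A ⊗ (A ⊗ A)` are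
  compared along the associativity isomorphism. -/
  coassoc : ∀ a z, assocHom A A A ((strictExt (homTensorId comul) (comul a)).fst z) =
    (strictExt (idTensorHom comul) (comul a)).fst (assocHom A A A z)

variable {I A}

namespace PartialCompactQuantumSemigroup

variable (G : PartialCompactQuantumSemigroup I A)

/-- The source projection `λ_k = ∑_m 1_{km}`. -/
noncomputable def source (k : I) : 𝓜(ℂ, A) := strictSum fun m => (G.unit k m : 𝓜(ℂ, A))

/-- The target projection `ρ_m = ∑_k 1_{km}`. -/
noncomputable def target (m : I) : 𝓜(ℂ, A) := strictSum fun k => (G.unit k m : 𝓜(ℂ, A))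

/-- The projection `P = ∑_k 1_{kk}`. -/
noncomputable def diag : 𝓜(ℂ, A) := strictSum fun k => (G.unit k k : 𝓜(ℂ, A))

/-- The projection `Δ(1) = ∑_{k,l,m} 1_{km} ⊗ 1_{ml}`. -/
noncomputable def comulOne : 𝓜(ℂ, MinTensor A A) :=
  strictSum fun p : I × I × I =>
    (MinTensor.tmul (G.unit p.1 p.2.2) (G.unit p.2.2 p.2.1) : 𝓜(ℂ, MinTensor A A))

end PartialCompactQuantumSemigroup

variable (I A)

/-- A C*-algebraic `I`-partial compact quantum group with underlying C*-algebra `A`. -/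
structure PartialCompactQuantumGroup extends PartialCompactQuantumSemigroup I A where
  unit_self_ne_zero : ∀ k, unit k k ≠ 0
  /-- `(A ⊗ A)Δ(1) = [(A ⊗ 1)Δ(A)]`. -/
  density_left :
    {Y | ∃ z : MinTensor A A,
      Y = (z : 𝓜(ℂ, MinTensor A A)) * toPartialCompactQuantumSemigroup.comulOne} =
    closure (Submodule.span ℂ {Y | ∃ a b : A,
      Y = multTensor (a : 𝓜(ℂ, A)) (1 : 𝓜(ℂ, A)) * comul b} : Set 𝓜(ℂ, MinTensor A A))
  /-- `(A ⊗ A)Δ(1) = [(1 ⊗ A)Δ(A)]`. -/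
  density_right :
    {Y | ∃ z : MinTensor A A,
      Y = (z : 𝓜(ℂ, MinTensor A A)) * toPartialCompactQuantumSemigroup.comulOne} =
    closure (Submodule.span ℂ {Y | ∃ a b : A,
      Y = multTensor (1 : 𝓜(ℂ, A)) (a : 𝓜(ℂ, A)) * comul b} : Set 𝓜(ℂ, MinTensor A A))
  /-- `A = [(ω ⊗ id)Δ(PAP) | ω ∈ A*]`. -/
  density_diag_left :
    Set.range (fun a : A => (a : 𝓜(ℂ, A))) =
    closure (Submodule.span ℂ {Y | ∃ (ω : A →L[ℂ] ℂ) (b : A),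
      Y = sliceMultLeft ω (comul (compress toPartialCompactQuantumSemigroup.diag b))} :
        Set 𝓜(ℂ, A))
  /-- `A = [(id ⊗ ω)Δ(PAP) | ω ∈ A*]`. -/
  density_diag_right :
    Set.range (fun a : A => (a : 𝓜(ℂ, A))) =
    closure (Submodule.span ℂ {Y | ∃ (ω : A →L[ℂ] ℂ) (b : A),
      Y = sliceMultRight ω (comul (compress toPartialCompactQuantumSemigroup.diag b))} :
        Set 𝓜(ℂ, A))

/-- A weight on `A`: an additive and positively homogeneous map from the cone of positive elements
to `[0, ∞]`, with `0 * ∞ = 0`. -/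
structure Weight where
  toFun : {a : A // 0 ≤ a} → ℝ≥0∞
  map_add' : ∀ a b : {a : A // 0 ≤ a},
    toFun ⟨(a : A) + (b : A), add_nonneg a.2 b.2⟩ = toFun a + toFun b
  map_smul' : ∀ (c : NNReal) (a : {a : A // 0 ≤ a}),
    toFun ⟨(c : ℝ) • (a : A), smul_nonneg c.2 a.2⟩ = (c : ℝ≥0∞) * toFun a

variable {I A}

instance : CoeFun (Weight A) fun _ => {a : A // 0 ≤ a} → ℝ≥0∞ := ⟨Weight.toFun⟩

/-- The functional `ω` is a state: positive and of norm one. -/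
def IsState (ω : A →L[ℂ] ℂ) : Prop := (∀ a, 0 ≤ a → 0 ≤ ω a) ∧ ‖ω‖ = 1

/-- The element `m* a m` of the positive cone. -/
noncomputable def compressPos (m : 𝓜(ℂ, A)) (a : {a : A // 0 ≤ a}) : {a : A // 0 ≤ a} :=
  ⟨compress m a, compress_nonneg m a.2⟩

/-- The weight `φ` is an invariant integral. In the two invariance conditions the number
`ω(λ_k) ≥ 0` is the value at `λ_k` of the strictly continuous extension of the state `ω`. -/
structure PartialCompactQuantumSemigroup.IsInvariantIntegral
    (G : PartialCompactQuantumSemigroup I A) (φ : Weight A) : Prop where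
  unit_eq_one : ∀ k m, G.unit k m ≠ 0 →
    φ ⟨G.unit k m, (G.isStarProjection_unit k m).nonneg⟩ = 1
  eq_tsum : ∀ a : {a : A // 0 ≤ a},
    φ a = ∑' p : I × I, φ (compressPos (G.unit p.1 p.2 : 𝓜(ℂ, A)) a)
  left_invariant : ∀ (a : {a : A // 0 ≤ a}) (ω : A →L[ℂ] ℂ), IsState ω →
    ∃ x : {a : A // 0 ≤ a}, ((x : A) : 𝓜(ℂ, A)) = sliceMultLeft ω (G.comul (a : A)) ∧
      φ x = ∑' k : I, ENNReal.ofReal (evalMult ω (G.source k)).re *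
        φ (compressPos (G.source k) a)
  right_invariant : ∀ (a : {a : A // 0 ≤ a}) (ω : A →L[ℂ] ℂ), IsState ω →
    ∃ x : {a : A // 0 ≤ a}, ((x : A) : 𝓜(ℂ, A)) = sliceMultRight ω (G.comul (a : A)) ∧
      φ x = ∑' m : I, ENNReal.ofReal (evalMult ω (G.target m)).re *
        φ (compressPos (G.target m) a)

end Main

end PartialCQG

/-!
The proof is a Haar measure argument in each corner of the algebra, which is then transported to
all corners by convolution.

Write `u k m` for the projections `1_{km}`. Cutting `Δ(a)` by `u j k ⊗ u k m` on the left and by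
`u j' k' ⊗ u k' m'` on the right gives an element of `A ⊗ A`, so bounded functionals on `A` have
convolution products indexed by these cells. Coassociativity makes them associative with matching
indices (`PartialCompactQuantumSemigroup.conv_assoc`). No antipode and no representation theory is
needed.

* For a diagonal corner `(k, k)`, the corner states form a semigroup under convolution which is
  compact in the weak-* topology. For a single corner state, a limit point of the Cesàro means of
  its powers is invariant (`Frame.exists_invariant`). The step of Maes and Van Daele,
  `Frame.conv_eq_of_le`, passes from a state to the states that it dominates; it rests on the
  density of `(A ⊗ 1)Δ(A)` in `(A ⊗ A)Δ(1)`. By compactness there is a state `h k` invariant under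
  all corner states (`Frame.exists_haar`).
* Since the slices of `Δ(PAP)` are dense, a functional of a corner is determined by its
  convolutions into the diagonal corners (`Frame.eq_zero_of_forall_conv`). Therefore the
  convolution of a functional `ω` on the corner `(k, m)` with `h m` only depends on `ω(u k m)`: it
  is `ω(u k m) • φ k m` for a state `φ k m` of that corner. The symmetric construction, starting
  from `h k`, gives the same `φ k m`, so that the family is left and right invariant
  (`Frame.exists_isHaarSystem`).
* The sum of the `φ k m` is an invariant weight. Summing up the corners of a slice `(ω ⊗ id)Δ(a)`
  is justified by the fact that every bounded functional `ω` is the norm limit of `ω(p · p)`, for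
  `p` the finite sums of the projections `u k m` (`tendsto_norm_sub_mulFun`). This also shows that
  the slices lie in `A` (`Frame.exists_slice`).
* Conversely, for `a` in the corner `(k, m)` the slice of `Δ(a)` by `φ k k = h k` is
  `φ k m a • u k m` (`Frame.IsHaarSystem.slice_corner`), so left invariance forces every invariant
  integral to agree with `φ k m` on that corner.

Left and right are exchanged by means of the leg-symmetric data `Frame` and its opposite
`Frame.op`.
-/

namespace PartialCQG

/-! ### Bounded functionals on C*-algebras -/

section Functionals

open Topology

/-- A limit may be interchanged with a uniform approximation. -/
theorem tendsto_of_uniform_approx {E ι κ : Type*} [SeminormedAddCommGroup E] {l : Filter ι}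
    {l' : Filter κ} [l'.NeBot] {f : ι → E} {g : κ → ι → E} {y : κ → E} {x : E} {δ : κ → ℝ}
    (hg : ∀ n, Tendsto (g n) l (𝓝 (y n))) (hy : Tendsto y l' (𝓝 x)) (hδ : Tendsto δ l' (𝓝 0))
    (hfg : ∀ n, ∀ᶠ i in l, ‖f i - g n i‖ ≤ δ n) : Tendsto f l (𝓝 x) := by
  rw [Metric.tendsto_nhds]
  intro ε hε
  have h1 := (Metric.tendsto_nhds.1 hy) (ε / 3) (by positivity)
  have h2 := hδ.eventually_lt_const (show (0 : ℝ) < ε / 3 by positivity)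
  obtain ⟨n, hn1, hn2⟩ := (h1.and h2).exists
  filter_upwards [hfg n, (Metric.tendsto_nhds.1 (hg n)) (ε / 3) (by positivity)] with i h3 h4
  rw [dist_eq_norm] at *
  calc ‖f i - x‖ = ‖(f i - g n i) + (g n i - y n) + (y n - x)‖ := by congr 1; abel
    _ ≤ ‖f i - g n i‖ + ‖g n i - y n‖ + ‖y n - x‖ := norm_add₃_le
    _ < ε := by linarith

/-- Operators that are eventually bounded by a constant and converge on a set with dense span
converge everywhere. -/
theorem exists_tendsto_of_dense_span {E F ι : Type*} [NormedAddCommGroup E] [NormedSpace ℂ E]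
    [NormedAddCommGroup F] [NormedSpace ℂ F] [CompleteSpace F] {l : Filter ι} [l.NeBot]
    (T : ι → E →L[ℂ] F) {c : ℝ} (hc : ∀ᶠ i in l, ‖T i‖ ≤ c) {M : Set E}
    (hM : Dense (Submodule.span ℂ M : Set E))
    (h : ∀ z ∈ M, ∃ y, Tendsto (fun i => T i z) l (𝓝 y)) (z : E) :
    ∃ y, Tendsto (fun i => T i z) l (𝓝 y) := by
  have h0 : 0 ≤ c := by
    obtain ⟨i, hi⟩ := hc.exists
    exact (norm_nonneg _).trans hi
  have hspan : ∀ z ∈ Submodule.span ℂ M, ∃ y, Tendsto (fun i => T i z) l (𝓝 y) := by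
    intro z hz
    induction hz using Submodule.span_induction with
    | mem z hz => exact h z hz
    | zero => exact ⟨0, by simp⟩
    | add x y _ _ hx hy =>
      obtain ⟨a, ha⟩ := hx
      obtain ⟨b, hb⟩ := hy
      exact ⟨a + b, by simpa using ha.add hb⟩
    | smul r x _ hx =>
      obtain ⟨a, ha⟩ := hx
      exact ⟨r • a, by simpa using ha.const_smul r⟩
  refine cauchy_map_iff_exists_tendsto.1 ?_
  refine ⟨inferInstance, ?_⟩
  rw [Metric.uniformity_basis_dist.ge_iff]
  intro ε hε
  obtain ⟨w, hw, hwz⟩ := Metric.dense_iff.1 hM z (ε / (4 * (c + 1))) (by positivity)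
  obtain ⟨y, hy⟩ := hspan w hwz
  have hd : ∀ᶠ i in l, dist (T i z) y < ε / 2 := by
    filter_upwards [hc, (Metric.tendsto_nhds.1 hy) (ε / 4) (by positivity)] with i h1 h2
    have h3 : dist (T i z) (T i w) ≤ ε / 4 := by
      rw [dist_eq_norm, ← map_sub]
      refine ((T i).le_opNorm _).trans ?_
      rw [Metric.mem_ball, dist_comm, dist_eq_norm] at hw
      calc ‖T i‖ * ‖z - w‖ ≤ (c + 1) * (ε / (4 * (c + 1))) := by gcongr; linarith
        _ = ε / 4 := by field_simp
    calc dist (T i z) y ≤ dist (T i z) (T i w) + dist (T i w) y := dist_triangle _ _ _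
      _ < ε / 2 := by linarith
  rw [mem_prod_iff]
  refine ⟨_, image_mem_map hd, _, image_mem_map hd, ?_⟩
  rintro ⟨_, _⟩ ⟨⟨i, hi, rfl⟩, ⟨j, hj, rfl⟩⟩
  change dist (T i z) (T j z) < ε
  calc dist (T i z) (T j z) ≤ dist (T i z) y + dist (T j z) y := dist_triangle_right _ _ _
    _ < ε := by
      have hi' : dist (T i z) y < ε / 2 := hi
      have hj' : dist (T j z) y < ε / 2 := hj
      linarith

variable {A : Type*} [NonUnitalCStarAlgebra A]

/-- The functional `x ↦ ω (a * x)`. -/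
noncomputable def mulLeftFun (ω : A →L[ℂ] ℂ) (a : A) : A →L[ℂ] ℂ :=
  ω ∘L ContinuousLinearMap.mul ℂ A a

/-- The functional `x ↦ ω (x * a)`. -/
noncomputable def mulRightFun (ω : A →L[ℂ] ℂ) (a : A) : A →L[ℂ] ℂ :=
  ω ∘L (ContinuousLinearMap.mul ℂ A).flip a

@[simp] theorem mulLeftFun_apply (ω : A →L[ℂ] ℂ) (a x : A) : mulLeftFun ω a x = ω (a * x) := rfl

@[simp] theorem mulRightFun_apply (ω : A →L[ℂ] ℂ) (a x : A) : mulRightFun ω a x = ω (x * a) := rfl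

theorem norm_mulRightFun_le (ω : A →L[ℂ] ℂ) (a : A) : ‖mulRightFun ω a‖ ≤ ‖ω‖ * ‖a‖ :=
  ContinuousLinearMap.opNorm_le_bound _ (by positivity) fun x => by
    rw [mulRightFun_apply]
    refine (ω.le_opNorm _).trans ?_
    calc ‖ω‖ * ‖x * a‖ ≤ ‖ω‖ * (‖x‖ * ‖a‖) := by gcongr; exact norm_mul_le _ _
      _ = _ := by ring

/-- If a functional nearly attains its norm at `r`, then it is small on every `s` for which the
norms of the combinations `α r + β s` satisfy the estimate of an orthogonal sum. -/
theorem norm_apply_le_of_orthogonal {ω : A →L[ℂ] ℂ} {r s : A} {δ t : ℝ} (ht : 0 < t)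
    (hr : ‖ω‖ - δ ≤ ‖ω r‖)
    (h : ∀ α β : ℂ, ‖α • r + β • s‖ ^ 2 ≤ ‖α‖ ^ 2 + 4 * ‖β‖ ^ 2) :
    ‖ω s‖ ≤ δ / t + 2 * ‖ω‖ * t := by
  have key : ‖ω r‖ + t * ‖ω s‖ ≤ ‖ω‖ * (1 + 2 * t ^ 2) := by
    obtain ⟨α, hα, hα'⟩ : ∃ α : ℂ, ‖α‖ = 1 ∧ α * ω r = (‖ω r‖ : ℂ) := by
      obtain ⟨α, h1, h2⟩ := RCLike.exists_norm_eq_mul_self (ω r)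
      exact ⟨α, h1, h2.symm⟩
    obtain ⟨β, hβ, hβ'⟩ : ∃ β : ℂ, ‖β‖ = 1 ∧ β * ω s = (‖ω s‖ : ℂ) := by
      obtain ⟨α, h1, h2⟩ := RCLike.exists_norm_eq_mul_self (ω s)
      exact ⟨α, h1, h2.symm⟩
    have h1 : ω (α • r + ((t : ℂ) * β) • s) = ((‖ω r‖ + t * ‖ω s‖ : ℝ) : ℂ) := by
      rw [map_add, map_smul, map_smul, smul_eq_mul, smul_eq_mul, mul_assoc, hα', hβ']
      push_cast; ring
    have h2 := ω.le_opNorm (α • r + ((t : ℂ) * β) • s)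
    rw [h1, Complex.norm_real, Real.norm_of_nonneg (by positivity)] at h2
    have h3 := h α ((t : ℂ) * β)
    rw [norm_mul, hα, hβ, Complex.norm_real, Real.norm_of_nonneg ht.le] at h3
    refine h2.trans (mul_le_mul_of_nonneg_left ?_ (norm_nonneg _))
    refine abs_le_of_sq_le_sq' (h3.trans ?_) (by positivity) |>.2
    nlinarith [sq_nonneg (t ^ 2)]
  have h4 : t * ‖ω s‖ ≤ δ + 2 * ‖ω‖ * t ^ 2 := by nlinarith
  calc ‖ω s‖ = t * ‖ω s‖ / t := by field_simp
    _ ≤ (δ + 2 * ‖ω‖ * t ^ 2) / t := by gcongr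
    _ = _ := by field_simp

/-- The left ideals of `e` and of its complement are orthogonal, whence an estimate as for an
orthogonal sum of vectors. -/
theorem norm_orthogonal_sq_le {e x y : A} (he : IsStarProjection e) (hx : ‖x‖ ≤ 1) (hy : ‖y‖ ≤ 1)
    (α β : ℂ) : ‖α • (e * x) + β • (y - e * y)‖ ^ 2 ≤ ‖α‖ ^ 2 + 4 * ‖β‖ ^ 2 := by
  set r := α • (e * x)
  set s := β • (y - e * y)
  have hee := he.isIdempotentElem.eq
  have hs := he.isSelfAdjoint.star_eq
  have h0 : star r * s = 0 := by
    simp only [r, s, star_smul, star_mul, hs, smul_mul_assoc, mul_smul_comm, mul_sub]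
    rw [mul_assoc, mul_assoc, ← mul_assoc e e, hee, sub_self]; simp
  have h1 : star s * r = 0 := by rw [← star_eq_zero, star_mul, star_star, h0]
  have h2 : star (r + s) * (r + s) = star r * r + star s * s := by
    rw [star_add, add_mul, mul_add, mul_add, h0, h1]; abel
  have h3 : ‖r‖ ≤ ‖α‖ := by
    rw [norm_smul]
    have := (norm_mul_le e x).trans (mul_le_one₀ (he.norm_le e) (norm_nonneg _) hx)
    exact mul_le_of_le_one_right (norm_nonneg _) this
  have h4 : ‖s‖ ≤ 2 * ‖β‖ := by
    rw [norm_smul, mul_comm]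
    have := (norm_mul_le e y).trans (mul_le_one₀ (he.norm_le e) (norm_nonneg _) hy)
    exact mul_le_mul_of_nonneg_right ((norm_sub_le _ _).trans (by linarith)) (norm_nonneg _)
  calc ‖r + s‖ ^ 2 = ‖star r * r + star s * s‖ := by rw [← h2, CStarRing.norm_star_mul_self, sq]
    _ ≤ ‖star r * r‖ + ‖star s * s‖ := norm_add_le _ _
    _ = ‖r‖ ^ 2 + ‖s‖ ^ 2 := by
      rw [CStarRing.norm_star_mul_self, CStarRing.norm_star_mul_self]; ring
    _ ≤ ‖α‖ ^ 2 + (2 * ‖β‖) ^ 2 := by gcongr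
    _ = _ := by ring

/-- Bounded functionals are norm-continuous for the left action of an approximate unit of
projections: a functional that nearly attains its norm on `e x` is nearly zero on the orthogonal
part `y - e y`. -/
theorem tendsto_norm_sub_mulLeftFun {ι : Type*} {l : Filter ι} {e : ι → A}
    (he : ∀ i, IsStarProjection (e i)) (h : ∀ x, Tendsto (fun i => e i * x) l (𝓝 x))
    (ω : A →L[ℂ] ℂ) : Tendsto (fun i => ‖ω - mulLeftFun ω (e i)‖) l (𝓝 0) := by
  rw [Metric.tendsto_nhds]
  intro ε hε
  set N := ‖ω‖
  have hN : 0 ≤ N := norm_nonneg _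
  set t := ε / (8 * (N + 1)) with ht
  have htpos : 0 < t := by positivity
  set δ := t * ε / 4 with hδ
  have hδpos : 0 < δ := by positivity
  obtain ⟨x, hx1, hx⟩ : ∃ x : A, ‖x‖ ≤ 1 ∧ N - δ / 2 ≤ ‖ω x‖ := by
    by_cases h0 : N - δ / 2 < 0
    · exact ⟨0, by simp, by simpa using h0.le⟩
    · obtain ⟨x, h1, h2⟩ := ω.exists_lt_apply_of_lt_opNorm (r := N - δ / 2) (by linarith)
      exact ⟨x, h1.le, h2.le⟩
  have h1 : Tendsto (fun i => ‖ω (e i * x)‖) l (𝓝 ‖ω x‖) :=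
    ((ω.continuous.tendsto _).comp (h x)).norm
  filter_upwards [h1.eventually_const_lt (show ‖ω x‖ - δ / 2 < ‖ω x‖ by linarith)] with i hi
  rw [dist_zero_right, norm_norm]
  refine lt_of_le_of_lt (ContinuousLinearMap.opNorm_le_of_unit_norm (C := ε / 2)
    (by positivity) fun y hy => ?_) (by linarith)
  have := norm_apply_le_of_orthogonal (ω := ω) (r := e i * x) (s := y - e i * y) (δ := δ) htpos
    (by linarith) (norm_orthogonal_sq_le (he i) hx1 hy.le)
  rw [sub_apply, mulLeftFun_apply, ← map_sub]
  refine this.trans ?_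
  have h2 : δ / t = ε / 4 := by rw [hδ]; field_simp
  have h3 : 2 * N * t ≤ ε / 4 := by
    rw [ht]
    calc 2 * N * (ε / (8 * (N + 1))) ≤ 2 * (N + 1) * (ε / (8 * (N + 1))) := by gcongr; linarith
      _ = ε / 4 := by field_simp; norm_num
  linarith

/-- The right-handed form of `tendsto_norm_sub_mulLeftFun`. -/
theorem tendsto_norm_sub_mulRightFun {ι : Type*} {l : Filter ι} {e : ι → A}
    (he : ∀ i, IsStarProjection (e i)) (h : ∀ x, Tendsto (fun i => e i * x) l (𝓝 x))
    (ω : A →L[ℂ] ℂ) : Tendsto (fun i => ‖ω - mulRightFun ω (e i)‖) l (𝓝 0) := by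
  -- apply the left-handed form to the adjoint functional
  let τ : A →L[ℂ] ℂ := LinearMap.mkContinuous
    { toFun := fun x => star (ω (star x))
      map_add' := fun x y => by simp
      map_smul' := fun c x => by simp } ‖ω‖ fun x => by
    change ‖star (ω (star x))‖ ≤ _
    rw [norm_star]
    exact (ω.le_opNorm _).trans (by rw [norm_star])
  have hτ : ∀ x, τ x = star (ω (star x)) := fun x => rfl
  refine squeeze_zero (fun _ => norm_nonneg _) (fun i => ?_) (tendsto_norm_sub_mulLeftFun he h τ)
  refine ContinuousLinearMap.opNorm_le_bound _ (norm_nonneg _) fun x => ?_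
  have h1 := (τ - mulLeftFun τ (e i)).le_opNorm (star x)
  rw [norm_star] at h1
  refine le_of_eq_of_le ?_ h1
  rw [sub_apply, sub_apply, mulLeftFun_apply, mulRightFun_apply, hτ, hτ, star_mul,
    star_star, (he i).isSelfAdjoint.star_eq, ← star_sub, norm_star]

/-- The functional `x ↦ ω (a * x * b)`. -/
noncomputable def mulFun (ω : A →L[ℂ] ℂ) (a b : A) : A →L[ℂ] ℂ := mulRightFun (mulLeftFun ω a) b

@[simp] theorem mulFun_apply (ω : A →L[ℂ] ℂ) (a b x : A) : mulFun ω a b x = ω (a * (x * b)) := rfl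

theorem tendsto_norm_sub_mulFun {ι : Type*} {l : Filter ι} {e : ι → A}
    (he : ∀ i, IsStarProjection (e i)) (h : ∀ x, Tendsto (fun i => e i * x) l (𝓝 x))
    (ω : A →L[ℂ] ℂ) : Tendsto (fun i => ‖ω - mulFun ω (e i) (e i)‖) l (𝓝 0) := by
  have h1 := (tendsto_norm_sub_mulLeftFun he h ω).add (tendsto_norm_sub_mulRightFun he h ω)
  rw [add_zero] at h1
  refine squeeze_zero (fun _ => norm_nonneg _) (fun i => ?_) h1
  have h2 : ω - mulFun ω (e i) (e i) =
      (ω - mulRightFun ω (e i)) + mulRightFun (ω - mulLeftFun ω (e i)) (e i) := by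
    ext x; simp
  rw [h2, add_comm]
  refine (norm_add_le _ _).trans ?_
  gcongr
  exact (norm_mulRightFun_le _ _).trans
    (mul_le_of_le_one_right (norm_nonneg _) ((he i).norm_le (e i)))

variable [PartialOrder A] [StarOrderedRing A]

/-- A bounded functional is positive if it is nonnegative on positive elements. -/
def IsPos (ω : A →L[ℂ] ℂ) : Prop := ∀ a, 0 ≤ a → 0 ≤ ω a

/-- A positive functional as a bundled positive linear map. -/
noncomputable def IsPos.toPLM {ω : A →L[ℂ] ℂ} (hω : IsPos ω) : A →ₚ[ℂ] ℂ :=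
  PositiveLinearMap.mk₀ (ω : A →ₗ[ℂ] ℂ) hω

theorem IsPos.toPLM_apply {ω : A →L[ℂ] ℂ} (hω : IsPos ω) (a : A) : hω.toPLM a = ω a := rfl

theorem IsPos.apply_star {ω : A →L[ℂ] ℂ} (hω : IsPos ω) (a : A) : ω (star a) = star (ω a) :=
  map_star hω.toPLM a

/-- The Cauchy–Schwarz inequality. -/
theorem IsPos.norm_apply_sq_le {ω : A →L[ℂ] ℂ} (hω : IsPos ω) (a b : A) :
    ‖ω (star a * b)‖ ^ 2 ≤ ‖ω (star a * a)‖ * ‖ω (star b * b)‖ := by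
  have h := norm_inner_le_norm (𝕜 := ℂ) (hω.toPLM.toPreGNS a) (hω.toPLM.toPreGNS b)
  have h1 : ∀ c, ‖ω (star c * c)‖ = ‖hω.toPLM.toPreGNS c‖ ^ 2 := fun c => by
    have := hω.toPLM.preGNS_norm_sq (hω.toPLM.toPreGNS c)
    rw [PositiveLinearMap.ofPreGNS_toPreGNS, hω.toPLM_apply] at this
    rw [← this]
    simp
  rw [h1, h1, ← mul_pow]
  refine pow_le_pow_left₀ (norm_nonneg _) ?_ 2
  exact h

theorem IsPos.apply_mul_eq_zero {ω : A →L[ℂ] ℂ} (hω : IsPos ω) {b : A}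
    (hb : ω (star b * b) = 0) (a : A) : ω (a * b) = 0 := by
  have := hω.norm_apply_sq_le (star a) b
  rw [hb, norm_zero, mul_zero, star_star] at this
  exact norm_eq_zero.1 (pow_eq_zero_iff two_ne_zero |>.1 (le_antisymm this (by positivity)))

theorem IsPos.mulFun {ω : A →L[ℂ] ℂ} (hω : IsPos ω) (c : A) : IsPos (mulFun ω (star c) c) :=
  fun a ha => by
    rw [mulFun_apply, ← mul_assoc]
    exact hω _ (star_left_conjugate_nonneg ha c)

/-- Positive functionals as bounded functionals. -/
theorem exists_isPos (f : A →ₚ[ℂ] ℂ) : ∃ ω : A →L[ℂ] ℂ, IsPos ω ∧ ∀ a, ω a = f a :=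
  ⟨⟨f.toLinearMap, map_continuous f⟩, fun _ ha => f.map_nonneg ha, fun _ => rfl⟩

/-- Positive functionals separate points. -/
theorem eq_zero_of_isPos {x : A} (h : ∀ ω : A →L[ℂ] ℂ, IsPos ω → ω x = 0) : x = 0 := by
  -- polarization
  have h1 : ∀ ω : A →L[ℂ] ℂ, IsPos ω → ∀ y z, ω (star y * x * z) = 0 := by
    intro ω hω y z
    have h2 : ∀ c, ω (star c * x * c) = 0 := fun c => by
      have := h _ (hω.mulFun c)
      rwa [mulFun_apply, ← mul_assoc] at this
    have e1 := h2 (y + z)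
    have e2 := h2 (y + Complex.I • z)
    have e3 := h2 y
    have e4 := h2 z
    simp only [star_add, add_mul, mul_add, map_add, star_smul, smul_mul_assoc, mul_smul_comm,
      map_smul, smul_eq_mul, e3, e4] at e1 e2
    simp only [Complex.star_def, Complex.conj_I] at e2
    have e5 : ω (star z * x * y) = - ω (star y * x * z) := by linear_combination e1
    rw [e5] at e2
    have e6 : 2 * Complex.I * ω (star y * x * z) = 0 := by linear_combination e2
    simpa using e6
  by_contra h0
  have hc : x * star x ≠ 0 := by rwa [Ne, CStarRing.mul_star_self_eq_zero_iff]
  have hd : star (x * star x) * (x * star x) ≠ 0 := by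
    rwa [Ne, CStarRing.star_mul_self_eq_zero_iff]
  obtain ⟨f, hf⟩ := exists_positive_apply_ne_zero (star_mul_self_nonneg (x * star x)) hd
  obtain ⟨ω, hω, hωf⟩ := exists_isPos f
  apply hf
  rw [← hωf, ← mul_assoc]
  exact h1 ω hω _ _

/-- A positive functional which is supported on the corner of a projection `p` is bounded by its
value at `p`. -/
theorem IsPos.norm_apply_le_of_supp {ω : A →L[ℂ] ℂ} (hω : IsPos ω) {p : A}
    (hp : IsStarProjection p) (hs : ∀ a, ω (p * (a * p)) = ω a) (a : A) :
    ‖ω a‖ ≤ ‖ω p‖ * ‖a‖ := by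
  have hpp := hp.isIdempotentElem.eq
  have hst := hp.isSelfAdjoint.star_eq
  have h1 := hω.norm_apply_sq_le p (a * p)
  rw [hst, hs, hpp] at h1
  have h2 : ‖ω (star (a * p) * (a * p))‖ ≤ ‖a‖ ^ 2 * ‖ω p‖ := by
    have h3 : star (a * p) * (a * p) ≤ (‖a‖ ^ 2) • p := by
      rw [star_mul, hst, mul_assoc, ← mul_assoc (star a), ← mul_assoc]
      calc p * (star a * a) * p = star p * (star a * a) * p := by rw [hst]
        _ ≤ ‖star a * a‖ • (star p * p) := CStarAlgebra.star_left_conjugate_le_norm_smul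
        _ = _ := by rw [CStarRing.norm_star_mul_self, hst, hpp, sq]
    have h4 : 0 ≤ ω (star (a * p) * (a * p)) := hω _ (star_mul_self_nonneg _)
    have h5 : ω (star (a * p) * (a * p)) ≤ ω ((‖a‖ ^ 2) • p) := by
      rw [← sub_nonneg, ← map_sub]
      exact hω _ (sub_nonneg.2 h3)
    have h6 : ω ((‖a‖ ^ 2) • p) = ((‖a‖ ^ 2 : ℝ) : ℂ) * ω p := by
      rw [← Complex.coe_smul, map_smul, smul_eq_mul]
    rw [h6] at h5
    calc _ ≤ ‖((‖a‖ ^ 2 : ℝ) : ℂ) * ω p‖ := by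
          rw [← Complex.re_eq_norm.2 h4, ← Complex.re_eq_norm.2 (h4.trans h5)]
          exact (Complex.le_def.1 h5).1
      _ = _ := by rw [norm_mul, Complex.norm_real, Real.norm_of_nonneg (by positivity)]
  refine abs_le_of_sq_le_sq' ?_ (by positivity) |>.2
  calc ‖ω a‖ ^ 2 ≤ ‖ω p‖ * ‖ω (star (a * p) * (a * p))‖ := h1
    _ ≤ ‖ω p‖ * (‖a‖ ^ 2 * ‖ω p‖) := by gcongr
    _ = _ := by ring

end Functionals

/-! ### Multipliers and strict convergence -/

section StrictConvergence

open Topology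

variable {A : Type*} [NonUnitalCStarAlgebra A]

theorem multiplier_snd_mul (X : 𝓜(ℂ, A)) (a b : A) : X.snd (a * b) = a * X.snd b := by
  refine sub_eq_zero.1 ?_
  have h1 : ∀ c, (X.snd (a * b) - a * X.snd b) * c = 0 := fun c => by
    rw [sub_mul, X.central, mul_assoc, mul_assoc, X.central, sub_self]
  rw [← CStarRing.mul_star_self_eq_zero_iff]
  exact h1 _

theorem star_multiplier_fst (X : 𝓜(ℂ, A)) (a : A) : star (X.fst a) = (star X).snd (star a) := by
  rw [DoubleCentralizer.star_snd, star_star]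

theorem multiplier_mul_coe (X : 𝓜(ℂ, A)) (a : A) : X * (a : 𝓜(ℂ, A)) = (X.fst a : A) :=
  multiplier_ext fun b => by simp [DoubleCentralizer.mul_fst, multiplier_fst_mul]

theorem coe_mul_multiplier (X : 𝓜(ℂ, A)) (a : A) : (a : 𝓜(ℂ, A)) * X = (X.snd a : A) :=
  multiplier_ext fun b => by simp [DoubleCentralizer.mul_fst, X.central]

theorem coe_mult_injective {a b : A} (h : (a : 𝓜(ℂ, A)) = (b : 𝓜(ℂ, A))) : a = b := by
  have h1 : ∀ c, (a - b) * c = 0 := fun c => by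
    have := congrArg (fun X : 𝓜(ℂ, A) => X.fst c) h
    simpa [sub_mul, sub_eq_zero] using this
  rw [← sub_eq_zero, ← CStarRing.mul_star_self_eq_zero_iff]
  exact h1 _

theorem norm_multiplier_fst_le (X : 𝓜(ℂ, A)) (a : A) : ‖X.fst a‖ ≤ ‖X‖ * ‖a‖ := by
  rw [← DoubleCentralizer.norm_fst]; exact X.fst.le_opNorm a

theorem norm_multiplier_snd_le (X : 𝓜(ℂ, A)) (a : A) : ‖X.snd a‖ ≤ ‖X‖ * ‖a‖ := by
  rw [← DoubleCentralizer.norm_snd]; exact X.snd.le_opNorm a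

/-- A bounded net of multipliers that converges pointwise converges strictly to a multiplier. -/
theorem exists_strictTendsto {ι : Type*} {l : Filter ι} [l.NeBot] {f : ι → 𝓜(ℂ, A)} {c : ℝ}
    (hc : ∀ᶠ i in l, ‖f i‖ ≤ c) (h1 : ∀ a, ∃ y, Tendsto (fun i => (f i).fst a) l (𝓝 y))
    (h2 : ∀ a, ∃ y, Tendsto (fun i => (f i).snd a) l (𝓝 y)) : ∃ m, StrictTendsto f l m := by
  choose L hL using h1
  choose R hR using h2
  let LL : A →L[ℂ] A := LinearMap.mkContinuous
    { toFun := L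
      map_add' := fun a b => tendsto_nhds_unique (hL _)
        (((hL a).add (hL b)).congr fun i => (map_add _ _ _).symm)
      map_smul' := fun r a => tendsto_nhds_unique (hL _)
        (((hL a).const_smul r).congr fun i => (map_smul _ _ _).symm) } c fun a =>
    le_of_tendsto (hL a).norm (hc.mono fun i hi => (norm_multiplier_fst_le _ _).trans
      (mul_le_mul_of_nonneg_right hi (norm_nonneg _)))
  let RR : A →L[ℂ] A := LinearMap.mkContinuous
    { toFun := R
      map_add' := fun a b => tendsto_nhds_unique (hR _)
        (((hR a).add (hR b)).congr fun i => (map_add _ _ _).symm)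
      map_smul' := fun r a => tendsto_nhds_unique (hR _)
        (((hR a).const_smul r).congr fun i => (map_smul _ _ _).symm) } c fun a =>
    le_of_tendsto (hR a).norm (hc.mono fun i hi => (norm_multiplier_snd_le _ _).trans
      (mul_le_mul_of_nonneg_right hi (norm_nonneg _)))
  refine ⟨{ fst := LL, snd := RR, central := fun x y => ?_ }, fun a => ⟨hL a, hR a⟩⟩
  exact tendsto_nhds_unique ((hR x).mul_const y)
    (((hL y).const_mul x).congr fun i => ((f i).central x y).symm)

theorem HasStrictSum.strictSum_eq {ι : Type*} {f : ι → 𝓜(ℂ, A)} {m : 𝓜(ℂ, A)}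
    (h : HasStrictSum f m) : strictSum f = m :=
  StrictTendsto.strictLim_eq h

theorem coe_mult_sum {ι : Type*} (s : Finset ι) (f : ι → A) :
    ∑ i ∈ s, (f i : 𝓜(ℂ, A)) = ((∑ i ∈ s, f i : A) : 𝓜(ℂ, A)) :=
  (map_sum (DoubleCentralizer.coeHom (𝕜 := ℂ) (A := A)) f s).symm

theorem norm_coe_mult (a : A) : ‖(a : 𝓜(ℂ, A))‖ = ‖a‖ :=
  NonUnitalStarAlgHom.norm_map (DoubleCentralizer.coeHom (𝕜 := ℂ) (A := A))
    (fun _ _ h => coe_mult_injective h) a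

theorem isStarProjection_sum {ι : Type*} {w : ι → A} (hw : ∀ i, IsStarProjection (w i))
    (ho : ∀ i j, i ≠ j → w i * w j = 0) (s : Finset ι) : IsStarProjection (∑ i ∈ s, w i) := by
  classical
  refine ⟨?_, ?_⟩
  · rw [IsIdempotentElem, Finset.sum_mul_sum]
    refine Finset.sum_congr rfl fun i hi => ?_
    rw [Finset.sum_eq_single i (fun j _ hj => ho i j hj.symm) fun h => absurd hi h]
    exact (hw i).isIdempotentElem
  · rw [isSelfAdjoint_iff, star_sum]
    exact Finset.sum_congr rfl fun i _ => (hw i).isSelfAdjoint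

/-- A family of orthogonal projections is strictly summable as soon as its partial sums stabilize
on a total set. -/
theorem exists_hasStrictSum {ι : Type*} {w : ι → A} (hw : ∀ i, IsStarProjection (w i))
    (ho : ∀ i j, i ≠ j → w i * w j = 0) {M : Set A} (hM : Dense (Submodule.span ℂ M : Set A))
    (h : ∀ z ∈ M, ∃ y, ∀ᶠ s : Finset ι in atTop, (∑ i ∈ s, w i) * z = y) :
    ∃ m, HasStrictSum (fun i => (w i : 𝓜(ℂ, A))) m := by
  have hb : ∀ s : Finset ι, ‖∑ i ∈ s, (w i : 𝓜(ℂ, A))‖ ≤ 1 := fun s => by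
    rw [coe_mult_sum, norm_coe_mult]
    exact (isStarProjection_sum hw ho s).norm_le _
  have h1 : ∀ a, ∃ y, Tendsto (fun s : Finset ι => (∑ i ∈ s, w i) * a) atTop (𝓝 y) :=
    exists_tendsto_of_dense_span (fun s => ContinuousLinearMap.mul ℂ A (∑ i ∈ s, w i)) (c := 1)
      (Eventually.of_forall fun s => (ContinuousLinearMap.opNorm_mul_apply_le ℂ A _).trans
        ((isStarProjection_sum hw ho s).norm_le _)) hM fun z hz => by
        obtain ⟨y, hy⟩ := h z hz
        exact ⟨y, tendsto_const_nhds.congr' (hy.mono fun s hs => hs.symm)⟩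
  refine exists_strictTendsto (c := 1) (Eventually.of_forall hb) (fun a => ?_) (fun a => ?_)
  · obtain ⟨y, hy⟩ := h1 a
    refine ⟨y, hy.congr fun s => ?_⟩
    rw [coe_mult_sum]; rfl
  · obtain ⟨y, hy⟩ := h1 (star a)
    refine ⟨star y, hy.star.congr fun s => ?_⟩
    rw [coe_mult_sum, star_mul, star_star, (isStarProjection_sum hw ho s).isSelfAdjoint.star_eq]
    rfl

variable [PartialOrder A] [StarOrderedRing A]
variable {B : Type*} [NonUnitalCStarAlgebra B]

/-- The strict extension of a possibly degenerate homomorphism `φ : A → M(B)` to multipliers exists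
if `B` is generated by elements which are either fixed by some `φ s` or killed by `φ`. -/
theorem strictExt_hom (φ : A →⋆ₙₐ[ℂ] 𝓜(ℂ, B)) {M : Set B}
    (hM : Dense (Submodule.span ℂ M : Set B))
    (h : ∀ z ∈ M, (∃ s, (φ s).fst z = z) ∨ ∀ s, (φ s).fst z = 0) (X : 𝓜(ℂ, A)) :
    StrictTendsto (fun e => φ (X.fst e)) (CStarAlgebra.approximateUnit A) (strictExt φ X) := by
  have hinc := CStarAlgebra.increasingApproximateUnit A
  have hb : ∀ᶠ e in CStarAlgebra.approximateUnit A, ‖φ (X.fst e)‖ ≤ ‖X‖ :=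
    hinc.eventually_norm.mono fun e he => by
      refine (NonUnitalStarAlgHom.norm_apply_le φ _).trans ((norm_multiplier_fst_le _ _).trans ?_)
      exact mul_le_of_le_one_right (norm_nonneg _) he
  have hMs : Dense (Submodule.span ℂ (star '' M) : Set B) := by
    intro x
    have h1 := hM (star x)
    rw [Metric.mem_closure_iff] at h1 ⊢
    intro ε hε
    obtain ⟨y, hy, hyx⟩ := h1 ε hε
    refine ⟨star y, ?_, ?_⟩
    · rw [SetLike.mem_coe] at hy ⊢
      clear hyx
      induction hy using Submodule.span_induction with
      | mem z hz => exact Submodule.subset_span ⟨z, hz, rfl⟩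
      | zero => rw [star_zero]; exact zero_mem _
      | add a b _ _ ha hb => rw [star_add]; exact add_mem ha hb
      | smul r a _ ha => rw [star_smul]; exact Submodule.smul_mem _ _ ha
    · rw [dist_eq_norm] at hyx ⊢
      rw [← norm_star, star_sub, star_star]; exact hyx
  have hex : ∃ m, StrictTendsto (fun e => φ (X.fst e)) (CStarAlgebra.approximateUnit A) m := by
    refine exists_strictTendsto hb ?_ ?_
    · refine exists_tendsto_of_dense_span (fun e => (φ (X.fst e)).fst) (c := ‖X‖) ?_ hM ?_
      · exact hb.mono fun e he => by rw [DoubleCentralizer.norm_fst]; exact he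
      · intro z hz
        rcases h z hz with ⟨s, hs⟩ | h0
        · refine ⟨(φ (X.fst s)).fst z, ?_⟩
          have h2 : Tendsto (fun e => (φ (X.fst (e * s))).fst z)
              (CStarAlgebra.approximateUnit A) (𝓝 ((φ (X.fst s)).fst z)) :=
            (((multEval z ∘L homCLM φ ∘L X.fst).continuous.tendsto s).comp
              (hinc.tendsto_mul_right s))
          refine h2.congr fun e => ?_
          rw [multiplier_fst_mul, map_mul, DoubleCentralizer.mul_fst]
          exact congrArg (φ (X.fst e)).fst hs
        · exact ⟨0, tendsto_const_nhds.congr fun e => (h0 _).symm⟩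
    · refine exists_tendsto_of_dense_span (fun e => (φ (X.fst e)).snd) (c := ‖X‖) ?_ hMs ?_
      · exact hb.mono fun e he => by rw [DoubleCentralizer.norm_snd]; exact he
      · rintro _ ⟨z, hz, rfl⟩
        have hst : ∀ s, (φ s).snd (star z) = star ((φ (star s)).fst z) := fun s => by
          rw [map_star φ, DoubleCentralizer.star_fst, star_star]
        rcases h z hz with ⟨s, hs⟩ | h0
        · refine ⟨star ((φ (star (X.snd (star s)))).fst z), ?_⟩
          have hcont : Continuous fun x : A => star ((φ (star x)).fst z) :=
            continuous_star.comp (((multEval z ∘L homCLM φ).continuous).comp continuous_star)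
          have h2 : Tendsto (fun e => star ((φ (star (X.snd (star s) * e))).fst z))
              (CStarAlgebra.approximateUnit A)
              (𝓝 (star ((φ (star (X.snd (star s)))).fst z))) :=
            (hcont.tendsto _).comp (hinc.tendsto_mul_left (X.snd (star s)))
          refine h2.congr fun e => ?_
          rw [hst, X.central, star_mul, star_star, map_mul, DoubleCentralizer.mul_fst]
          exact congrArg (fun y => star ((φ (star (X.fst e))).fst y)) hs
        · exact ⟨0, tendsto_const_nhds.congr fun e => by rw [hst, h0, star_zero]⟩
  obtain ⟨m, hm⟩ := hex
  rw [strictExt, hm.strictLim_eq]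
  exact hm

/-- The strict extension is multiplicative against elements of the algebra. -/
theorem strictExt_hom_sandwich (φ : A →⋆ₙₐ[ℂ] 𝓜(ℂ, B)) {M : Set B}
    (hM : Dense (Submodule.span ℂ M : Set B))
    (h : ∀ z ∈ M, (∃ s, (φ s).fst z = z) ∨ ∀ s, (φ s).fst z = 0) (X : 𝓜(ℂ, A)) (s t : A) :
    φ s * strictExt φ X * φ t = φ (s * X.fst t) := by
  have h1 : strictExt φ X * φ t = φ (X.fst t) := by
    refine multiplier_ext fun z => ?_
    rw [DoubleCentralizer.mul_fst]
    refine tendsto_nhds_unique (((strictExt_hom φ hM h X) ((φ t).fst z)).1) ?_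
    have h2 : Tendsto (fun e => (φ (X.fst (e * t))).fst z)
        (CStarAlgebra.approximateUnit A) (𝓝 ((φ (X.fst t)).fst z)) :=
      (((multEval z ∘L homCLM φ ∘L X.fst).continuous.tendsto t).comp
        ((CStarAlgebra.increasingApproximateUnit A).tendsto_mul_right t))
    refine h2.congr fun e => ?_
    rw [multiplier_fst_mul, map_mul, DoubleCentralizer.mul_fst]; rfl
  rw [mul_assoc, h1, map_mul]

end StrictConvergence

/-! ### Positivity and boundedness of slice maps -/

theorem exists_eq_sum_tmul {A B : Type*} [AddCommGroup A] [Module ℂ A] [AddCommGroup B]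
    [Module ℂ B] (x : A ⊗[ℂ] B) :
    ∃ (n : ℕ) (a : Fin n → A) (b : Fin n → B), x = ∑ i, a i ⊗ₜ[ℂ] b i := by
  obtain ⟨s, rfl⟩ := TensorProduct.exists_finset x
  refine ⟨s.card, fun i => (s.equivFin.symm i).1.1, fun i => (s.equivFin.symm i).1.2, ?_⟩
  rw [← Finset.sum_coe_sort s (fun i => i.1 ⊗ₜ[ℂ] i.2)]
  exact (Equiv.sum_comp s.equivFin.symm fun i => i.1.1 ⊗ₜ[ℂ] i.1.2).symm

section Slices

variable {A B : Type*} [NonUnitalCStarAlgebra A] [PartialOrder A] [StarOrderedRing A]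
  [NonUnitalCStarAlgebra B] [PartialOrder B] [StarOrderedRing B]

theorem norm_sliceLeft_le (ω : A →L[ℂ] ℂ) (z : MinTensor A B) : ‖sliceLeft ω z‖ ≤ ‖ω‖ * ‖z‖ := by
  refine MinTensor.denseRange_ofAlg.induction_on
    (p := fun z => ‖sliceLeft ω z‖ ≤ ‖ω‖ * ‖z‖) z (isClosed_le (by fun_prop) (by fun_prop))
    fun x => ?_
  rw [sliceLeft, LinearMap.extendOfNorm_eq MinTensor.denseRange_ofAlg
    ⟨‖ω‖, norm_algSliceLeft_le ω⟩]
  exact norm_algSliceLeft_le ω x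

theorem norm_sliceRight_le (ω : B →L[ℂ] ℂ) (z : MinTensor A B) :
    ‖sliceRight ω z‖ ≤ ‖ω‖ * ‖z‖ := by
  refine MinTensor.denseRange_ofAlg.induction_on
    (p := fun z => ‖sliceRight ω z‖ ≤ ‖ω‖ * ‖z‖) z (isClosed_le (by fun_prop) (by fun_prop))
    fun x => ?_
  rw [sliceRight, LinearMap.extendOfNorm_eq MinTensor.denseRange_ofAlg
    ⟨‖ω‖, norm_algSliceRight_le ω⟩]
  exact norm_algSliceRight_le ω x

open scoped MatrixOrder in
/-- The Gram matrix of a positive functional is positive, so it can be factorized. -/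
theorem sum_apply_star_mul_nonneg {ω : A →L[ℂ] ℂ} (hω : IsPos ω) {n : Type*} [Fintype n]
    (a : n → A) (b : n → B) :
    0 ≤ ∑ i, ∑ j, ω (star (a i) * a j) • (star (b i) * b j) := by
  classical
  have hM : (Matrix.of fun i j => ω (star (a i) * a j)).PosSemidef := by
    refine Matrix.PosSemidef.of_dotProduct_mulVec_nonneg ?_ fun x => ?_
    · ext i j
      rw [Matrix.conjTranspose_apply, Matrix.of_apply, Matrix.of_apply, ← hω.apply_star, star_mul,
        star_star]
    · have h := hω _ (star_mul_self_nonneg (∑ i, x i • a i))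
      rw [star_sum, Finset.sum_mul_sum, map_sum] at h
      convert h using 1
      refine Finset.sum_congr rfl fun i _ => ?_
      rw [Matrix.mulVec, dotProduct, Finset.mul_sum, map_sum]
      refine Finset.sum_congr rfl fun j _ => ?_
      rw [star_smul, smul_mul_smul_comm, map_smul, Matrix.of_apply, Pi.star_apply, smul_eq_mul]
      ring
  obtain ⟨C, hC', -, hC⟩ := sub_zero (Matrix.of fun i j => ω (star (a i) * a j)) ▸
    CFC.exists_sqrt_of_isSelfAdjoint_of_quasispectrumRestricts hM.isHermitian
      (QuasispectrumRestricts.nnreal_of_nonneg hM.nonneg)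
  have h2 : ∀ i j, ω (star (a i) * a j) = ∑ r, star (C r i) * C r j := fun i j => by
    have h3 := congrFun (congrFun hC i) j
    rw [sub_zero, Matrix.of_apply, Matrix.mul_apply] at h3
    rw [← h3]
    refine Finset.sum_congr rfl fun r _ => ?_
    have h4 : star (C r i) = C i r := congrFun (congrFun hC'.star_eq i) r
    rw [h4]
  have h1 : ∑ i, ∑ j, ω (star (a i) * a j) • (star (b i) * b j) =
      ∑ r, star (∑ i, C r i • b i) * ∑ j, C r j • b j := by
    simp only [h2, star_sum, Finset.sum_mul_sum, star_smul, smul_mul_smul_comm, Finset.sum_smul]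
    rw [Finset.sum_comm (s := (Finset.univ : Finset n))]
    conv_rhs => rw [Finset.sum_comm]
    rw [Finset.sum_comm]
    refine Finset.sum_congr rfl fun i _ => ?_
    conv_rhs => rw [Finset.sum_comm]
  rw [h1]
  exact Finset.sum_nonneg fun r _ => star_mul_self_nonneg _

theorem star_mul_self_ofAlg_sum {n : ℕ} (a : Fin n → A) (b : Fin n → B) :
    star (MinTensor.ofAlg A B (∑ i, a i ⊗ₜ[ℂ] b i)) * MinTensor.ofAlg A B (∑ i, a i ⊗ₜ[ℂ] b i) =
      ∑ i, ∑ j, MinTensor.tmul (star (a i) * a j) (star (b i) * b j) := by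
  simp only [map_sum, star_sum, Finset.sum_mul_sum, MinTensor.ofAlg_tmul, MinTensor.star_tmul,
    MinTensor.tmul_mul]

/-- Positivity of an operator on the tensor product may be checked on the squares of the elements of
the algebraic tensor product. -/
theorem nonneg_of_nonneg_ofAlg {C : Type*} [NonUnitalCStarAlgebra C] [PartialOrder C]
    [StarOrderedRing C] (T : MinTensor A B →L[ℂ] C)
    (h : ∀ (n : ℕ) (a : Fin n → A) (b : Fin n → B),
      0 ≤ T (∑ i, ∑ j, MinTensor.tmul (star (a i) * a j) (star (b i) * b j)))
    {z : MinTensor A B} (hz : 0 ≤ z) : 0 ≤ T z := by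
  obtain ⟨w, rfl⟩ := CStarAlgebra.nonneg_iff_eq_star_mul_self.1 hz
  refine MinTensor.denseRange_ofAlg.induction_on
    (p := fun w => 0 ≤ T (star w * w)) w ?_ fun x => ?_
  · exact CStarAlgebra.isClosed_nonneg.preimage (T.continuous.comp (by fun_prop))
  · obtain ⟨n, a, b, rfl⟩ := exists_eq_sum_tmul x
    rw [star_mul_self_ofAlg_sum]
    exact h n a b

theorem sliceLeft_nonneg {ω : A →L[ℂ] ℂ} (hω : IsPos ω) {z : MinTensor A B} (hz : 0 ≤ z) :
    0 ≤ sliceLeft ω z :=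
  nonneg_of_nonneg_ofAlg _ (fun n a b => by
    simp only [map_sum, sliceLeft_tmul]
    exact sum_apply_star_mul_nonneg hω a b) hz

theorem sliceRight_nonneg {ω : B →L[ℂ] ℂ} (hω : IsPos ω) {z : MinTensor A B} (hz : 0 ≤ z) :
    0 ≤ sliceRight ω z :=
  nonneg_of_nonneg_ofAlg _ (fun n a b => by
    simp only [map_sum, sliceRight_tmul]
    exact sum_apply_star_mul_nonneg hω b a) hz

end Slices

/-! ### Convolution of functionals and coassociativity -/

section Convolution

open Topology

section General

variable {A B C : Type*} [NonUnitalCStarAlgebra A] [NonUnitalCStarAlgebra B]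

/-- The map `a ↦ e Δ(a) f` cut out of a homomorphism `Δ : A → M(B)` by elements `e` and `f`. -/
noncomputable def cut (Δ : A →⋆ₙₐ[ℂ] 𝓜(ℂ, B)) (e f : B) : A →L[ℂ] B :=
  ContinuousLinearMap.mul ℂ B e ∘L multEval f ∘L homCLM Δ

@[simp] theorem cut_apply (Δ : A →⋆ₙₐ[ℂ] 𝓜(ℂ, B)) (e f : B) (a : A) :
    cut Δ e f a = e * (Δ a).fst f := rfl

variable [PartialOrder A] [StarOrderedRing A] [PartialOrder B] [StarOrderedRing B]

/-- The functional `ω ⊗ χ` on the minimal tensor product. -/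
noncomputable def tensorFun (ω : A →L[ℂ] ℂ) (χ : B →L[ℂ] ℂ) : MinTensor A B →L[ℂ] ℂ :=
  χ ∘L sliceLeft ω

@[simp] theorem tensorFun_tmul (ω : A →L[ℂ] ℂ) (χ : B →L[ℂ] ℂ) (a : A) (b : B) :
    tensorFun ω χ (MinTensor.tmul a b) = ω a * χ b := by
  simp [tensorFun]

theorem dense_span_tmul_of_dense {M : Set A} {N : Set B}
    (hM : Dense (Submodule.span ℂ M : Set A)) (hN : Dense (Submodule.span ℂ N : Set B)) :
    Dense (Submodule.span ℂ {z | ∃ x ∈ M, ∃ y ∈ N, z = MinTensor.tmul x y} :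
      Set (MinTensor A B)) := by
  set S := Submodule.span ℂ {z | ∃ x ∈ M, ∃ y ∈ N, z = MinTensor.tmul x y}
  have h1 : ∀ x ∈ M, ∀ b : B, MinTensor.tmul x b ∈ S.topologicalClosure := by
    intro x hx
    have hcl : IsClosed {b : B | MinTensor.tmul x b ∈ S.topologicalClosure} :=
      S.isClosed_topologicalClosure.preimage (MinTensor.tmulL x).continuous
    have hsub : (Submodule.span ℂ N : Set B) ⊆
        {b : B | MinTensor.tmul x b ∈ S.topologicalClosure} := by
      have : Submodule.span ℂ N ≤
          S.topologicalClosure.comap (MinTensor.tmulL (A := A) (B := B) x).toLinearMap :=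
        Submodule.span_le.2 fun y hy =>
          S.le_topologicalClosure (Submodule.subset_span ⟨x, hx, y, hy, rfl⟩)
      exact this
    exact fun b => hcl.closure_subset_iff.2 hsub (hN b)
  have h2 : ∀ (a : A) (b : B), MinTensor.tmul a b ∈ S.topologicalClosure := by
    intro a b
    have hcl : IsClosed {a : A | MinTensor.tmul a b ∈ S.topologicalClosure} :=
      S.isClosed_topologicalClosure.preimage
        ((MinTensor.tmulL (A := A) (B := B)).flip b).continuous
    have hsub : (Submodule.span ℂ M : Set A) ⊆
        {a : A | MinTensor.tmul a b ∈ S.topologicalClosure} := by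
      have : Submodule.span ℂ M ≤ S.topologicalClosure.comap
          ((MinTensor.tmulL (A := A) (B := B)).flip b).toLinearMap :=
        Submodule.span_le.2 fun x hx => h1 x hx b
      exact this
    exact hcl.closure_subset_iff.2 hsub (hM a)
  intro z
  have h3 : Submodule.span ℂ (Set.range fun i : A × B => MinTensor.tmul i.1 i.2) ≤
      S.topologicalClosure := Submodule.span_le.2 (by rintro _ ⟨i, rfl⟩; exact h2 i.1 i.2)
  have h4 := closure_mono (SetLike.coe_subset_coe.2 h3) (dense_span_tmul z)
  rwa [Submodule.topologicalClosure_coe, closure_closure] at h4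

end General

namespace PartialCompactQuantumSemigroup

variable {I : Type v} {A : Type u} [NonUnitalCStarAlgebra A] [PartialOrder A] [StarOrderedRing A]
  (G : PartialCompactQuantumSemigroup I A)

theorem unit_idem (k l : I) : G.unit k l * G.unit k l = G.unit k l :=
  (G.isStarProjection_unit k l).isIdempotentElem

theorem star_unit (k l : I) : star (G.unit k l) = G.unit k l :=
  (G.isStarProjection_unit k l).isSelfAdjoint

theorem tendsto_unit_mul (a : A) :
    Tendsto (fun s : Finset (I × I) => (∑ p ∈ s, G.unit p.1 p.2) * a) atTop (𝓝 a) :=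
  (G.hasStrictSum_unit a).1.congr fun s => by simp only [coe_mult_sum]; rfl

theorem tendsto_mul_unit (a : A) :
    Tendsto (fun s : Finset (I × I) => a * ∑ p ∈ s, G.unit p.1 p.2) atTop (𝓝 a) :=
  (G.hasStrictSum_unit a).2.congr fun s => by simp only [coe_mult_sum]; rfl

theorem dense_span_unit_mul :
    Dense (Submodule.span ℂ {x | ∃ k l a, x = G.unit k l * a} : Set A) := fun a =>
  mem_closure_of_tendsto (G.tendsto_unit_mul a) (Eventually.of_forall fun s => by
    rw [Finset.sum_mul]
    exact sum_mem fun p _ => Submodule.subset_span ⟨p.1, p.2, a, rfl⟩)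

/-- The projection `1_{jk} ⊗ 1_{km}` below `Δ(1_{jm})`. -/
noncomputable def cell (j k m : I) : MinTensor A A := MinTensor.tmul (G.unit j k) (G.unit k m)

theorem cell_eq (j k m : I) :
    G.cell j k m = MinTensor.tmul (G.unit j k) (G.unit k m) := rfl

theorem cell_idem (j k m : I) : G.cell j k m * G.cell j k m = G.cell j k m := by
  rw [cell, MinTensor.tmul_mul, unit_idem, unit_idem]

theorem star_cell (j k m : I) : star (G.cell j k m) = G.cell j k m := by
  rw [cell, MinTensor.star_tmul, star_unit, star_unit]

theorem comul_unit_fst (j k k' m r s : I) :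
    Tendsto (fun F : Finset I => ∑ n ∈ F, MinTensor.tmul (G.unit r n * G.unit j k)
      (G.unit n s * G.unit k' m)) atTop
      (𝓝 ((G.comul (G.unit r s)).fst (MinTensor.tmul (G.unit j k) (G.unit k' m)))) := by
  refine (G.comul_unit r s (MinTensor.tmul (G.unit j k) (G.unit k' m))).1.congr fun F => ?_
  simp only [coe_mult_sum]
  change (∑ n ∈ F, MinTensor.tmul (G.unit r n) (G.unit n s)) * MinTensor.tmul _ _ = _
  rw [Finset.sum_mul]
  exact Finset.sum_congr rfl fun n _ => MinTensor.tmul_mul _ _ _ _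

theorem comul_fst_cell (j k m : I) : (G.comul (G.unit j m)).fst (G.cell j k m) = G.cell j k m := by
  refine tendsto_nhds_unique (G.comul_unit_fst j k k m j m) (tendsto_const_nhds.congr' ?_)
  filter_upwards [eventually_ge_atTop {k}] with F hF
  rw [Finset.sum_eq_single k, unit_idem, unit_idem, cell]
  · intro n _ hn
    rw [G.unit_mul_unit j n j k (by simpa using hn), ← zero_smul ℂ (0 : A),
      MinTensor.tmul_smul_left, zero_smul]
  · intro h; exact absurd (hF (Finset.mem_singleton_self k)) h

theorem tmul_zero_left (b : A) : MinTensor.tmul (0 : A) b = 0 := by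
  rw [← zero_smul ℂ (0 : A), MinTensor.tmul_smul_left, zero_smul]

theorem tmul_zero_right (b : A) : MinTensor.tmul b (0 : A) = 0 := by
  rw [← zero_smul ℂ (0 : A), MinTensor.tmul_smul_right, zero_smul]

/-- For `k ≠ k'` the projection `1_{jk} ⊗ 1_{k'm}` is orthogonal to `Δ(1)`, so it is killed by
every `Δ(a)`. -/
theorem comul_fst_eq_zero {k k' : I} (hk : k ≠ k') (j m : I) (a : A) :
    (G.comul a).fst (MinTensor.tmul (G.unit j k) (G.unit k' m)) = 0 := by
  have h1 : ∀ r s, (G.comul (G.unit r s)).fst (MinTensor.tmul (G.unit j k) (G.unit k' m)) = 0 := by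
    intro r s
    refine tendsto_nhds_unique (G.comul_unit_fst j k k' m r s)
      (tendsto_const_nhds.congr fun F => ?_)
    refine (Finset.sum_eq_zero fun n _ => ?_).symm
    by_cases h : n = k
    · rw [G.unit_mul_unit n s k' m (by rintro ⟨⟩; exact hk h.symm), tmul_zero_right]
    · rw [G.unit_mul_unit r n j k (by simp [h]), tmul_zero_left]
  refine tendsto_nhds_unique (((multEval (MinTensor.tmul (G.unit j k) (G.unit k' m)) ∘L
    homCLM G.comul).continuous.tendsto a).comp (G.tendsto_mul_unit a))
    (tendsto_const_nhds.congr fun F => ?_)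
  simp only [Function.comp, ContinuousLinearMap.comp_apply, homCLM_apply, multEval_apply]
  rw [map_mul, map_sum, DoubleCentralizer.mul_fst, mul_apply_eq_comp]
  have h2 : (∑ p ∈ F, G.comul (G.unit p.1 p.2)).fst
      (MinTensor.tmul (G.unit j k) (G.unit k' m)) = 0 := by
    have := map_sum (multEval (MinTensor.tmul (G.unit j k) (G.unit k' m)))
      (fun p : I × I => G.comul (G.unit p.1 p.2)) F
    rw [multEval_apply] at this
    rw [this]
    exact Finset.sum_eq_zero fun p _ => h1 p.1 p.2
  rw [h2, map_zero]

theorem cell_comul_snd (j k m : I) : (G.comul (G.unit j m)).snd (G.cell j k m) = G.cell j k m := by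
  have h := congrArg star (G.comul_fst_cell j k m)
  rwa [star_multiplier_fst, ← map_star G.comul, star_unit, star_cell] at h

/-- Cutting by cells only sees the corner `1_{jm} a 1_{j'm'}`. -/
theorem cut_cell_corner (j k m j' k' m' : I) (a : A) :
    cut G.comul (G.cell j k m) (G.cell j' k' m') (G.unit j m * (a * G.unit j' m')) =
      cut G.comul (G.cell j k m) (G.cell j' k' m') a := by
  rw [cut_apply, cut_apply, map_mul, map_mul, DoubleCentralizer.mul_fst, DoubleCentralizer.mul_fst,
    mul_apply_eq_comp, mul_apply_eq_comp, comul_fst_cell, ← DoubleCentralizer.central,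
    cell_comul_snd]

/-- The convolution `(ω ⊗ χ)((1_{jk} ⊗ 1_{km}) Δ(a) (1_{j'k'} ⊗ 1_{k'm'}))` of two functionals. -/
noncomputable def conv (j k m j' k' m' : I) (ω χ : A →L[ℂ] ℂ) : A →L[ℂ] ℂ :=
  tensorFun ω χ ∘L cut G.comul (G.cell j k m) (G.cell j' k' m')

theorem conv_corner (j k m j' k' m' : I) (ω χ : A →L[ℂ] ℂ) (a : A) :
    G.conv j k m j' k' m' ω χ (G.unit j m * (a * G.unit j' m')) =
      G.conv j k m j' k' m' ω χ a := by
  rw [conv, ContinuousLinearMap.comp_apply, ContinuousLinearMap.comp_apply, cut_cell_corner]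

/-- The homomorphism `Δ ⊗ id` may be degenerate, but each generator is either fixed or killed by
it, as required for its strict extension. -/
theorem homTensorId_comul_cases (z : MinTensor (MinTensor A A) A)
    (hz : z ∈ {z | ∃ x ∈ {x : MinTensor A A | ∃ a ∈ {x | ∃ k l a, x = G.unit k l * a},
      ∃ b ∈ {x | ∃ k l a, x = G.unit k l * a}, x = MinTensor.tmul a b},
      ∃ y ∈ {x | ∃ k l a, x = G.unit k l * a}, z = MinTensor.tmul x y}) :
    (∃ s, (homTensorId (B := A) G.comul s).fst z = z) ∨
      ∀ s, (homTensorId (B := A) G.comul s).fst z = 0 := by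
  obtain ⟨_, ⟨_, ⟨j, k, a, rfl⟩, _, ⟨k', m, b, rfl⟩, rfl⟩, _, ⟨r, s, c, rfl⟩, rfl⟩ := hz
  by_cases hk : k = k'
  · subst hk
    refine Or.inl ⟨MinTensor.tmul (G.unit j m) (G.unit r s), ?_⟩
    rw [homTensorId_tmul, multTensor_fst_tmul, ← MinTensor.tmul_mul, multiplier_fst_mul (G.comul _)]
    have := G.comul_fst_cell j k m
    rw [cell] at this
    rw [this, DoubleCentralizer.coe_fst, ContinuousLinearMap.mul_apply', ← mul_assoc, unit_idem]
  · refine Or.inr fun s' => ?_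
    have h : multEval (MinTensor.tmul (MinTensor.tmul (G.unit j k * a) (G.unit k' m * b))
        (G.unit r s * c)) ∘L homCLM (homTensorId (B := A) G.comul) = 0 :=
      MinTensor.clm_ext fun x y => by
        rw [ContinuousLinearMap.comp_apply, homCLM_apply, multEval_apply, homTensorId_tmul,
          multTensor_fst_tmul, ← MinTensor.tmul_mul, multiplier_fst_mul (G.comul _),
          G.comul_fst_eq_zero hk, zero_mul, ← zero_smul ℂ (0 : MinTensor A A),
          MinTensor.tmul_smul_left, zero_smul]
        rfl
    exact DFunLike.congr_fun h s'

/-- The form of `homTensorId_comul_cases` for `id ⊗ Δ`. -/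
theorem idTensorHom_comul_cases (z : MinTensor A (MinTensor A A))
    (hz : z ∈ {z | ∃ y ∈ {x | ∃ k l a, x = G.unit k l * a},
      ∃ x ∈ {x : MinTensor A A | ∃ a ∈ {x | ∃ k l a, x = G.unit k l * a},
      ∃ b ∈ {x | ∃ k l a, x = G.unit k l * a}, x = MinTensor.tmul a b},
      z = MinTensor.tmul y x}) :
    (∃ s, (idTensorHom (A := A) G.comul s).fst z = z) ∨
      ∀ s, (idTensorHom (A := A) G.comul s).fst z = 0 := by
  obtain ⟨_, ⟨r, s, c, rfl⟩, _, ⟨_, ⟨j, k, a, rfl⟩, _, ⟨k', m, b, rfl⟩, rfl⟩, rfl⟩ := hz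
  by_cases hk : k = k'
  · subst hk
    refine Or.inl ⟨MinTensor.tmul (G.unit r s) (G.unit j m), ?_⟩
    rw [idTensorHom_tmul, multTensor_fst_tmul, ← MinTensor.tmul_mul, multiplier_fst_mul (G.comul _)]
    have := G.comul_fst_cell j k m
    rw [cell] at this
    rw [this, DoubleCentralizer.coe_fst, ContinuousLinearMap.mul_apply', ← mul_assoc, unit_idem]
  · refine Or.inr fun s' => ?_
    have h : multEval (MinTensor.tmul (G.unit r s * c)
        (MinTensor.tmul (G.unit j k * a) (G.unit k' m * b))) ∘L
        homCLM (idTensorHom (A := A) G.comul) = 0 :=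
      MinTensor.clm_ext fun x y => by
        rw [ContinuousLinearMap.comp_apply, homCLM_apply, multEval_apply, idTensorHom_tmul,
          multTensor_fst_tmul, ← MinTensor.tmul_mul, multiplier_fst_mul (G.comul _),
          G.comul_fst_eq_zero hk, zero_mul, ← zero_smul ℂ (0 : MinTensor A A),
          MinTensor.tmul_smul_right, zero_smul]
        rfl
    exact DFunLike.congr_fun h s'

/-- `(Δ ⊗ id)Δ(a)`, cut by `1_{jk} ⊗ 1_{km} ⊗ 1_{mn}` on either side, is computed from `Δ(a)` cut by
`1_{jm} ⊗ 1_{mn}`. -/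
theorem tensorFun_homTensorId (j k m n j' k' m' n' : I) (ω χ ψ : A →L[ℂ] ℂ) (a : A) :
    tensorFun (tensorFun ω χ) ψ (MinTensor.tmul (G.cell j k m) (G.unit m n) *
      (strictExt (homTensorId G.comul) (G.comul a)).fst
        (MinTensor.tmul (G.cell j' k' m') (G.unit m' n'))) =
      G.conv j m n j' m' n' (G.conv j k m j' k' m' ω χ) ψ a := by
  set φ := homTensorId (B := A) G.comul
  set w := MinTensor.tmul (G.cell j k m) (G.unit m n) with hw
  set z := MinTensor.tmul (G.cell j' k' m') (G.unit m' n') with hz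
  have hz' : (φ (G.cell j' m' n')).fst z = z := by
    rw [hz, G.cell_eq j' m' n', homTensorId_tmul, multTensor_fst_tmul, comul_fst_cell,
      DoubleCentralizer.coe_fst, ContinuousLinearMap.mul_apply', unit_idem]
  have hw' : (φ (G.cell j m n)).snd w = w := by
    rw [hw, G.cell_eq j m n, homTensorId_tmul, multTensor_snd_tmul, cell_comul_snd,
      DoubleCentralizer.coe_snd, ContinuousLinearMap.flip_apply, ContinuousLinearMap.mul_apply',
      unit_idem]
  have h1 : w * (strictExt φ (G.comul a)).fst z =
      w * (φ (cut G.comul (G.cell j m n) (G.cell j' m' n') a)).fst z := by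
    have h2 := strictExt_hom_sandwich φ (dense_span_tmul_of_dense (dense_span_tmul_of_dense
      G.dense_span_unit_mul G.dense_span_unit_mul) G.dense_span_unit_mul)
      G.homTensorId_comul_cases (G.comul a) (G.cell j m n) (G.cell j' m' n')
    rw [cut_apply, ← h2, DoubleCentralizer.mul_fst, DoubleCentralizer.mul_fst, mul_apply_eq_comp,
      mul_apply_eq_comp, hz', ← DoubleCentralizer.central (φ _) w, hw']
  have h3 : tensorFun (tensorFun ω χ) ψ ∘L ContinuousLinearMap.mul ℂ _ w ∘L multEval z ∘L
      homCLM φ = tensorFun (G.conv j k m j' k' m' ω χ) ψ ∘L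
      ContinuousLinearMap.mul ℂ _ (G.cell j m n) ∘L
      (ContinuousLinearMap.mul ℂ _).flip (G.cell j' m' n') :=
    MinTensor.clm_ext fun x y => by
      simp only [ContinuousLinearMap.comp_apply, homCLM_apply, multEval_apply,
        ContinuousLinearMap.mul_apply', ContinuousLinearMap.flip_apply]
      rw [homTensorId_tmul, hz, hw, multTensor_fst_tmul, MinTensor.tmul_mul, tensorFun_tmul,
        G.cell_eq j m n, G.cell_eq j' m' n', MinTensor.tmul_mul, MinTensor.tmul_mul,
        tensorFun_tmul, conv_corner]
      rfl
  rw [h1]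
  refine (DFunLike.congr_fun h3 _).trans ?_
  simp only [ContinuousLinearMap.comp_apply, ContinuousLinearMap.mul_apply',
    ContinuousLinearMap.flip_apply, cut_apply]
  rw [mul_assoc, ← multiplier_fst_mul, cell_idem, ← mul_assoc, cell_idem]
  rfl

/-- `(id ⊗ Δ)Δ(a)`, cut by `1_{jk} ⊗ 1_{km} ⊗ 1_{mn}` on either side, is computed from `Δ(a)` cut by
`1_{jk} ⊗ 1_{kn}`. -/
theorem tensorFun_idTensorHom (j k m n j' k' m' n' : I) (ω χ ψ : A →L[ℂ] ℂ) (a : A) :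
    tensorFun ω (tensorFun χ ψ) (MinTensor.tmul (G.unit j k) (G.cell k m n) *
      (strictExt (idTensorHom G.comul) (G.comul a)).fst
        (MinTensor.tmul (G.unit j' k') (G.cell k' m' n'))) =
      G.conv j k n j' k' n' ω (G.conv k m n k' m' n' χ ψ) a := by
  set φ := idTensorHom (A := A) G.comul
  set w := MinTensor.tmul (G.unit j k) (G.cell k m n) with hw
  set z := MinTensor.tmul (G.unit j' k') (G.cell k' m' n') with hz
  have hz' : (φ (G.cell j' k' n')).fst z = z := by
    rw [hz, G.cell_eq j' k' n', idTensorHom_tmul, multTensor_fst_tmul, comul_fst_cell,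
      DoubleCentralizer.coe_fst, ContinuousLinearMap.mul_apply', unit_idem]
  have hw' : (φ (G.cell j k n)).snd w = w := by
    rw [hw, G.cell_eq j k n, idTensorHom_tmul, multTensor_snd_tmul, cell_comul_snd,
      DoubleCentralizer.coe_snd, ContinuousLinearMap.flip_apply, ContinuousLinearMap.mul_apply',
      unit_idem]
  have h1 : w * (strictExt φ (G.comul a)).fst z =
      w * (φ (cut G.comul (G.cell j k n) (G.cell j' k' n') a)).fst z := by
    have h2 := strictExt_hom_sandwich φ (dense_span_tmul_of_dense G.dense_span_unit_mul
      (dense_span_tmul_of_dense G.dense_span_unit_mul G.dense_span_unit_mul))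
      G.idTensorHom_comul_cases (G.comul a) (G.cell j k n) (G.cell j' k' n')
    rw [cut_apply, ← h2, DoubleCentralizer.mul_fst, DoubleCentralizer.mul_fst, mul_apply_eq_comp,
      mul_apply_eq_comp, hz', ← DoubleCentralizer.central (φ _) w, hw']
  have h3 : tensorFun ω (tensorFun χ ψ) ∘L ContinuousLinearMap.mul ℂ _ w ∘L multEval z ∘L
      homCLM φ = tensorFun ω (G.conv k m n k' m' n' χ ψ) ∘L
      ContinuousLinearMap.mul ℂ _ (G.cell j k n) ∘L
      (ContinuousLinearMap.mul ℂ _).flip (G.cell j' k' n') :=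
    MinTensor.clm_ext fun x y => by
      simp only [ContinuousLinearMap.comp_apply, homCLM_apply, multEval_apply,
        ContinuousLinearMap.mul_apply', ContinuousLinearMap.flip_apply]
      rw [idTensorHom_tmul, hz, hw, multTensor_fst_tmul, MinTensor.tmul_mul, tensorFun_tmul,
        G.cell_eq j k n, G.cell_eq j' k' n', MinTensor.tmul_mul, MinTensor.tmul_mul,
        tensorFun_tmul, conv_corner]
      rfl
  rw [h1]
  refine (DFunLike.congr_fun h3 _).trans ?_
  simp only [ContinuousLinearMap.comp_apply, ContinuousLinearMap.mul_apply',
    ContinuousLinearMap.flip_apply, cut_apply]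
  rw [mul_assoc, ← multiplier_fst_mul, cell_idem, ← mul_assoc, cell_idem]
  rfl

theorem tensorFun_assocHom (ω χ ψ : A →L[ℂ] ℂ) (z : MinTensor (MinTensor A A) A) :
    tensorFun ω (tensorFun χ ψ) (assocHom A A A z) = tensorFun (tensorFun ω χ) ψ z := by
  have h : tensorFun ω (tensorFun χ ψ) ∘L homCLM (assocHom A A A) =
      tensorFun (tensorFun ω χ) ψ := by
    refine ContinuousLinearMap.ext_on dense_span_tmul_tmul ?_
    rintro _ ⟨⟨a, b, c⟩, rfl⟩
    rw [ContinuousLinearMap.comp_apply, homCLM_apply, assocHom_tmul, tensorFun_tmul,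
      tensorFun_tmul, tensorFun_tmul, tensorFun_tmul, mul_assoc]
  exact DFunLike.congr_fun h z

/-- Coassociativity as associativity of the convolution of functionals. -/
theorem conv_assoc (j k m n j' k' m' n' : I) (ω χ ψ : A →L[ℂ] ℂ) :
    G.conv j m n j' m' n' (G.conv j k m j' k' m' ω χ) ψ =
      G.conv j k n j' k' n' ω (G.conv k m n k' m' n' χ ψ) := by
  ext a
  rw [← tensorFun_homTensorId, ← tensorFun_idTensorHom, ← tensorFun_assocHom, map_mul, G.coassoc,
    cell, cell, assocHom_tmul, assocHom_tmul]
  rfl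

end PartialCompactQuantumSemigroup

end Convolution

/-! ### Two-sided comultiplication data -/

section FrameSection

open Topology

/-- The convolution of functionals `(ω ⊗ χ)((u_{jk} ⊗ u_{km}) Δ(a) (u_{j'k'} ⊗ u_{k'm'}))`, for a
given tensor product map `t` with slice maps `s ω = ω ⊗ id`. -/
noncomputable def convOf {I A B : Type*} [NonUnitalCStarAlgebra A] [NonUnitalCStarAlgebra B]
    (u : I → I → A) (t : A → A → B) (s : (A →L[ℂ] ℂ) → B →L[ℂ] A) (Δ : A →⋆ₙₐ[ℂ] 𝓜(ℂ, B))
    (j k m j' k' m' : I) (ω χ : A →L[ℂ] ℂ) : A →L[ℂ] ℂ :=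
  (χ ∘L s ω) ∘L cut Δ (t (u j k) (u k m)) (t (u j' k') (u k' m'))

/-- The data of a partial compact quantum group in a form which is invariant under exchanging the
legs of the tensor product, so that every left-handed statement has a right-handed counterpart.
Here `B` stands for `A ⊗ A`, the map `t` for the tensor product of elements, `sl ω` and `sr ω` for
the slice maps `ω ⊗ id` and `id ⊗ ω`, the multipliers `l a` and `r a` for `a ⊗ 1` and `1 ⊗ a`, and
`E` for `Δ(1)`. The density of the slices of `Δ(PAP)` is stated in dual form in `dens_diag_l` and
`dens_diag_r`: a functional vanishes if it vanishes on the slices of `Δ(b)` for all `b` which are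
annihilated by the `u i j` with `i ≠ j`. -/
structure Frame (I : Type*) (A : Type*) (B : Type*) [NonUnitalCStarAlgebra A] [PartialOrder A]
    [StarOrderedRing A] [NonUnitalCStarAlgebra B] [PartialOrder B] [StarOrderedRing B] where
  u : I → I → A
  proj : ∀ k l, IsStarProjection (u k l)
  orth : ∀ k l k' l', (k, l) ≠ (k', l') → u k l * u k' l' = 0
  dense_u : Dense (Submodule.span ℂ {x | ∃ k l a, x = u k l * a} : Set A)
  unit_ne : ∀ k, u k k ≠ 0
  t : A → A → B
  dense_t : Dense (Submodule.span ℂ {z | ∃ a b, z = t a b} : Set B)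
  t_mul : ∀ a b a' b', t a b * t a' b' = t (a * a') (b * b')
  star_t : ∀ a b, star (t a b) = t (star a) (star b)
  norm_t_le : ∀ a b, ‖t a b‖ ≤ ‖a‖ * ‖b‖
  t_add_left : ∀ a a' b, t (a + a') b = t a b + t a' b
  t_add_right : ∀ a b b', t a (b + b') = t a b + t a b'
  t_smul_left : ∀ (c : ℂ) a b, t (c • a) b = c • t a b
  t_smul_right : ∀ (c : ℂ) a b, t a (c • b) = c • t a b
  sl : (A →L[ℂ] ℂ) → B →L[ℂ] A
  sr : (A →L[ℂ] ℂ) → B →L[ℂ] A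
  sl_t : ∀ ω a b, sl ω (t a b) = ω a • b
  sr_t : ∀ ω a b, sr ω (t a b) = ω b • a
  norm_sl_le : ∀ ω z, ‖sl ω z‖ ≤ ‖ω‖ * ‖z‖
  norm_sr_le : ∀ ω z, ‖sr ω z‖ ≤ ‖ω‖ * ‖z‖
  sl_nonneg : ∀ ω, IsPos ω → ∀ z, 0 ≤ z → 0 ≤ sl ω z
  sr_nonneg : ∀ ω, IsPos ω → ∀ z, 0 ≤ z → 0 ≤ sr ω z
  l : A → 𝓜(ℂ, B)
  r : A → 𝓜(ℂ, B)
  l_fst : ∀ c a b, (l c).fst (t a b) = t (c * a) b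
  l_snd : ∀ c a b, (l c).snd (t a b) = t (a * c) b
  r_fst : ∀ c a b, (r c).fst (t a b) = t a (c * b)
  r_snd : ∀ c a b, (r c).snd (t a b) = t a (b * c)
  Δ : A →⋆ₙₐ[ℂ] 𝓜(ℂ, B)
  comul_self : ∀ j k m, (Δ (u j m)).fst (t (u j k) (u k m)) = t (u j k) (u k m)
  comul_ne : ∀ j k k' m a, k ≠ k' → (Δ a).fst (t (u j k) (u k' m)) = 0
  assoc : ∀ j k m n j' k' m' n' ω χ ψ,
    convOf u t sl Δ j m n j' m' n' (convOf u t sl Δ j k m j' k' m' ω χ) ψ =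
      convOf u t sl Δ j k n j' k' n' ω (convOf u t sl Δ k m n k' m' n' χ ψ)
  mem_l : ∀ c a, ∃ z : B, l c * Δ a = z
  mem_r : ∀ c a, ∃ z : B, r c * Δ a = z
  E : 𝓜(ℂ, B)
  E_fst : ∀ j k m, E.fst (t (u j k) (u k m)) = t (u j k) (u k m)
  dens_l : ∀ z : B, (z : 𝓜(ℂ, B)) * E ∈
    closure (Submodule.span ℂ {Y | ∃ a b, Y = l a * Δ b} : Set 𝓜(ℂ, B))
  dens_r : ∀ z : B, (z : 𝓜(ℂ, B)) * E ∈
    closure (Submodule.span ℂ {Y | ∃ a b, Y = r a * Δ b} : Set 𝓜(ℂ, B))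
  dens_diag_l : ∀ θ : A →L[ℂ] ℂ, (∀ ω b (x : A), (∀ i j, i ≠ j → u i j * b = 0 ∧ b * u i j = 0) →
    strictExt (fun z : B => ((sl ω z : A) : 𝓜(ℂ, A))) (Δ b) = (x : 𝓜(ℂ, A)) → θ x = 0) → θ = 0
  dens_diag_r : ∀ θ : A →L[ℂ] ℂ, (∀ ω b (x : A), (∀ i j, i ≠ j → u i j * b = 0 ∧ b * u i j = 0) →
    strictExt (fun z : B => ((sr ω z : A) : 𝓜(ℂ, A))) (Δ b) = (x : 𝓜(ℂ, A)) → θ x = 0) → θ = 0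

namespace Frame

variable {I A B : Type*} [NonUnitalCStarAlgebra A] [PartialOrder A]
    [StarOrderedRing A] [NonUnitalCStarAlgebra B] [PartialOrder B] [StarOrderedRing B]
    (G : Frame I A B)

theorem u_idem (k l : I) : G.u k l * G.u k l = G.u k l := (G.proj k l).isIdempotentElem

theorem star_u (k l : I) : star (G.u k l) = G.u k l := (G.proj k l).isSelfAdjoint

theorem t_zero_left (b : A) : G.t 0 b = 0 := by
  rw [← zero_smul ℂ (0 : A), G.t_smul_left, zero_smul]

theorem t_sum_left {ι : Type*} (s : Finset ι) (f : ι → A) (b : A) :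
    G.t (∑ i ∈ s, f i) b = ∑ i ∈ s, G.t (f i) b :=
  map_sum (AddMonoidHom.mk' (fun a => G.t a b) fun a a' => G.t_add_left a a' b) f s

/-- Continuous linear maps on `B` are determined on elementary tensors. -/
theorem clm_ext {F : Type*} [NormedAddCommGroup F] [NormedSpace ℂ F] {S T : B →L[ℂ] F}
    (h : ∀ a b, S (G.t a b) = T (G.t a b)) (z : B) : S z = T z := by
  have : S = T := ContinuousLinearMap.ext_on G.dense_t (by rintro _ ⟨a, b, rfl⟩; exact h a b)
  rw [this]

/-- The two ways of evaluating `ω ⊗ χ` agree. -/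
theorem apply_sl (ω χ : A →L[ℂ] ℂ) (z : B) : χ (G.sl ω z) = ω (G.sr χ z) :=
  G.clm_ext (S := χ ∘L G.sl ω) (T := ω ∘L G.sr χ) (fun a b => by
    simp [G.sl_t, G.sr_t, mul_comm]) z

theorem convOf_swap (j k m j' k' m' : I) (ω χ : A →L[ℂ] ℂ) :
    convOf (fun k l => G.u l k) (fun a b => G.t b a) G.sr G.Δ j k m j' k' m' ω χ =
      convOf G.u G.t G.sl G.Δ m k j m' k' j' χ ω := by
  ext a
  exact (G.apply_sl χ ω _).symm

/-- The opposite data, with the legs of the tensor product exchanged. -/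
def op : Frame I A B where
  u k l := G.u l k
  proj k l := G.proj l k
  orth k l k' l' h := G.orth l k l' k' fun h' => h (by
    rw [Prod.mk.injEq] at h' ⊢; exact h'.symm)
  dense_u := by
    have := G.dense_u
    have h : {x | ∃ k l a, x = G.u l k * a} = {x | ∃ k l a, x = G.u k l * a} :=
      Set.ext fun x => ⟨fun ⟨k, l, a, h⟩ => ⟨l, k, a, h⟩, fun ⟨k, l, a, h⟩ => ⟨l, k, a, h⟩⟩
    rwa [h]
  unit_ne := G.unit_ne
  t a b := G.t b a
  dense_t := by
    have := G.dense_t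
    have h : {z | ∃ a b, z = G.t b a} = {z | ∃ a b, z = G.t a b} :=
      Set.ext fun x => ⟨fun ⟨a, b, h⟩ => ⟨b, a, h⟩, fun ⟨a, b, h⟩ => ⟨b, a, h⟩⟩
    rwa [h]
  t_mul a b a' b' := G.t_mul b a b' a'
  star_t a b := G.star_t b a
  norm_t_le a b := (G.norm_t_le b a).trans (mul_comm _ _).le
  t_add_left a a' b := G.t_add_right b a a'
  t_add_right a b b' := G.t_add_left b b' a
  t_smul_left c a b := G.t_smul_right c b a
  t_smul_right c a b := G.t_smul_left c b a
  sl := G.sr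
  sr := G.sl
  sl_t ω a b := G.sr_t ω b a
  sr_t ω a b := G.sl_t ω b a
  norm_sl_le := G.norm_sr_le
  norm_sr_le := G.norm_sl_le
  sl_nonneg := G.sr_nonneg
  sr_nonneg := G.sl_nonneg
  l := G.r
  r := G.l
  l_fst c a b := G.r_fst c b a
  l_snd c a b := G.r_snd c b a
  r_fst c a b := G.l_fst c b a
  r_snd c a b := G.l_snd c b a
  Δ := G.Δ
  comul_self j k m := G.comul_self m k j
  comul_ne j k k' m a h := G.comul_ne m k' k j a h.symm
  assoc j k m n j' k' m' n' ω χ ψ := by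
    rw [convOf_swap, convOf_swap, convOf_swap, convOf_swap, G.assoc]
  mem_l := G.mem_r
  mem_r := G.mem_l
  E := G.E
  E_fst j k m := G.E_fst m k j
  dens_l := G.dens_r
  dens_r := G.dens_l
  dens_diag_l θ h := G.dens_diag_r θ fun ω b x hb hx =>
    h ω b x (fun i j hij => hb j i hij.symm) hx
  dens_diag_r θ h := G.dens_diag_l θ fun ω b x hb hx =>
    h ω b x (fun i j hij => hb j i hij.symm) hx

/-- The finite partial sums of the projections `u k l`. -/
noncomputable def pSum (s : Finset (I × I)) : A := ∑ p ∈ s, G.u p.1 p.2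

theorem isStarProjection_pSum (s : Finset (I × I)) : IsStarProjection (G.pSum s) :=
  isStarProjection_sum (w := fun p : I × I => G.u p.1 p.2) (fun _ => G.proj _ _)
    (fun _ _ h => G.orth _ _ _ _ h) s

theorem tendsto_pSum_mul (a : A) : Tendsto (fun s => G.pSum s * a) atTop (𝓝 a) := by
  have hb : ∀ s, ‖ContinuousLinearMap.mul ℂ A (G.pSum s)‖ ≤ 1 := fun s =>
    (ContinuousLinearMap.opNorm_mul_apply_le ℂ A _).trans ((G.isStarProjection_pSum s).norm_le _)
  have hfix : ∀ k l b, ∀ᶠ s in atTop, G.pSum s * (G.u k l * b) = G.u k l * b := by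
    intro k l b
    filter_upwards [eventually_ge_atTop {(k, l)}] with s hs
    rw [pSum, ← mul_assoc, Finset.sum_mul, Finset.sum_eq_single (k, l), u_idem]
    · intro q _ hq
      exact G.orth _ _ _ _ hq
    · intro h; exact absurd (hs (Finset.mem_singleton_self _)) h
  have hspan : ∀ x ∈ Submodule.span ℂ {x | ∃ k l a, x = G.u k l * a},
      Tendsto (fun s => G.pSum s * x) atTop (𝓝 x) := by
    intro x hx
    induction hx using Submodule.span_induction with
    | mem x hx =>
      obtain ⟨k, l, b, rfl⟩ := hx
      exact tendsto_const_nhds.congr' ((hfix k l b).mono fun s hs => hs.symm)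
    | zero => simp
    | add x y _ _ hx hy => simpa only [mul_add] using hx.add hy
    | smul c x _ hx => simpa only [mul_smul_comm] using hx.const_smul c
  rw [Metric.tendsto_nhds]
  intro ε hε
  obtain ⟨w, hw, hwS⟩ := Metric.dense_iff.1 G.dense_u a (ε / 3) (by positivity)
  filter_upwards [(Metric.tendsto_nhds.1 (hspan w hwS)) (ε / 3) (by positivity)] with s hs
  rw [Metric.mem_ball] at hw
  have h1 : dist (G.pSum s * a) (G.pSum s * w) ≤ dist w a := by
    rw [dist_comm w a, dist_eq_norm, dist_eq_norm, ← mul_sub]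
    refine (norm_mul_le _ _).trans ?_
    exact mul_le_of_le_one_left (norm_nonneg _) ((G.isStarProjection_pSum s).norm_le _)
  have h2 := dist_triangle4 (G.pSum s * a) (G.pSum s * w) w a
  linarith

theorem tendsto_mul_pSum (a : A) : Tendsto (fun s => a * G.pSum s) atTop (𝓝 a) := by
  have h := (G.tendsto_pSum_mul (star a)).star
  rw [star_star] at h
  refine h.congr fun s => ?_
  rw [star_mul, star_star, (G.isStarProjection_pSum s).isSelfAdjoint.star_eq]

theorem eq_of_corners {x y : A}
    (h : ∀ k m k' m', G.u k m * x * G.u k' m' = G.u k m * y * G.u k' m') : x = y := by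
  have h1 : ∀ s s', G.pSum s * x * G.pSum s' = G.pSum s * y * G.pSum s' := fun s s' => by
    simp only [pSum, Finset.sum_mul, Finset.mul_sum]
    exact Finset.sum_congr rfl fun p _ => Finset.sum_congr rfl fun q _ => h _ _ _ _
  have h2 : ∀ s, G.pSum s * x = G.pSum s * y := fun s =>
    tendsto_nhds_unique ((G.tendsto_mul_pSum _).congr fun s' => h1 s s') (G.tendsto_mul_pSum _)
  exact tendsto_nhds_unique ((G.tendsto_pSum_mul x).congr h2) (G.tendsto_pSum_mul y)

/-! ### Slices of the comultiplication -/

theorem sl_sub (ω χ : A →L[ℂ] ℂ) (z : B) : G.sl (ω - χ) z = G.sl ω z - G.sl χ z :=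
  G.clm_ext (S := G.sl (ω - χ)) (T := G.sl ω - G.sl χ) (fun a b => by
    rw [sub_apply, G.sl_t, G.sl_t, G.sl_t, sub_apply, sub_smul]) z

theorem sl_mulLeftFun (ω : A →L[ℂ] ℂ) (c : A) (z : B) :
    G.sl (mulLeftFun ω c) z = G.sl ω ((G.l c).fst z) :=
  G.clm_ext (S := G.sl (mulLeftFun ω c)) (T := G.sl ω ∘L (G.l c).fst) (fun a b => by
    rw [ContinuousLinearMap.comp_apply, G.l_fst, G.sl_t, G.sl_t, mulLeftFun_apply]) z

theorem mul_sl (ω : A →L[ℂ] ℂ) (d : A) (z : B) : d * G.sl ω z = G.sl ω ((G.r d).fst z) :=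
  G.clm_ext (S := ContinuousLinearMap.mul ℂ A d ∘L G.sl ω) (T := G.sl ω ∘L (G.r d).fst)
    (fun a b => by
      rw [ContinuousLinearMap.comp_apply, ContinuousLinearMap.comp_apply, G.r_fst, G.sl_t, G.sl_t,
        ContinuousLinearMap.mul_apply', mul_smul_comm]) z

theorem sl_mulRightFun_mul (ω : A →L[ℂ] ℂ) (c d : A) (z : B) :
    G.sl (mulRightFun ω c) z * d = G.sl ω (z * G.t c d) :=
  G.clm_ext (S := (ContinuousLinearMap.mul ℂ A).flip d ∘L G.sl (mulRightFun ω c))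
    (T := G.sl ω ∘L (ContinuousLinearMap.mul ℂ B).flip (G.t c d)) (fun a b => by
      rw [ContinuousLinearMap.comp_apply, ContinuousLinearMap.comp_apply,
        ContinuousLinearMap.flip_apply, ContinuousLinearMap.flip_apply,
        ContinuousLinearMap.mul_apply', ContinuousLinearMap.mul_apply', G.t_mul, G.sl_t, G.sl_t,
        mulRightFun_apply, smul_mul_assoc]) z

/-- Slices of `(c ⊗ d) z (c' ⊗ d')`. -/
theorem sl_sandwich (ω : A →L[ℂ] ℂ) (c d c' d' : A) (z : B) :
    G.sl ω (G.t c d * (z * G.t c' d')) = d * (G.sl (mulFun ω c c') z * d') :=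
  (G.clm_ext (S := ContinuousLinearMap.mul ℂ A d ∘L (ContinuousLinearMap.mul ℂ A).flip d' ∘L
      G.sl (mulFun ω c c'))
    (T := G.sl ω ∘L ContinuousLinearMap.mul ℂ B (G.t c d) ∘L
      (ContinuousLinearMap.mul ℂ B).flip (G.t c' d')) (fun a b => by
      simp only [ContinuousLinearMap.comp_apply, ContinuousLinearMap.flip_apply,
        ContinuousLinearMap.mul_apply', G.t_mul, G.sl_t, mulFun_apply, smul_mul_assoc,
        mul_smul_comm]) z).symm

theorem sr_sandwich (ω : A →L[ℂ] ℂ) (c d c' d' : A) (z : B) :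
    G.sr ω (G.t c d * (z * G.t c' d')) = c * (G.sr (mulFun ω d d') z * c') :=
  G.op.sl_sandwich ω d c d' c' z

theorem r_mul_l (c d : A) : G.r d * G.l c = (G.t c d : 𝓜(ℂ, B)) :=
  multiplier_ext fun z =>
    G.clm_ext (S := (G.r d * G.l c).fst) (T := (G.t c d : 𝓜(ℂ, B)).fst) (fun a b => by
      rw [DoubleCentralizer.mul_fst, mul_apply_eq_comp, G.l_fst, G.r_fst,
        DoubleCentralizer.coe_fst, ContinuousLinearMap.mul_apply', G.t_mul]) z

/-- The slice `(ω ⊗ id)Δ(a)` is an element of the algebra, for every bounded functional `ω`. It is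
the limit of the slices by the functionals `ω(p · p)`, where `p` runs through the finite sums of the
projections `u k l`. -/
theorem exists_slice (ω : A →L[ℂ] ℂ) (a : A) :
    ∃ x : A, strictExt (fun z : B => ((G.sl ω z : A) : 𝓜(ℂ, A))) (G.Δ a) = x ∧
      ∀ d d', Tendsto (fun s => G.sl ω (cut G.Δ (G.t (G.pSum s) d) (G.t (G.pSum s) d') a)) atTop
        (𝓝 (d * x * d')) := by
  classical
  set X := G.Δ a
  have hinc := CStarAlgebra.increasingApproximateUnit B
  choose y hy using fun s => G.mem_l (G.pSum s) a
  have hω := tendsto_norm_sub_mulFun G.isStarProjection_pSum G.tendsto_pSum_mul ω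
  set ωs := fun s => mulFun ω (G.pSum s) (G.pSum s)
  set xs := fun s => G.sl (mulRightFun ω (G.pSum s)) (y s)
  have hr : ∀ s d, Tendsto (fun e => G.sl (ωs s) (X.fst e) * d) (CStarAlgebra.approximateUnit B)
      (𝓝 (xs s * d)) := by
    intro s d
    have h1 : Tendsto (fun e => G.sl ω (y s * (e * G.t (G.pSum s) d)))
        (CStarAlgebra.approximateUnit B) (𝓝 (G.sl ω (y s * G.t (G.pSum s) d))) :=
      ((G.sl ω).continuous.tendsto _).comp ((hinc.tendsto_mul_right _).const_mul _)
    change Tendsto _ _ (𝓝 (G.sl (mulRightFun ω (G.pSum s)) (y s) * d))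
    rw [sl_mulRightFun_mul]
    refine h1.congr fun e => ?_
    change _ = G.sl (mulRightFun (mulLeftFun ω (G.pSum s)) (G.pSum s)) (X.fst e) * d
    rw [sl_mulRightFun_mul, sl_mulLeftFun, multiplier_fst_mul, ← mul_assoc]
    have h2 := congrArg (fun Y : 𝓜(ℂ, B) => Y.fst e) (hy s)
    simp only [DoubleCentralizer.mul_fst, mul_apply_eq_comp, DoubleCentralizer.coe_fst,
      ContinuousLinearMap.mul_apply'] at h2
    rw [h2]
  have hry : ∀ s d, (G.r d).fst (y s) = X.snd (G.t (G.pSum s) d) := by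
    intro s d
    refine coe_mult_injective ?_
    rw [← multiplier_mul_coe, ← hy, ← mul_assoc, r_mul_l, coe_mul_multiplier]
  have hl : ∀ s d, Tendsto (fun e => d * G.sl (ωs s) (X.fst e)) (CStarAlgebra.approximateUnit B)
      (𝓝 (d * xs s)) := by
    intro s d
    have h1 : Tendsto (fun e => G.sl (mulRightFun ω (G.pSum s)) (X.snd (G.t (G.pSum s) d) * e))
        (CStarAlgebra.approximateUnit B)
        (𝓝 (G.sl (mulRightFun ω (G.pSum s)) (X.snd (G.t (G.pSum s) d)))) :=
      ((G.sl _).continuous.tendsto _).comp (hinc.tendsto_mul_left _)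
    change Tendsto _ _ (𝓝 (d * G.sl (mulRightFun ω (G.pSum s)) (y s)))
    rw [mul_sl, hry]
    refine h1.congr fun e => ?_
    have h3 : ωs s = mulLeftFun (mulRightFun ω (G.pSum s)) (G.pSum s) := by
      ext b
      simp only [ωs, mulFun_apply, mulLeftFun_apply, mulRightFun_apply, mul_assoc]
    rw [h3, sl_mulLeftFun, mul_sl, DoubleCentralizer.central]
    have h2 := congrArg (fun Y : 𝓜(ℂ, B) => Y.fst (X.fst e)) (G.r_mul_l (G.pSum s) d)
    simp only [DoubleCentralizer.mul_fst, mul_apply_eq_comp, DoubleCentralizer.coe_fst,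
      ContinuousLinearMap.mul_apply'] at h2
    rw [h2]
  have hbd : ∀ χ : A →L[ℂ] ℂ, ∀ᶠ e in CStarAlgebra.approximateUnit B,
      ‖G.sl χ (X.fst e)‖ ≤ ‖χ‖ * ‖X‖ :=
    fun χ => hinc.eventually_norm.mono fun e he => (G.norm_sl_le _ _).trans
      (mul_le_mul_of_nonneg_left ((norm_multiplier_fst_le _ _).trans
        (mul_le_of_le_one_right (norm_nonneg _) he)) (norm_nonneg _))
  -- the elements `xs s` form a Cauchy net since the functionals `ω(p · p)` do
  have hx : ∀ s s', ‖xs s - xs s'‖ ≤ ‖ωs s - ωs s'‖ * ‖X‖ := by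
    intro s s'
    have h1 : ∀ d, ‖(xs s - xs s') * d‖ ≤ ‖ωs s - ωs s'‖ * ‖X‖ * ‖d‖ := by
      intro d
      rw [sub_mul]
      refine le_of_tendsto ((hr s d).sub (hr s' d)).norm ((hbd (ωs s - ωs s')).mono fun e he => ?_)
      rw [← sub_mul, ← sl_sub]
      exact (norm_mul_le _ _).trans (mul_le_mul_of_nonneg_right he (norm_nonneg _))
    by_cases h0 : ‖xs s - xs s'‖ = 0
    · rw [h0]; positivity
    · have h2 := h1 (star (xs s - xs s'))
      rw [CStarRing.norm_self_mul_star, norm_star] at h2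
      exact le_of_mul_le_mul_right h2 (lt_of_le_of_ne (norm_nonneg _) (Ne.symm h0))
  have hωs : Tendsto ωs atTop (𝓝 ω) := by
    rw [tendsto_iff_norm_sub_tendsto_zero]
    exact hω.congr fun s => norm_sub_rev _ _
  have hcau : CauchySeq xs := by
    rw [Metric.cauchySeq_iff]
    intro ε hε
    obtain ⟨N, hN⟩ := Metric.cauchySeq_iff.1 hωs.cauchySeq (ε / (‖X‖ + 1)) (by positivity)
    refine ⟨N, fun m hm n hn => ?_⟩
    have h1 := hN m hm n hn
    rw [dist_eq_norm] at h1 ⊢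
    calc ‖xs m - xs n‖ ≤ ‖ωs m - ωs n‖ * ‖X‖ := hx m n
      _ ≤ ‖ωs m - ωs n‖ * (‖X‖ + 1) := by gcongr; linarith
      _ < ε / (‖X‖ + 1) * (‖X‖ + 1) := by gcongr
      _ = ε := by field_simp
  obtain ⟨x, hxlim⟩ := cauchySeq_tendsto_of_complete hcau
  have hδ : ∀ d : A, Tendsto (fun s => ‖ω - ωs s‖ * ‖X‖ * ‖d‖) atTop (𝓝 0) := fun d => by
    simpa using (hω.mul_const ‖X‖).mul_const ‖d‖
  have hstrict : StrictTendsto (fun e => ((G.sl ω (X.fst e) : A) : 𝓜(ℂ, A)))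
      (CStarAlgebra.approximateUnit B) x := by
    intro d
    constructor
    · refine tendsto_of_uniform_approx (f := fun e => G.sl ω (X.fst e) * d)
        (fun s => hr s d) (hxlim.mul_const d) (hδ d) fun s => ?_
      filter_upwards [hbd (ω - ωs s)] with e he
      rw [← sub_mul, ← sl_sub]
      exact (norm_mul_le _ _).trans (mul_le_mul_of_nonneg_right he (norm_nonneg _))
    · refine tendsto_of_uniform_approx (f := fun e => d * G.sl ω (X.fst e))
        (fun s => hl s d) (hxlim.const_mul d) (hδ d) fun s => ?_
      filter_upwards [hbd (ω - ωs s)] with e he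
      rw [← mul_sub, ← sl_sub]
      exact (norm_mul_le _ _).trans
        ((mul_comm _ _).trans_le (mul_le_mul_of_nonneg_right he (norm_nonneg _)))
  refine ⟨x, hstrict.strictLim_eq, fun d d' => ?_⟩
  refine ((hxlim.const_mul d).mul_const d').congr fun s => ?_
  change d * G.sl (mulRightFun ω (G.pSum s)) (y s) * d' = _
  rw [mul_sl, hry, sl_mulRightFun_mul, cut_apply, ← DoubleCentralizer.central]

theorem slice_tendsto {ω : A →L[ℂ] ℂ} {a x : A}
    (hx : strictExt (fun z : B => ((G.sl ω z : A) : 𝓜(ℂ, A))) (G.Δ a) = x) (d d' : A) :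
    Tendsto (fun s => G.sl ω (cut G.Δ (G.t (G.pSum s) d) (G.t (G.pSum s) d') a)) atTop
      (𝓝 (d * x * d')) := by
  obtain ⟨y, hy, h⟩ := G.exists_slice ω a
  rw [hy] at hx
  rw [← coe_mult_injective hx]
  exact h d d'

theorem star_mul_comul (a b : A) (e f : B) :
    star ((G.Δ a).fst e) * (G.Δ b).fst f = star e * (G.Δ (star a * b)).fst f := by
  rw [star_multiplier_fst, DoubleCentralizer.central, ← map_star G.Δ, map_mul,
    DoubleCentralizer.mul_fst]
  rfl

theorem cut_nonneg (e : B) {a : A} (ha : 0 ≤ a) : 0 ≤ cut G.Δ (star e) e a := by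
  obtain ⟨b, rfl⟩ := CStarAlgebra.nonneg_iff_eq_star_mul_self.1 ha
  rw [cut_apply, ← star_mul_comul]
  exact star_mul_self_nonneg _

theorem slice_nonneg {ω : A →L[ℂ] ℂ} (hω : IsPos ω) {a x : A} (ha : 0 ≤ a)
    (hx : strictExt (fun z : B => ((G.sl ω z : A) : 𝓜(ℂ, A))) (G.Δ a) = x) : 0 ≤ x := by
  have h1 : ∀ d, 0 ≤ star d * x * d := by
    intro d
    refine CStarAlgebra.isClosed_nonneg.mem_of_tendsto (G.slice_tendsto hx (star d) d)
      (Eventually.of_forall fun s => G.sl_nonneg ω hω _ ?_)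
    have := G.cut_nonneg (G.t (G.pSum s) d) ha
    rwa [G.star_t, (G.isStarProjection_pSum s).isSelfAdjoint.star_eq] at this
  have h2 : Tendsto (fun s => G.pSum s * (x * G.pSum s - x) + G.pSum s * x) atTop (𝓝 (0 + x)) := by
    refine Tendsto.add ?_ (G.tendsto_pSum_mul x)
    have h3 := (G.tendsto_mul_pSum x).sub_const x
    rw [sub_self] at h3
    refine squeeze_zero_norm (fun s => ?_) (tendsto_zero_iff_norm_tendsto_zero.1 h3)
    exact (norm_mul_le _ _).trans
      (mul_le_of_le_one_left (norm_nonneg _) ((G.isStarProjection_pSum s).norm_le _))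
  rw [zero_add] at h2
  refine CStarAlgebra.isClosed_nonneg.mem_of_tendsto h2 (Eventually.of_forall fun s => ?_)
  have h3 := h1 (G.pSum s)
  rw [(G.isStarProjection_pSum s).isSelfAdjoint.star_eq] at h3
  change 0 ≤ _
  rwa [mul_sub, sub_add_cancel, ← mul_assoc]

end Frame

end FrameSection

/-! ### Corner states and the Haar state of a diagonal corner -/

section Haar

open Topology

namespace Frame

variable {I A B : Type*} [NonUnitalCStarAlgebra A] [PartialOrder A]
    [StarOrderedRing A] [NonUnitalCStarAlgebra B] [PartialOrder B] [StarOrderedRing B]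
    (G : Frame I A B)

/-- The projection `u_{jk} ⊗ u_{km}` below `Δ(u_{jm})`. -/
noncomputable def cell (j k m : I) : B := G.t (G.u j k) (G.u k m)

theorem cell_eq (j k m : I) : G.cell j k m = G.t (G.u j k) (G.u k m) := rfl

theorem cell_idem (j k m : I) : G.cell j k m * G.cell j k m = G.cell j k m := by
  rw [cell, G.t_mul, u_idem, u_idem]

theorem star_cell (j k m : I) : star (G.cell j k m) = G.cell j k m := by
  rw [cell, G.star_t, star_u, star_u]

theorem comul_fst_cell (j k m : I) : (G.Δ (G.u j m)).fst (G.cell j k m) = G.cell j k m :=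
  G.comul_self j k m

theorem comul_snd_cell (j k m : I) : (G.Δ (G.u j m)).snd (G.cell j k m) = G.cell j k m := by
  have h := congrArg star (G.comul_fst_cell j k m)
  rwa [star_multiplier_fst, ← map_star G.Δ, star_u, star_cell] at h

theorem comul_snd_eq_zero {k k' : I} (hk : k ≠ k') (j m : I) (a : A) :
    (G.Δ a).snd (G.t (G.u j k) (G.u k' m)) = 0 := by
  have h := congrArg star (G.comul_ne j k k' m (star a) hk)
  rwa [star_multiplier_fst, ← map_star G.Δ, star_star, G.star_t, star_u, star_u, star_zero] at h

/-- The part of `Δ(a)` between two cells. -/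
noncomputable def D (j k m j' k' m' : I) : A →L[ℂ] B :=
  cut G.Δ (G.cell j k m) (G.cell j' k' m')

theorem D_apply (j k m j' k' m' : I) (a : A) :
    G.D j k m j' k' m' a = G.cell j k m * (G.Δ a).fst (G.cell j' k' m') := rfl

theorem D_corner (j k m j' k' m' : I) (a : A) :
    G.D j k m j' k' m' (G.u j m * (a * G.u j' m')) = G.D j k m j' k' m' a := by
  rw [D_apply, D_apply, map_mul, map_mul, DoubleCentralizer.mul_fst, DoubleCentralizer.mul_fst,
    mul_apply_eq_comp, mul_apply_eq_comp, comul_fst_cell, ← DoubleCentralizer.central,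
    comul_snd_cell]

theorem cell_mul_D (j k m j' k' m' : I) (a : A) :
    G.cell j k m * (G.D j k m j' k' m' a * G.cell j' k' m') = G.D j k m j' k' m' a := by
  rw [D_apply, mul_assoc, ← multiplier_fst_mul, cell_idem, ← mul_assoc, cell_idem]

theorem D_mul_cell (j k m j' k' m' : I) (a : A) :
    G.D j k m j' k' m' a * G.cell j' k' m' = G.D j k m j' k' m' a := by
  rw [D_apply, mul_assoc, ← multiplier_fst_mul, cell_idem]

theorem D_unit (j k k' m : I) :
    G.D j k m j k' m (G.u j m) = G.cell j k m * G.cell j k' m := by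
  rw [D_apply, comul_fst_cell]

theorem D_nonneg (j k m : I) {a : A} (ha : 0 ≤ a) : 0 ≤ G.D j k m j k m a := by
  have := G.cut_nonneg (G.cell j k m) ha
  rwa [star_cell] at this

/-- The functional `ω ⊗ χ`. -/
noncomputable def tens (ω χ : A →L[ℂ] ℂ) : B →L[ℂ] ℂ := χ ∘L G.sl ω

theorem tens_t (ω χ : A →L[ℂ] ℂ) (a b : A) : G.tens ω χ (G.t a b) = ω a * χ b := by
  rw [tens, ContinuousLinearMap.comp_apply, G.sl_t, map_smul, smul_eq_mul]

theorem tens_isPos {ω χ : A →L[ℂ] ℂ} (hω : IsPos ω) (hχ : IsPos χ) : IsPos (G.tens ω χ) :=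
  fun z hz => hχ _ (G.sl_nonneg ω hω z hz)

/-- The convolution of functionals, seen between two cells. -/
noncomputable def conv (j k m j' k' m' : I) (ω χ : A →L[ℂ] ℂ) : A →L[ℂ] ℂ :=
  convOf G.u G.t G.sl G.Δ j k m j' k' m' ω χ

variable {G} {j k m n j' k' m' n' : I} {ω χ ψ : A →L[ℂ] ℂ}

theorem conv_apply (a : A) :
    G.conv j k m j' k' m' ω χ a = χ (G.sl ω (G.D j k m j' k' m' a)) := rfl

theorem conv_apply' (a : A) :
    G.conv j k m j' k' m' ω χ a = ω (G.sr χ (G.D j k m j' k' m' a)) :=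
  G.apply_sl ω χ _

theorem conv_apply_tens (a : A) :
    G.conv j k m j' k' m' ω χ a = G.tens ω χ (G.D j k m j' k' m' a) := rfl

theorem op_conv : G.op.conv j k m j' k' m' ω χ = G.conv m k j m' k' j' χ ω :=
  G.convOf_swap j k m j' k' m' ω χ

theorem conv_assoc :
    G.conv j m n j' m' n' (G.conv j k m j' k' m' ω χ) ψ =
      G.conv j k n j' k' n' ω (G.conv k m n k' m' n' χ ψ) :=
  G.assoc j k m n j' k' m' n' ω χ ψ

theorem conv_corner (a : A) :
    G.conv j k m j' k' m' ω χ (G.u j m * (a * G.u j' m')) = G.conv j k m j' k' m' ω χ a := by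
  rw [conv_apply, conv_apply, D_corner]

theorem conv_unit_self : G.conv j k m j k m ω χ (G.u j m) = ω (G.u j k) * χ (G.u k m) := by
  rw [conv_apply_tens, D_unit, cell_idem, cell, tens_t]

theorem conv_unit_ne (h : k ≠ k') : G.conv j k m j k' m ω χ (G.u j m) = 0 := by
  rw [conv_apply_tens, D_unit, cell, cell, G.t_mul, G.orth j k j k' (by simpa using h),
    t_zero_left, map_zero]

theorem sr_D (hχ : mulFun χ (G.u k m) (G.u k' m') = χ) (a : A) :
    G.u j k * (G.sr χ (G.D j k m j' k' m' a) * G.u j' k') = G.sr χ (G.D j k m j' k' m' a) := by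
  conv_rhs => rw [← cell_mul_D, cell, cell, sr_sandwich, hχ]

/-- A state of the corner `u_{km} A u_{km}`, regarded as a functional on `A`. -/
structure IsCornerState (G : Frame I A B) (k m : I) (ω : A →L[ℂ] ℂ) : Prop where
  pos : IsPos ω
  unit : ω (G.u k m) = 1
  supp : ∀ a, ω (G.u k m * (a * G.u k m)) = ω a

namespace IsCornerState

theorem op (h : IsCornerState G k m ω) : IsCornerState G.op m k ω := ⟨h.pos, h.unit, h.supp⟩

theorem mulFun_eq (h : IsCornerState G k m ω) : mulFun ω (G.u k m) (G.u k m) = ω :=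
  ContinuousLinearMap.ext h.supp

theorem mul_right (h : IsCornerState G k m ω) (a : A) : ω (a * G.u k m) = ω a := by
  rw [← h.supp, mul_assoc, u_idem, h.supp]

theorem mul_left (h : IsCornerState G k m ω) (a : A) : ω (G.u k m * a) = ω a := by
  rw [← h.supp, mul_assoc, ← mul_assoc, u_idem, h.supp]

theorem norm_apply_le (h : IsCornerState G k m ω) (a : A) : ‖ω a‖ ≤ ‖a‖ := by
  have := h.pos.norm_apply_le_of_supp (G.proj k m) h.supp a
  rwa [h.unit, norm_one, one_mul] at this

theorem ne_zero (h : IsCornerState G k m ω) : G.u k m ≠ 0 := fun h0 => by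
  have := h.unit
  rw [h0, map_zero] at this
  exact zero_ne_one this

theorem conv (h : IsCornerState G j k ω) (h' : IsCornerState G k m χ) :
    IsCornerState G j m (G.conv j k m j k m ω χ) :=
  ⟨fun a ha => G.tens_isPos h.pos h'.pos _ (G.D_nonneg j k m ha),
    by rw [conv_unit_self, h.unit, h'.unit, one_mul], fun a => conv_corner a⟩

/-- Averages of corner states are corner states. -/
theorem average {ι : Type*} {s : Finset ι} (hs : s.Nonempty) {f : ι → A →L[ℂ] ℂ}
    (h : ∀ i ∈ s, IsCornerState G k m (f i)) :
    IsCornerState G k m (((s.card : ℂ)⁻¹) • ∑ i ∈ s, f i) := by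
  have hc : (s.card : ℂ) ≠ 0 := by exact_mod_cast hs.card_pos.ne'
  have happ : ∀ a, (((s.card : ℂ)⁻¹) • ∑ i ∈ s, f i) a = (s.card : ℂ)⁻¹ * ∑ i ∈ s, f i a := by
    intro a
    rw [smul_apply, sum_apply, smul_eq_mul]
  refine ⟨fun a ha => ?_, ?_, fun a => ?_⟩
  · rw [happ]
    refine mul_nonneg ?_ (Finset.sum_nonneg fun i hi => (h i hi).pos a ha)
    rw [← Complex.ofReal_natCast, ← Complex.ofReal_inv]
    exact_mod_cast inv_nonneg.2 (Nat.cast_nonneg (α := ℝ) s.card)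
  · rw [happ, Finset.sum_congr rfl fun i hi => (h i hi).unit, Finset.sum_const, nsmul_eq_mul,
      mul_one, inv_mul_cancel₀ hc]
  · rw [happ, happ, Finset.sum_congr rfl fun i hi => (h i hi).supp a]

end IsCornerState

/-- Normalizing a positive functional on a corner. -/
theorem exists_isCornerState_of_isPos (hω : IsPos ω) (h0 : ω (G.u k m) ≠ 0) :
    IsCornerState G k m ((ω (G.u k m))⁻¹ • mulFun ω (G.u k m) (G.u k m)) := by
  have hp := hω (G.u k m) (G.proj k m).nonneg
  refine ⟨fun a ha => ?_, ?_, fun a => ?_⟩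
  · rw [smul_apply, smul_eq_mul]
    refine mul_nonneg (inv_nonneg.2 hp) ?_
    have := (hω.mulFun (G.u k m)) a ha
    rwa [star_u] at this
  · rw [smul_apply, smul_eq_mul, mulFun_apply, u_idem, u_idem, inv_mul_cancel₀ h0]
  · rw [smul_apply, smul_apply, mulFun_apply, mulFun_apply, mul_assoc, mul_assoc, u_idem,
      ← mul_assoc, u_idem]

theorem exists_isCornerState (h : G.u k m ≠ 0) : ∃ ω, IsCornerState G k m ω := by
  obtain ⟨f, hf⟩ := exists_positive_apply_ne_zero (G.proj k m).nonneg h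
  obtain ⟨ω, hω, hωf⟩ := exists_isPos f
  exact ⟨_, exists_isCornerState_of_isPos hω (by rwa [hωf])⟩

/-- An element of a corner on which all corner states vanish is zero. -/
theorem eq_zero_of_isCornerState {x : A} (hx : G.u k m * (x * G.u k m) = x)
    (h : ∀ ω, IsCornerState G k m ω → ω x = 0) : x = 0 := by
  refine eq_zero_of_isPos fun ω hω => ?_
  by_cases h0 : ω (G.u k m) = 0
  · rw [← hx]
    refine norm_eq_zero.1 (le_antisymm ?_ (norm_nonneg _))
    have h1 := hω.norm_apply_sq_le (G.u k m) (x * G.u k m)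
    rw [star_u, u_idem, h0, norm_zero, zero_mul] at h1
    exact (pow_eq_zero_iff two_ne_zero |>.1 (le_antisymm h1 (by positivity))).le
  · have := h _ (exists_isCornerState_of_isPos hω h0)
    rw [smul_apply, mulFun_apply, hx, smul_eq_mul] at this
    exact (mul_eq_zero.1 this).resolve_left (inv_ne_zero h0)

theorem eq_of_forall_functional {x y : A} (h : ∀ θ : A →L[ℂ] ℂ, θ x = θ y) : x = y := by
  rw [← sub_eq_zero]
  exact eq_zero_of_isPos fun θ _ => by rw [map_sub, h, sub_self]

theorem continuous_t_left (b : A) : Continuous fun a => G.t a b :=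
  (({ toFun := fun a => G.t a b
      map_add' := fun a a' => G.t_add_left a a' b
      map_smul' := fun c a => G.t_smul_left c a b } : A →ₗ[ℂ] B).mkContinuous ‖b‖
    fun a => (G.norm_t_le a b).trans (mul_comm _ _).le).continuous

theorem tens_t_mul_D {h g : A →L[ℂ] ℂ} (hh : IsCornerState G k k h)
    (hg : mulFun g (G.u k k) (G.u k k) = g) (j : I) (c a : A) :
    G.tens h g (G.t c (G.u k k) * G.D j k k k k k a) =
      G.conv j k k k k k (mulLeftFun h c) g a := by
  have h1 : mulFun h c (G.u k k) = mulLeftFun h c := by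
    ext x
    rw [mulFun_apply, mulLeftFun_apply, ← mul_assoc, hh.mul_right]
  rw [← D_mul_cell, cell, tens, ContinuousLinearMap.comp_apply, sl_sandwich, h1]
  exact DFunLike.congr_fun hg _

/-- A density property for functionals: since `(A ⊗ 1)Δ(A)` spans a dense subspace of
`(A ⊗ A)Δ(1)`, a functional `g` on the corner at `(k, k)` vanishes if all convolutions of the
functionals `h(c ·)` with `g` vanish. -/
theorem eq_zero_of_conv_eq_zero {h g : A →L[ℂ] ℂ} (hh : IsCornerState G k k h)
    (hg : mulFun g (G.u k k) (G.u k k) = g)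
    (hz : ∀ j c, G.conv j k k k k k (mulLeftFun h c) g = 0) : g = 0 := by
  have h1 : ∀ c a, G.tens h g (G.t c (G.u k k) * (G.Δ a).fst (G.cell k k k)) = 0 := by
    intro c a
    have hcont : Continuous fun c =>
        G.tens h g (G.t c (G.u k k) * (G.Δ a).fst (G.cell k k k)) :=
      (G.tens h g).continuous.comp ((continuous_t_left (G.u k k)).mul continuous_const)
    refine tendsto_nhds_unique ((hcont.tendsto c).comp (G.tendsto_mul_pSum c))
      (tendsto_const_nhds.congr fun s => ?_)
    simp only [Function.comp]
    rw [pSum, Finset.mul_sum, t_sum_left, Finset.sum_mul, map_sum]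
    refine (Finset.sum_eq_zero fun q _ => ?_).symm
    have h2 : G.t (c * G.u q.1 q.2) (G.u k k) =
        G.t c (G.u k k) * G.t (G.u q.1 q.2) (G.u k k) := by rw [G.t_mul, u_idem]
    rw [h2, mul_assoc]
    by_cases hq : q.2 = k
    · rw [hq]
      change G.tens h g (G.t c (G.u k k) * G.D q.1 k k k k k a) = 0
      rw [tens_t_mul_D hh hg, hz]
      rfl
    · rw [← DoubleCentralizer.central, G.comul_snd_eq_zero hq, zero_mul, mul_zero, map_zero]
  let Ψ : 𝓜(ℂ, B) →L[ℂ] ℂ := G.tens h g ∘L ContinuousLinearMap.mul ℂ B (G.cell k k k) ∘L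
    multEval (G.cell k k k)
  have hΨ : ∀ Y, Ψ Y = G.tens h g (G.cell k k k * Y.fst (G.cell k k k)) := fun Y => rfl
  have h2 : ∀ Y ∈ closure (Submodule.span ℂ {Y | ∃ a b, Y = G.l a * G.Δ b} : Set 𝓜(ℂ, B)),
      Ψ Y = 0 := by
    intro Y hY
    have hcl : IsClosed {Y | Ψ Y = 0} := isClosed_eq Ψ.continuous continuous_const
    refine hcl.closure_subset_iff.2 ?_ hY
    have : Submodule.span ℂ {Y | ∃ a b, Y = G.l a * G.Δ b} ≤ LinearMap.ker Ψ.toLinearMap := by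
      refine Submodule.span_le.2 ?_
      rintro _ ⟨a, b, rfl⟩
      change Ψ _ = 0
      rw [hΨ, DoubleCentralizer.mul_fst, mul_apply_eq_comp, ← DoubleCentralizer.central,
        cell, G.l_snd]
      exact h1 _ _
    exact this
  ext q
  have h3 := h2 _ (G.dens_l (G.t (G.u k k) q))
  rw [hΨ, DoubleCentralizer.mul_fst, mul_apply_eq_comp, cell, G.E_fst,
    DoubleCentralizer.coe_fst, ContinuousLinearMap.mul_apply', G.t_mul, G.t_mul, tens_t, u_idem,
    u_idem, hh.unit, one_mul] at h3
  rw [← DFunLike.congr_fun hg q]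
  exact h3

/-- If a state `h` of the corner at `(k, k)` is invariant under convolution by a state `ω`, then it
is invariant under convolution by every state that is dominated by a multiple of `ω`. The reason is
that for `b = (id ⊗ h)Δ(a)` the positive element `(Δ(b) - b ⊗ 1)* (Δ(b) - b ⊗ 1)` is annihilated
by `h ⊗ ω`. -/
theorem conv_eq_of_le {h ω ρ : A →L[ℂ] ℂ} (hh : IsCornerState G k k h)
    (hω : IsCornerState G k k ω) (hρ : IsCornerState G k k ρ)
    (h1 : G.conv k k k k k k ω h = h) (h2 : G.conv k k k k k k h ω = h) {c : ℂ} (hc : 0 < c)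
    (hle : ∀ a, 0 ≤ a → c * ρ a ≤ ω a) : G.conv k k k k k k ρ h = h := by
  set p := G.u k k
  have hpp : p * p = p := u_idem G k k
  rw [← sub_eq_zero]
  refine eq_zero_of_conv_eq_zero hh ?_ fun j d => ContinuousLinearMap.ext fun a => ?_
  · ext a
    rw [mulFun_apply, sub_apply, sub_apply, conv_corner, hh.supp]
  set b := G.sr h (G.D j k k k k k a) with hb
  have hb1 : G.u j k * b = b := by
    rw [hb, ← sr_D hh.mulFun_eq, ← mul_assoc, u_idem]
  have hb2 : b * p = b := by
    rw [hb, ← sr_D hh.mulFun_eq, mul_assoc, mul_assoc, hpp]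
  have hbstar : star b * G.u j k = star b := by
    have := congrArg star hb1
    rwa [star_mul, star_u] at this
  have hθ : ∀ θ : A →L[ℂ] ℂ, θ b = G.conv j k k k k k θ h a := fun θ => (conv_apply' a).symm
  -- `(id ⊗ ω)Δ(b) = b`
  have hbω : G.sr ω (G.D j k k k k k b) = b := by
    refine eq_of_forall_functional fun θ => ?_
    rw [← conv_apply', hθ, hθ, conv_assoc, h1]
  set Z := (G.Δ b).fst (G.cell k k k) - G.t b p with hZ
  set T := G.tens h ω
  have hT : IsPos T := G.tens_isPos hh.pos hω.pos
  have e1 : T (star ((G.Δ b).fst (G.cell k k k)) * (G.Δ b).fst (G.cell k k k)) =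
      h (star b * b) := by
    rw [star_mul_comul, star_cell]
    change G.conv k k k k k k h ω (star b * b) = _
    rw [h2]
  have hsplit : ∀ x, G.t (x * G.u j k) p * (G.Δ b).fst (G.cell k k k) =
      G.t x p * G.D j k k k k k b := fun x => by
    rw [D_apply, ← mul_assoc, cell_eq G j k k, G.t_mul, hpp]
  have e2 : T (star (G.t b p) * (G.Δ b).fst (G.cell k k k)) = h (star b * b) := by
    rw [G.star_t, star_u, ← hbstar, hsplit, tens_t_mul_D hh hω.mulFun_eq, conv_apply', hbω,
      mulLeftFun_apply, hbstar]
  have e3 : T (star ((G.Δ b).fst (G.cell k k k)) * G.t b p) = h (star b * b) := by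
    have := hT.apply_star (star (G.t b p) * (G.Δ b).fst (G.cell k k k))
    rw [e2, star_mul, star_star, ← hh.pos.apply_star, star_mul, star_star] at this
    exact this
  have e4 : T (star (G.t b p) * G.t b p) = h (star b * b) := by
    rw [G.star_t, star_u, G.t_mul, hpp, tens_t, hω.unit, mul_one]
  have e5 : T (star Z * Z) = 0 := by
    rw [hZ, star_sub, sub_mul, mul_sub, mul_sub, map_sub, map_sub, map_sub, e1, e2, e3, e4]
    ring
  have hT' : IsPos (G.tens h ρ) := G.tens_isPos hh.pos hρ.pos
  have e6 : G.tens h ρ (star Z * Z) = 0 := by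
    have h3 : 0 ≤ star Z * Z := star_mul_self_nonneg Z
    have h4 := hle _ (G.sl_nonneg h hh.pos _ h3)
    have h5 : c * G.tens h ρ (star Z * Z) ≤ 0 := h4.trans_eq e5
    have h6 := hT' _ h3
    have h7 : c * G.tens h ρ (star Z * Z) = 0 := le_antisymm h5 (mul_nonneg hc.le h6)
    exact (mul_eq_zero.1 h7).resolve_left hc.ne'
  have e7 := hT'.apply_mul_eq_zero e6 (G.t (d * G.u j k) p)
  rw [hZ, mul_sub, map_sub, hsplit, tens_t_mul_D hh hρ.mulFun_eq, G.t_mul, hpp, tens_t, hρ.unit,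
    mul_one, mul_assoc, hb1, hθ (G.conv j k k k k k _ ρ), conv_assoc] at e7
  exact (congrArg (_ - ·) (hθ (mulLeftFun h d)).symm).trans e7

/-! ### Existence of invariant states -/

/-- The corner states as a subset of the dual space with the weak-* topology. -/
def cornerStates (G : Frame I A B) (k : I) : Set (WeakDual ℂ A) :=
  {ω | IsCornerState G k k (WeakDual.toStrongDual ω)}

theorem isCompact_cornerStates (G : Frame I A B) (k : I) : IsCompact (cornerStates G k) := by
  refine (WeakDual.isCompact_closedBall (𝕜 := ℂ) (0 : StrongDual ℂ A) 1).of_isClosed_subset ?_ ?_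
  · have h1 : cornerStates G k = (⋂ a : {a : A // 0 ≤ a}, {ω : WeakDual ℂ A | 0 ≤ ω a.1}) ∩
        ({ω : WeakDual ℂ A | ω (G.u k k) = 1} ∩
        ⋂ a : A, {ω : WeakDual ℂ A | ω (G.u k k * (a * G.u k k)) = ω a}) := by
      ext ω
      simp only [Set.mem_inter_iff, Set.mem_iInter, Set.mem_ofPred_eq]
      exact ⟨fun h => ⟨fun a => h.pos a.1 a.2, h.unit, h.supp⟩,
        fun h => ⟨fun a ha => h.1 ⟨a, ha⟩, h.2.1, h.2.2⟩⟩
    rw [h1]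
    refine (isClosed_iInter fun a => ?_).inter (IsClosed.inter ?_ (isClosed_iInter fun a => ?_))
    · exact isClosed_le continuous_const (WeakDual.eval_continuous _)
    · exact isClosed_eq (WeakDual.eval_continuous _) continuous_const
    · exact isClosed_eq (WeakDual.eval_continuous _) (WeakDual.eval_continuous _)
  · intro ω hω
    rw [Set.mem_preimage, mem_closedBall_zero_iff]
    exact ContinuousLinearMap.opNorm_le_bound _ zero_le_one fun a => by
      rw [one_mul]
      exact IsCornerState.norm_apply_le hω a

/-- For every state `ω` of the corner, the Cesàro means of its convolution powers have a limit point
which is invariant under convolution by `ω`. -/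
theorem exists_invariant (hω : IsCornerState G k k ω) :
    ∃ h, IsCornerState G k k h ∧ G.conv k k k k k k ω h = h ∧ G.conv k k k k k k h ω = h := by
  let pw : ℕ → A →L[ℂ] ℂ := fun n => Nat.rec ω (fun _ χ => G.conv k k k k k k ω χ) n
  have hpw : ∀ n, pw (n + 1) = G.conv k k k k k k ω (pw n) := fun n => rfl
  have hpw' : ∀ n, pw (n + 1) = G.conv k k k k k k (pw n) ω := by
    intro n
    induction n with
    | zero => rfl
    | succ n ih =>
      rw [hpw (n + 1)]
      conv_lhs => rw [ih]
      rw [← conv_assoc, ← hpw]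
  have hst : ∀ n, IsCornerState G k k (pw n) := by
    intro n
    induction n with
    | zero => exact hω
    | succ n ih => exact hω.conv ih
  let mean : ℕ → A →L[ℂ] ℂ := fun n =>
    (((Finset.range (n + 1)).card : ℂ)⁻¹) • ∑ i ∈ Finset.range (n + 1), pw i
  have hmean : ∀ n, IsCornerState G k k (mean n) := fun n =>
    IsCornerState.average ⟨0, by simp⟩ fun i _ => hst i
  have hmapp : ∀ n a, mean n a = ((n + 1 : ℕ) : ℂ)⁻¹ * ∑ i ∈ Finset.range (n + 1), pw i a := by
    intro n a
    simp only [mean, smul_apply, sum_apply, smul_eq_mul, Finset.card_range]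
  -- convolution by `ω` shifts the means, so it moves them by a term of order `1 / n`
  have hshift : ∀ (a x : A), (∀ n, pw (n + 1) a = pw n x) →
      Tendsto (fun n => mean n x - mean n a) (hyperfilter ℕ : Filter ℕ) (𝓝 0) := by
    intro a x hx
    refine Tendsto.mono_left ?_ (Nat.hyperfilter_le_atTop)
    have h1 : ∀ n, mean n x - mean n a = ((n + 1 : ℕ) : ℂ)⁻¹ * (pw (n + 1) a - pw 0 a) := by
      intro n
      rw [hmapp, hmapp, ← mul_sub, ← Finset.sum_sub_distrib]
      simp only [← hx]
      rw [Finset.sum_range_sub (fun i => pw i a)]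
    refine squeeze_zero_norm (a := fun n : ℕ => ((n : ℝ) + 1)⁻¹ * (2 * ‖a‖)) (fun n => ?_) ?_
    · rw [h1, norm_mul, norm_inv, Complex.norm_natCast]
      push_cast
      gcongr
      refine (norm_sub_le _ _).trans ?_
      have h3 := (hst (n + 1)).norm_apply_le a
      have h4 := (hst 0).norm_apply_le a
      linarith
    · have := (tendsto_one_div_add_atTop_nhds_zero_nat (𝕜 := ℝ)).mul_const (2 * ‖a‖)
      simpa using this
  obtain ⟨h, hh, hlim⟩ := (isCompact_cornerStates G k).ultrafilter_le_nhds
    ((hyperfilter ℕ).map fun n => StrongDual.toWeakDual (mean n))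
    (by
      rw [le_principal_iff]
      exact Filter.mem_map.2 (Filter.Eventually.of_forall fun n => hmean n))
  have hev : ∀ a, Tendsto (fun n => mean n a) (hyperfilter ℕ : Filter ℕ) (𝓝 (h a)) := fun a =>
    ((WeakDual.eval_continuous a).tendsto h).comp hlim
  have hinv : ∀ a x, (∀ n, pw (n + 1) a = pw n x) → h x = h a := fun a x hx =>
    sub_eq_zero.1 (tendsto_nhds_unique ((hev x).sub (hev a)) (hshift a x hx))
  refine ⟨WeakDual.toStrongDual h, hh, ContinuousLinearMap.ext fun a => ?_,
    ContinuousLinearMap.ext fun a => ?_⟩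
  · exact hinv a _ fun n => by rw [hpw]; exact conv_apply a
  · rw [conv_apply']
    exact hinv a _ fun n => by rw [hpw']; exact conv_apply' a

/-- The Haar state of the corner at `(k, k)`. -/
theorem exists_haar (G : Frame I A B) (k : I) : ∃ h, IsCornerState G k k h ∧
    ∀ ω, IsCornerState G k k ω →
      G.conv k k k k k k ω h = h ∧ G.conv k k k k k k h ω = h := by
  classical
  let K : {ω // IsCornerState G k k ω} → Set (WeakDual ℂ A) := fun ω =>
    {h | (∀ a, h (G.sl ω.1 (G.D k k k k k k a)) = h a) ∧
      ∀ a, h (G.sr ω.1 (G.D k k k k k k a)) = h a}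
  have hK : ∀ ω, IsClosed (K ω) := by
    intro ω
    have h1 : K ω = (⋂ a, {h : WeakDual ℂ A | h (G.sl ω.1 (G.D k k k k k k a)) = h a}) ∩
        ⋂ a, {h : WeakDual ℂ A | h (G.sr ω.1 (G.D k k k k k k a)) = h a} := by
      ext h
      simp only [Set.mem_inter_iff, Set.mem_iInter, Set.mem_ofPred_eq, K]
    rw [h1]
    exact (isClosed_iInter fun a =>
        isClosed_eq (WeakDual.eval_continuous _) (WeakDual.eval_continuous _)).inter
      (isClosed_iInter fun a =>
        isClosed_eq (WeakDual.eval_continuous _) (WeakDual.eval_continuous _))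
  have hfin : ∀ F : Finset {ω // IsCornerState G k k ω},
      (cornerStates G k ∩ ⋂ ω ∈ F, K ω).Nonempty := by
    intro F
    obtain ⟨ω₀, hω₀⟩ := exists_isCornerState (G.unit_ne k)
    rcases F.eq_empty_or_nonempty with rfl | hF
    · exact ⟨StrongDual.toWeakDual ω₀, hω₀, by simp⟩
    -- a state that is invariant under the average is invariant under each state of the family
    have hav : IsCornerState G k k (((F.card : ℂ)⁻¹) • ∑ ω ∈ F, ω.1) :=
      IsCornerState.average (f := fun ω : {ω // IsCornerState G k k ω} => ω.1) hF
        fun ω _ => ω.2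
    obtain ⟨h, hh, h1, h2⟩ := exists_invariant hav
    have hpos : (0 : ℂ) < (F.card : ℂ)⁻¹ := by
      rw [← Complex.ofReal_natCast, ← Complex.ofReal_inv]
      exact_mod_cast inv_pos.2 (Nat.cast_pos.2 hF.card_pos)
    have hle : ∀ ω ∈ F, ∀ a, 0 ≤ a → (F.card : ℂ)⁻¹ * ω.1 a ≤
        (((F.card : ℂ)⁻¹) • ∑ ω ∈ F, ω.1) a := by
      intro ω hω a ha
      rw [smul_apply, sum_apply, smul_eq_mul]
      exact mul_le_mul_of_nonneg_left (Finset.single_le_sum (f := fun ω :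
        {ω // IsCornerState G k k ω} => ω.1 a) (fun χ _ => χ.2.pos a ha) hω) hpos.le
    refine ⟨StrongDual.toWeakDual h, hh, ?_⟩
    simp only [Set.mem_iInter]
    intro ω hω
    have e1 := conv_eq_of_le hh hav ω.2 h1 h2 hpos (hle ω hω)
    have e2 : G.conv k k k k k k h ω.1 = h := by
      rw [← op_conv]
      exact conv_eq_of_le (G := G.op) hh.op hav.op ω.2.op (by rw [op_conv, h2])
        (by rw [op_conv, h1]) hpos (hle ω hω)
    refine ⟨fun a => ?_, fun a => ?_⟩
    · exact (conv_apply (G := G) a).symm.trans (DFunLike.congr_fun e1 a)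
    · exact (conv_apply' (G := G) a).symm.trans (DFunLike.congr_fun e2 a)
  obtain ⟨h, hh, hinv⟩ := (isCompact_cornerStates G k).inter_iInter_nonempty K hK hfin
  rw [Set.mem_iInter] at hinv
  refine ⟨WeakDual.toStrongDual h, hh, fun ω hω => ⟨ContinuousLinearMap.ext fun a => ?_,
    ContinuousLinearMap.ext fun a => ?_⟩⟩
  · exact (hinv ⟨ω, hω⟩).1 a
  · rw [conv_apply']
    exact (hinv ⟨ω, hω⟩).2 a

end Frame

end Haar

/-! ### The Haar system of functionals -/

section HaarSystem

open Topology

namespace Frame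

variable {I A B : Type*} [NonUnitalCStarAlgebra A] [PartialOrder A]
    [StarOrderedRing A] [NonUnitalCStarAlgebra B] [PartialOrder B] [StarOrderedRing B]
    {G : Frame I A B} {j k m n j' k' m' n' : I} {ω χ ψ : A →L[ℂ] ℂ}

/-- The cells of `Δ(a)` which are seen by the partial sums in `slice_tendsto`. -/
theorem sl_cut_pSum [DecidableEq I] (ω : A →L[ℂ] ℂ) (s : Finset (I × I)) (k m k' m' : I) (a : A) :
    G.sl ω (cut G.Δ (G.t (G.pSum s) (G.u k m)) (G.t (G.pSum s) (G.u k' m')) a) =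
      ∑ p ∈ s, ∑ p' ∈ s, if p.2 = k ∧ p'.2 = k' then G.sl ω (G.D p.1 k m p'.1 k' m' a) else 0 := by
  rw [cut_apply, pSum, t_sum_left, t_sum_left, map_sum, Finset.sum_mul, map_sum]
  refine Finset.sum_congr rfl fun p _ => ?_
  rw [Finset.mul_sum, map_sum]
  refine Finset.sum_congr rfl fun p' _ => ?_
  split_ifs with h
  · obtain ⟨rfl, rfl⟩ := h
    rfl
  · rcases not_and_or.1 h with h | h
    · rw [← DoubleCentralizer.central, G.comul_snd_eq_zero h, zero_mul, map_zero]
    · rw [G.comul_ne _ _ _ _ _ h, mul_zero, map_zero]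

/-- Faithfulness of convolution: by the density of the slices of `Δ(PAP)`, a functional `θ` of a
corner is zero if its convolutions into the corners with diagonal indices all vanish. -/
theorem eq_zero_of_forall_conv {θ : A →L[ℂ] ℂ} (hθ : mulFun θ (G.u k m) (G.u k' m') = θ)
    (hz : ∀ ψ, G.conv m k m m' k' m' ψ θ = 0) : θ = 0 := by
  classical
  refine G.dens_diag_l θ fun ω b x hb hx => ?_
  have h1 := (θ.continuous.tendsto _).comp (G.slice_tendsto hx (G.u k m) (G.u k' m'))
  have h2 : θ (G.u k m * x * G.u k' m') = θ x := by
    rw [mul_assoc]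
    exact DFunLike.congr_fun hθ x
  rw [h2] at h1
  refine tendsto_nhds_unique h1 (tendsto_const_nhds.congr fun s => ?_)
  rw [Function.comp, sl_cut_pSum, map_sum]
  refine (Finset.sum_eq_zero fun p _ => ?_).symm
  rw [map_sum]
  refine Finset.sum_eq_zero fun p' _ => ?_
  split_ifs with h
  · by_cases hp : p.1 = m
    · by_cases hp' : p'.1 = m'
      · rw [hp, hp', ← conv_apply, hz]
        rfl
      · rw [← D_corner, (hb _ _ hp').2, mul_zero, map_zero, map_zero, map_zero]
    · rw [← D_corner, ← mul_assoc, (hb _ _ hp).1, zero_mul, map_zero, map_zero, map_zero]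
  · exact map_zero θ

theorem conv_eq_zero_of_unit (h : G.u j m = 0) : G.conv j k m j' k' m' ω χ = 0 := by
  ext a
  rw [← conv_corner, h, zero_mul, map_zero]
  rfl

theorem mulFun_conv :
    mulFun (G.conv j k m j' k' m' ω χ) (G.u j m) (G.u j' m') = G.conv j k m j' k' m' ω χ :=
  ContinuousLinearMap.ext fun a => conv_corner a

theorem conv_sub_left :
    G.conv j k m j' k' m' (ω - ψ) χ = G.conv j k m j' k' m' ω χ - G.conv j k m j' k' m' ψ χ := by
  ext a
  rw [sub_apply, conv_apply', conv_apply', conv_apply', sub_apply]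

theorem conv_smul_left (c : ℂ) :
    G.conv j k m j' k' m' (c • ω) χ = c • G.conv j k m j' k' m' ω χ := by
  ext a
  rw [smul_apply, conv_apply', conv_apply', smul_apply]

theorem conv_zero_right : G.conv j k m j' k' m' ω 0 = 0 := rfl

/-- If `u m k` vanished, then so would all convolutions of a state of the corner at `(k, m)` into
the corner at `(m, m)`. -/
theorem u_ne_zero_symm (h : G.u k m ≠ 0) : G.u m k ≠ 0 := by
  intro h0
  obtain ⟨θ, hθ⟩ := exists_isCornerState h
  have : θ = 0 := eq_zero_of_forall_conv hθ.mulFun_eq fun ψ => by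
    ext a
    rw [conv_apply, D_apply, cell_eq, h0, t_zero_left, zero_mul, map_zero, map_zero]
    rfl
  have h1 := hθ.unit
  rw [this] at h1
  exact zero_ne_one h1

/-- The convolution of two corner states is a state of the corner at `(j, m)`. -/
theorem u_ne_zero_trans (h : G.u j k ≠ 0) (h' : G.u k m ≠ 0) : G.u j m ≠ 0 := by
  obtain ⟨ω, hω⟩ := exists_isCornerState h
  obtain ⟨χ, hχ⟩ := exists_isCornerState h'
  exact (hω.conv hχ).ne_zero

/-- A Haar state of the diagonal corner at `(k, k)`: a state of that corner which is invariant
under convolution by all states of the corner. -/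
structure IsHaarState (G : Frame I A B) (k : I) (h : A →L[ℂ] ℂ) : Prop where
  state : IsCornerState G k k h
  left : ∀ ω, IsCornerState G k k ω → G.conv k k k k k k ω h = h
  right : ∀ ω, IsCornerState G k k ω → G.conv k k k k k k h ω = h

namespace IsHaarState

theorem op {h : A →L[ℂ] ℂ} (hh : IsHaarState G k h) : IsHaarState G.op k h where
  state := hh.state.op
  left ω hω := by
    rw [op_conv]
    exact hh.right ω hω.op
  right ω hω := by
    rw [op_conv]
    exact hh.left ω hω.op

/-- Invariance of the Haar state under arbitrary bounded functionals. -/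
theorem conv_left {h : A →L[ℂ] ℂ} (hh : IsHaarState G k h) (η : A →L[ℂ] ℂ) :
    G.conv k k k k k k η h = η (G.u k k) • h := by
  ext a
  set x := G.sr h (G.D k k k k k k a) - h a • G.u k k with hx
  have h1 : x = 0 := by
    refine eq_zero_of_isCornerState (G := G) (k := k) (m := k) ?_ fun ω hω => ?_
    · rw [hx, sub_mul, mul_sub, sr_D hh.state.mulFun_eq, smul_mul_assoc, mul_smul_comm, u_idem,
        u_idem]
    · rw [hx, map_sub, map_smul, hω.unit, ← conv_apply', hh.left ω hω, smul_eq_mul, mul_one,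
        sub_self]
  rw [conv_apply', sub_eq_zero.1 h1, map_smul, smul_apply, smul_eq_mul, smul_eq_mul, mul_comm]

/-- The convolution of a functional with the Haar state at `(m, m)` only depends on the value of the
functional at `u k m`, and it vanishes off the corners. -/
theorem conv_eq_zero {h : A →L[ℂ] ℂ} (hh : IsHaarState G m h) (hχ : k = k' → χ (G.u k m) = 0) :
    G.conv k m m k' m m χ h = 0 := by
  refine eq_zero_of_forall_conv mulFun_conv fun ψ => ?_
  rw [← conv_assoc, hh.conv_left]
  by_cases hk : k = k'
  · subst hk
    rw [conv_unit_self, hχ rfl, mul_zero]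
    exact zero_smul ℂ h
  · rw [conv_unit_ne hk]
    exact zero_smul ℂ h

/-- The case of equal indices; any corner state `χ` yields the same functional. -/
theorem conv_eq_smul {h : A →L[ℂ] ℂ} (hh : IsHaarState G m h) (hχ : IsCornerState G k m χ)
    (ω : A →L[ℂ] ℂ) : G.conv k m m k m m ω h = ω (G.u k m) • G.conv k m m k m m χ h := by
  rw [← sub_eq_zero, ← conv_smul_left, ← conv_sub_left]
  refine hh.conv_eq_zero fun _ => ?_
  rw [sub_apply, smul_apply, hχ.unit, smul_eq_mul, mul_one, sub_self]

end IsHaarState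

/-- A family of functionals `φ k m`, consisting of states of the corners at `(k, m)`, which
satisfies the left and the right invariance conditions, corner by corner. -/
structure IsHaarSystem (G : Frame I A B) (φ : I → I → A →L[ℂ] ℂ) : Prop where
  state : ∀ k m, G.u k m ≠ 0 → IsCornerState G k m (φ k m)
  eq_zero : ∀ k m, G.u k m = 0 → φ k m = 0
  left_self : ∀ k l m ω, G.conv k l m k l m ω (φ l m) = ω (G.u k l) • φ k m
  left_ne : ∀ k k' l m ω, k ≠ k' → G.conv k l m k' l m ω (φ l m) = 0
  right_self : ∀ k l m ω, G.conv k l m k l m (φ k l) ω = ω (G.u l m) • φ k m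
  right_ne : ∀ k l m m' ω, m ≠ m' → G.conv k l m k l m' (φ k l) ω = 0

theorem IsHaarSystem.op {φ : I → I → A →L[ℂ] ℂ} (h : IsHaarSystem G φ) :
    IsHaarSystem G.op fun k m => φ m k where
  state k m hkm := (h.state m k hkm).op
  eq_zero k m := h.eq_zero m k
  left_self k l m ω := by
    rw [op_conv]
    exact h.right_self m l k ω
  left_ne k k' l m ω hk := by
    rw [op_conv]
    exact h.right_ne m l k k' ω hk
  right_self k l m ω := by
    rw [op_conv]
    exact h.left_self m l k ω
  right_ne k l m m' ω hm := by
    rw [op_conv]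
    exact h.left_ne m m' l k ω hm

/-- One half of the conditions on a Haar system, from the Haar states of the diagonal corners. -/
theorem exists_left_system (G : Frame I A B) {h : I → A →L[ℂ] ℂ} (hh : ∀ k, IsHaarState G k (h k)) :
    ∃ φ : I → I → A →L[ℂ] ℂ, (∀ k m, G.u k m ≠ 0 → IsCornerState G k m (φ k m)) ∧
      (∀ k m, G.u k m = 0 → φ k m = 0) ∧
      (∀ k m ω, G.conv k m m k m m ω (h m) = ω (G.u k m) • φ k m) ∧
      (∀ k l m ω, G.conv k l m k l m ω (φ l m) = ω (G.u k l) • φ k m) ∧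
      ∀ k k' l m ω, k ≠ k' → G.conv k l m k' l m ω (φ l m) = 0 := by
  have hex : ∀ k m, ∃ χ : A →L[ℂ] ℂ, G.u k m ≠ 0 → IsCornerState G k m χ := fun k m => by
    by_cases h0 : G.u k m = 0
    · exact ⟨0, fun h => absurd h0 h⟩
    · obtain ⟨χ, hχ⟩ := exists_isCornerState h0
      exact ⟨χ, fun _ => hχ⟩
  choose χ hχ using hex
  let φ : I → I → A →L[ℂ] ℂ := fun k m => G.conv k m m k m m (χ k m) (h m)
  have hφ0 : ∀ k m, G.u k m = 0 → φ k m = 0 := fun k m h0 => conv_eq_zero_of_unit h0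
  have hA : ∀ k m ω, G.conv k m m k m m ω (h m) = ω (G.u k m) • φ k m := by
    intro k m ω
    by_cases h0 : G.u k m = 0
    · rw [h0, map_zero, conv_eq_zero_of_unit h0]
      exact (zero_smul ℂ (φ k m)).symm
    · exact (hh m).conv_eq_smul (hχ k m h0) ω
  refine ⟨φ, fun k m h0 => (hχ k m h0).conv (hh m).state, hφ0, hA, fun k l m ω => ?_,
    fun k k' l m ω hk => ?_⟩
  · by_cases h0 : G.u l m = 0
    · rw [hφ0 l m h0, conv_zero_right]
      by_cases hkl : G.u k l = 0
      · rw [hkl, map_zero]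
        exact (zero_smul ℂ (φ k m)).symm
      · have hkm : G.u k m = 0 := by
          by_contra hkm
          exact u_ne_zero_trans (u_ne_zero_symm hkl) hkm h0
        rw [hφ0 k m hkm]
        exact (smul_zero (A := A →L[ℂ] ℂ) (ω (G.u k l))).symm
    · change G.conv k l m k l m ω (G.conv l m m l m m (χ l m) (h m)) = _
      rw [← conv_assoc, hA, conv_unit_self, (hχ l m h0).unit, mul_one]
  · change G.conv k l m k' l m ω (G.conv l m m l m m (χ l m) (h m)) = _
    rw [← conv_assoc]
    exact (hh m).conv_eq_zero fun h => absurd h hk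

theorem exists_isHaarSystem (G : Frame I A B) : ∃ φ, IsHaarSystem G φ := by
  have hex : ∀ k, ∃ h, IsHaarState G k h := fun k => by
    obtain ⟨h, h1, h2⟩ := exists_haar G k
    exact ⟨h, h1, fun ω hω => (h2 ω hω).1, fun ω hω => (h2 ω hω).2⟩
  choose h hh using hex
  obtain ⟨φ, h1, h2, h3, h4, h5⟩ := exists_left_system G hh
  obtain ⟨φ', h1', h2', h3', h4', h5'⟩ := exists_left_system G.op fun k => (hh k).op
  -- both families are given by `h k * φ k m * h m`
  have heq : ∀ k m, φ' m k = φ k m := by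
    intro k m
    by_cases h0 : G.u k m = 0
    · rw [h2 k m h0, h2' m k h0]
    · have e1 := h3' m k (φ k m)
      have e2 := h3 k m (φ' m k)
      have u1 : φ k m (G.u k m) = 1 := (h1 k m h0).unit
      have u2 : φ' m k (G.u k m) = 1 := (h1' m k h0).unit
      have e3 := h3 k m (φ k m)
      rw [op_conv, show G.op.u m k = G.u k m from rfl, u1, one_smul] at e1
      rw [u2, one_smul] at e2
      rw [u1, one_smul] at e3
      rw [← e1, conv_assoc, e3] at e2
      rw [← e1, e2]
  refine ⟨φ, h1, h2, h4, h5, fun k l m ω => ?_, fun k l m m' ω hm => ?_⟩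
  · have := h4' m l k ω
    rw [op_conv, heq, heq] at this
    exact this
  · have := h5' m m' l k ω hm
    rw [op_conv, heq] at this
    exact this

namespace IsHaarSystem

variable {φ : I → I → A →L[ℂ] ℂ}

theorem supp (h : IsHaarSystem G φ) (k m : I) (a : A) :
    φ k m (G.u k m * (a * G.u k m)) = φ k m a := by
  by_cases h0 : G.u k m = 0
  · rw [h.eq_zero k m h0]
    rfl
  · exact (h.state k m h0).supp a

theorem isPos (h : IsHaarSystem G φ) (k m : I) : IsPos (φ k m) := by
  by_cases h0 : G.u k m = 0
  · rw [h.eq_zero k m h0]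
    exact fun a _ => le_rfl
  · exact (h.state k m h0).pos

/-- Left invariance of a Haar system, for the slices of the comultiplication. -/
theorem hasSum_slice (h : IsHaarSystem G φ) {a x : A}
    (hx : strictExt (fun z : B => ((G.sl ω z : A) : 𝓜(ℂ, A))) (G.Δ a) = x) (l m : I) :
    HasSum (fun k => ω (G.u k l) * φ k m a) (φ l m x) := by
  classical
  have h1 := ((φ l m).continuous.tendsto _).comp (G.slice_tendsto hx (G.u l m) (G.u l m))
  rw [mul_assoc, h.supp] at h1
  let f : I × I → ℂ := fun p => if p.2 = l then ω (G.u p.1 l) * φ p.1 m a else 0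
  have h2 : HasSum f (φ l m x) := by
    refine h1.congr fun s => ?_
    rw [Function.comp, sl_cut_pSum, map_sum]
    refine Finset.sum_congr rfl fun p hp => ?_
    rw [map_sum, Finset.sum_eq_single p]
    · by_cases hpl : p.2 = l
      · rw [if_pos ⟨hpl, hpl⟩, ← conv_apply, h.left_self]
        simp only [f, if_pos hpl, smul_apply, smul_eq_mul]
      · rw [if_neg fun hc => hpl hc.1, map_zero]
        simp only [f, if_neg hpl]
    · intro p' _ hp'
      split_ifs with hc
      · have hne : p.1 ≠ p'.1 := fun h3 => hp' (Prod.ext h3.symm (hc.2.trans hc.1.symm))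
        rw [← conv_apply, h.left_ne _ _ _ _ _ hne]
        rfl
      · exact map_zero _
    · exact fun hc => absurd hp hc
  have hinj : Function.Injective fun k : I => (k, l) := fun k k' hk => congrArg Prod.fst hk
  have h3 := (hinj.hasSum_iff (f := f) (a := φ l m x) fun p hp => ?_).2 h2
  · simpa only [Function.comp_def, f, if_true] using h3
  · have : p.2 ≠ l := fun hc => hp ⟨p.1, by rw [← hc]⟩
    simp only [f, if_neg this]

/-- The slice of an element of the corner at `(k, m)` by the Haar state at `(k, k)` is a multiple of
the projection of the corner. -/
theorem slice_corner (h : IsHaarSystem G φ) {a x : A} (ha : G.u k m * (a * G.u k m) = a)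
    (hx : strictExt (fun z : B => ((G.sl (φ k k) z : A) : 𝓜(ℂ, A))) (G.Δ a) = x) :
    x = φ k m a • G.u k m := by
  classical
  have hs := h.state k k (G.unit_ne k)
  have hD : ∀ i r j i' r' j', (i, r, j) ≠ (k, k, m) ∨ (i', r', j') ≠ (k, k, m) →
      G.sl (φ k k) (G.D i r j i' r' j' a) = 0 := by
    intro i r j i' r' j' hne
    by_cases hl : (i, r) = (k, k) ∧ (i', r') = (k, k)
    · obtain ⟨hl1, hl2⟩ := hl
      rw [Prod.mk.injEq] at hl1 hl2
      obtain ⟨rfl, rfl⟩ := hl1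
      obtain ⟨rfl, rfl⟩ := hl2
      rw [← D_corner, ← ha]
      rcases hne with hne | hne
      · rw [← mul_assoc, ← mul_assoc, G.orth _ _ _ _ (by rintro ⟨⟩; exact hne rfl), zero_mul,
          zero_mul, map_zero, map_zero]
      · rw [mul_assoc (G.u _ m), mul_assoc a,
          G.orth _ _ _ _ (by rintro ⟨⟩; exact hne rfl), mul_zero, mul_zero, mul_zero, map_zero,
          map_zero]
    · have hz : mulFun (φ k k) (G.u i r) (G.u i' r') = 0 := by
        ext y
        rw [mulFun_apply]
        rcases not_and_or.1 hl with hl | hl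
        · rw [← hs.mul_left, ← mul_assoc, G.orth _ _ _ _ (Ne.symm hl), zero_mul, map_zero]
          rfl
        · rw [← hs.mul_right, mul_assoc, mul_assoc, G.orth _ _ _ _ hl, mul_zero, mul_zero,
            map_zero]
          rfl
      have hzero : ∀ z, G.sl (0 : A →L[ℂ] ℂ) z = 0 := fun z => by
        rw [← sub_self (0 : A →L[ℂ] ℂ), sl_sub, sub_self]
      rw [← cell_mul_D, cell, cell, sl_sandwich, hz, hzero, zero_mul, mul_zero]
  have hself : G.sl (φ k k) (G.D k k m k k m a) = φ k m a • G.u k m := by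
    refine eq_of_forall_functional fun θ => ?_
    rw [← conv_apply, h.right_self, smul_apply, map_smul, smul_eq_mul, smul_eq_mul, mul_comm]
  refine G.eq_of_corners fun r j r' j' => ?_
  refine tendsto_nhds_unique (G.slice_tendsto hx (G.u r j) (G.u r' j')) ?_
  by_cases hc : (r, j) = (k, m) ∧ (r', j') = (k, m)
  · obtain ⟨hc1, hc2⟩ := hc
    rw [Prod.mk.injEq] at hc1 hc2
    obtain ⟨rfl, rfl⟩ := hc1
    obtain ⟨rfl, rfl⟩ := hc2
    rw [mul_smul_comm, smul_mul_assoc, u_idem, u_idem]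
    refine tendsto_const_nhds.congr' ?_
    filter_upwards [eventually_ge_atTop {(r', r')}] with s hs'
    have hmem : (r', r') ∈ s := hs' (Finset.mem_singleton_self _)
    rw [sl_cut_pSum, Finset.sum_eq_single_of_mem (r', r') hmem,
      Finset.sum_eq_single_of_mem (r', r') hmem, if_pos ⟨rfl, rfl⟩, hself]
    · intro p' _ hp'
      split_ifs with hcc
      · refine hD _ _ _ _ _ _ (Or.inr fun he => hp' ?_)
        rw [Prod.mk.injEq] at he
        exact Prod.ext he.1 hcc.2
      · rfl
    · intro p _ hp
      refine Finset.sum_eq_zero fun p' _ => ?_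
      split_ifs with hcc
      · refine hD _ _ _ _ _ _ (Or.inl fun he => hp ?_)
        rw [Prod.mk.injEq] at he
        exact Prod.ext he.1 hcc.1
      · rfl
  · have h0 : G.u r j * φ k m a • G.u k m * G.u r' j' = 0 := by
      rw [mul_smul_comm, smul_mul_assoc]
      rcases not_and_or.1 hc with hc | hc
      · rw [G.orth _ _ _ _ hc, zero_mul, smul_zero]
      · rw [mul_assoc, G.orth _ _ _ _ (Ne.symm hc), mul_zero, smul_zero]
    rw [h0]
    refine tendsto_const_nhds.congr fun s => ?_
    rw [sl_cut_pSum]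
    refine (Finset.sum_eq_zero fun p _ => Finset.sum_eq_zero fun p' _ => ?_).symm
    split_ifs with hcc
    · refine hD _ _ _ _ _ _ ?_
      rcases not_and_or.1 hc with hc | hc
      · exact Or.inl fun he => hc (congrArg Prod.snd he)
      · exact Or.inr fun he => hc (congrArg Prod.snd he)
    · rfl

end IsHaarSystem

end Frame

end HaarSystem

/-! ### Strict sums of the projections -/

section StrictSums

open Topology

variable {I : Type v} {A : Type u} [NonUnitalCStarAlgebra A]

theorem HasStrictSum.tendsto_mul {ι : Type*} {w : ι → A} {m : 𝓜(ℂ, A)}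
    (h : HasStrictSum (fun i => (w i : 𝓜(ℂ, A))) m) (a : A) :
    Tendsto (fun s : Finset ι => (∑ i ∈ s, w i) * a) atTop (𝓝 (m.fst a)) :=
  (h a).1.congr fun s => by simp only [coe_mult_sum]; rfl

theorem HasStrictSum.mul_tendsto {ι : Type*} {w : ι → A} {m : 𝓜(ℂ, A)}
    (h : HasStrictSum (fun i => (w i : 𝓜(ℂ, A))) m) (a : A) :
    Tendsto (fun s : Finset ι => a * ∑ i ∈ s, w i) atTop (𝓝 (m.snd a)) :=
  (h a).2.congr fun s => by simp only [coe_mult_sum]; rfl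

theorem HasStrictSum.star_eq {ι : Type*} {w : ι → A} {m : 𝓜(ℂ, A)}
    (hw : ∀ i, IsStarProjection (w i)) (h : HasStrictSum (fun i => (w i : 𝓜(ℂ, A))) m) :
    star m = m := by
  refine multiplier_ext fun a => tendsto_nhds_unique ?_ (h.tendsto_mul a)
  rw [DoubleCentralizer.star_fst]
  refine (h.mul_tendsto (star a)).star.congr fun s => ?_
  rw [star_mul, star_star, star_sum]
  simp only [(hw _).isSelfAdjoint.star_eq]

/-- A functional vanishes if it vanishes on a set of elements whose span, formed in the multiplier
algebra, is dense in the algebra. -/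
theorem functional_eq_zero_of_range_eq {S : Set 𝓜(ℂ, A)}
    (hS : Set.range (fun a : A => (a : 𝓜(ℂ, A))) = closure (Submodule.span ℂ S : Set 𝓜(ℂ, A)))
    (θ : A →L[ℂ] ℂ) (h : ∀ x : A, (x : 𝓜(ℂ, A)) ∈ S → θ x = 0) : θ = 0 := by
  let ι : A →ₗ[ℂ] 𝓜(ℂ, A) := (DoubleCentralizer.coeHom (𝕜 := ℂ) (A := A) : A →ₗ[ℂ] 𝓜(ℂ, A))
  have hι : Isometry ι := AddMonoidHomClass.isometry_of_norm ι norm_coe_mult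
  have h1 : Submodule.span ℂ S ≤ (LinearMap.ker θ.toLinearMap).map ι := by
    refine Submodule.span_le.2 fun Y hY => ?_
    have h2 : Y ∈ Set.range (fun a : A => (a : 𝓜(ℂ, A))) := by
      rw [hS]
      exact subset_closure (Submodule.subset_span hY)
    obtain ⟨x, rfl⟩ := h2
    exact ⟨x, h x hY, rfl⟩
  have hcl : IsClosed (((LinearMap.ker θ.toLinearMap).map ι : Submodule ℂ 𝓜(ℂ, A)) :
      Set 𝓜(ℂ, A)) := by
    rw [Submodule.map_coe]
    exact hι.isClosedEmbedding.isClosedMap _ (isClosed_singleton.preimage θ.continuous)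
  ext a
  have h3 : (a : 𝓜(ℂ, A)) ∈ closure (Submodule.span ℂ S : Set 𝓜(ℂ, A)) := by
    rw [← hS]
    exact ⟨a, rfl⟩
  obtain ⟨x, hx, hxa⟩ := hcl.closure_subset_iff.2 h1 h3
  rw [← coe_mult_injective hxa]
  exact hx

variable [PartialOrder A] [StarOrderedRing A]

namespace PartialCompactQuantumSemigroup

variable (G : PartialCompactQuantumSemigroup I A)

/-- The multiplier `m` is the projection `∑ 1_{kl}` over the pairs `(k, l)` in `S`. -/
structure IsUnitSum (S : Set (I × I)) (m : 𝓜(ℂ, A)) : Prop where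
  star_eq : star m = m
  fst_mem : ∀ q ∈ S, m.fst (G.unit q.1 q.2) = G.unit q.1 q.2
  fst_notMem : ∀ q, q ∉ S → m.fst (G.unit q.1 q.2) = 0

variable {G}

namespace IsUnitSum

variable {S : Set (I × I)} {m : 𝓜(ℂ, A)}

theorem snd_eq (h : G.IsUnitSum S m) (k l : I) :
    m.snd (G.unit k l) = star (m.fst (G.unit k l)) := by
  rw [star_multiplier_fst, h.star_eq, star_unit]

theorem snd_mem (h : G.IsUnitSum S m) {k l : I} (hq : (k, l) ∈ S) :
    m.snd (G.unit k l) = G.unit k l := by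
  rw [h.snd_eq, h.fst_mem _ hq, star_unit]

theorem snd_notMem (h : G.IsUnitSum S m) {k l : I} (hq : (k, l) ∉ S) :
    m.snd (G.unit k l) = 0 := by
  rw [h.snd_eq, h.fst_notMem _ hq, star_zero]

theorem unit_mul_compress (h : G.IsUnitSum S m) (k l : I) (a : A) :
    G.unit k l * compress m a = m.snd (G.unit k l) * m.snd a := by
  rw [compress, h.star_eq, ← m.central]

theorem compress_mul_unit (h : G.IsUnitSum S m) (k l : I) (a : A) :
    compress m a * G.unit k l = m.fst (a * m.fst (G.unit k l)) := by
  rw [compress, h.star_eq, ← multiplier_fst_mul, m.central]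

/-- The compression of an element by the sum of the projections only has the corners over `S`. -/
theorem unit_mul_compress_mul_unit (h : G.IsUnitSum S m) (k l : I) (a : A) :
    G.unit k l * (compress m a * G.unit k l) = m.snd (G.unit k l) * (a * m.fst (G.unit k l)) := by
  rw [h.compress_mul_unit, m.central]

theorem compress_of_mem (h : G.IsUnitSum S m) {k l : I} (hq : (k, l) ∈ S) {a : A}
    (ha : G.unit k l * (a * G.unit k l) = a) : compress m a = a := by
  rw [← ha, compress, h.star_eq, multiplier_snd_mul, multiplier_snd_mul, h.snd_mem hq,
    multiplier_fst_mul, h.fst_mem _ hq]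

end IsUnitSum

theorem isUnitSum_coe (k l : I) : G.IsUnitSum {(k, l)} (G.unit k l : 𝓜(ℂ, A)) where
  star_eq := by rw [← coe_mult_star, star_unit]
  fst_mem := by
    rintro _ rfl
    exact G.unit_idem k l
  fst_notMem q hq := G.unit_mul_unit k l q.1 q.2 (Ne.symm hq)

/-- Every subfamily of the projections `1_{kl}` is strictly summable. -/
theorem isUnitSum_strictSum {ι : Type*} {f : ι → I × I} (hf : Function.Injective f) :
    G.IsUnitSum (Set.range f) (strictSum fun i => (G.unit (f i).1 (f i).2 : 𝓜(ℂ, A))) := by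
  have hmem : ∀ i a, ∀ᶠ s : Finset ι in atTop,
      (∑ i ∈ s, G.unit (f i).1 (f i).2) * (G.unit (f i).1 (f i).2 * a) =
        G.unit (f i).1 (f i).2 * a := by
    intro i a
    filter_upwards [eventually_ge_atTop {i}] with s hs
    rw [← mul_assoc, Finset.sum_mul, Finset.sum_eq_single i, unit_idem]
    · intro j _ hj
      exact G.unit_mul_unit _ _ _ _ fun h => hj (hf h)
    · intro h; exact absurd (hs (Finset.mem_singleton_self _)) h
  have hnot : ∀ k l, (k, l) ∉ Set.range f → ∀ a (s : Finset ι),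
      (∑ i ∈ s, G.unit (f i).1 (f i).2) * (G.unit k l * a) = 0 := by
    intro k l hq a s
    rw [← mul_assoc, Finset.sum_mul]
    rw [Finset.sum_eq_zero fun i _ => G.unit_mul_unit _ _ _ _ fun h => hq ⟨i, h⟩, zero_mul]
  have hproj : ∀ i, IsStarProjection (G.unit (f i).1 (f i).2) := fun i =>
    G.isStarProjection_unit _ _
  obtain ⟨m, hm⟩ := exists_hasStrictSum (w := fun i => G.unit (f i).1 (f i).2) hproj
    (fun i j hij => G.unit_mul_unit _ _ _ _ fun h => hij (hf h)) G.dense_span_unit_mul (by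
      rintro _ ⟨k, l, a, rfl⟩
      by_cases hq : (k, l) ∈ Set.range f
      · obtain ⟨i, hi⟩ := hq
        have := hmem i a
        rw [hi] at this
        exact ⟨_, this⟩
      · exact ⟨0, Eventually.of_forall (hnot k l hq a)⟩)
  rw [hm.strictSum_eq]
  refine ⟨hm.star_eq hproj, ?_, fun q hq => ?_⟩
  · rintro _ ⟨i, rfl⟩
    refine tendsto_nhds_unique (hm.tendsto_mul _) (tendsto_const_nhds.congr' ?_)
    have := hmem i (G.unit (f i).1 (f i).2)
    rw [unit_idem] at this
    exact this.mono fun s hs => hs.symm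
  · refine tendsto_nhds_unique (hm.tendsto_mul _) (tendsto_const_nhds.congr fun s => ?_)
    have := hnot q.1 q.2 hq (G.unit q.1 q.2) s
    rw [unit_idem] at this
    exact this.symm

variable (G)

theorem isUnitSum_source (k : I) : G.IsUnitSum (Set.range fun m => (k, m)) (G.source k) :=
  isUnitSum_strictSum (f := fun m => (k, m)) fun _ _ h => congrArg Prod.snd h

theorem isUnitSum_target (m : I) : G.IsUnitSum (Set.range fun k => (k, m)) (G.target m) :=
  isUnitSum_strictSum (f := fun k => (k, m)) fun _ _ h => congrArg Prod.fst h

theorem isUnitSum_diag : G.IsUnitSum (Set.range fun k => (k, k)) G.diag :=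
  isUnitSum_strictSum (f := fun k => (k, k)) fun _ _ h => congrArg Prod.fst h

/-- The projections `1_{km} ⊗ 1_{ml}` are strictly summable, and their sum `Δ(1)` fixes each
of them. -/
theorem comulOne_fst (j k m : I) : G.comulOne.fst (MinTensor.tmul (G.unit j k) (G.unit k m)) =
    MinTensor.tmul (G.unit j k) (G.unit k m) := by
  classical
  let w : I × I × I → MinTensor A A := fun p =>
    MinTensor.tmul (G.unit p.1 p.2.2) (G.unit p.2.2 p.2.1)
  have hwo : ∀ p q r, p ≠ q ∨ q.2.2 ≠ r →
      w p * MinTensor.tmul (G.unit q.1 q.2.2) (G.unit r q.2.1) = 0 := by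
    intro p q r hpq
    rw [MinTensor.tmul_mul]
    by_cases h1 : (p.1, p.2.2) = (q.1, q.2.2)
    · by_cases h2 : (p.2.2, p.2.1) = (r, q.2.1)
      · rw [Prod.mk.injEq] at h1 h2
        rcases hpq with hpq | hpq
        · exact absurd (Prod.ext h1.1 (Prod.ext h2.2 h1.2)) hpq
        · exact absurd (h1.2.symm.trans h2.1) hpq
      · rw [G.unit_mul_unit _ _ _ _ h2, tmul_zero_right]
    · rw [G.unit_mul_unit _ _ _ _ h1, tmul_zero_left]
  have hwproj : ∀ p, IsStarProjection (w p) := fun p =>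
    ⟨G.cell_idem _ _ _, G.star_cell _ _ _⟩
  have hev : ∀ j k m, ∀ᶠ s : Finset (I × I × I) in atTop,
      (∑ p ∈ s, w p) * MinTensor.tmul (G.unit j k) (G.unit k m) =
        MinTensor.tmul (G.unit j k) (G.unit k m) := by
    intro j k m
    filter_upwards [eventually_ge_atTop {(j, m, k)}] with s hs
    rw [Finset.sum_mul, Finset.sum_eq_single (j, m, k)]
    · exact G.cell_idem j k m
    · intro p _ hp
      exact hwo p (j, m, k) k (Or.inl hp)
    · intro h; exact absurd (hs (Finset.mem_singleton_self _)) h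
  obtain ⟨M, hM⟩ := exists_hasStrictSum (w := w) hwproj
    (fun p q hpq => hwo p q q.2.2 (Or.inl hpq))
    (dense_span_tmul_of_dense G.dense_span_unit_mul G.dense_span_unit_mul) (by
      rintro _ ⟨_, ⟨j, k, a, rfl⟩, _, ⟨k', m, b, rfl⟩, rfl⟩
      rw [← MinTensor.tmul_mul]
      by_cases hk : k = k'
      · subst hk
        refine ⟨MinTensor.tmul (G.unit j k) (G.unit k m) * MinTensor.tmul a b,
          (hev j k m).mono fun s hs => ?_⟩
        rw [← mul_assoc, hs]
      · refine ⟨0, Eventually.of_forall fun s => ?_⟩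
        rw [← mul_assoc, Finset.sum_mul,
          Finset.sum_eq_zero fun p _ => hwo p (j, m, k) k' (Or.inr hk), zero_mul])
  rw [comulOne, hM.strictSum_eq]
  exact tendsto_nhds_unique (hM.tendsto_mul _)
    (tendsto_const_nhds.congr' ((hev j k m).mono fun s hs => hs.symm))

end PartialCompactQuantumSemigroup

/-! ### The frame of a partial compact quantum group -/

open PartialCompactQuantumSemigroup in
/-- The leg-symmetric form of the data of a partial compact quantum group. -/
noncomputable def PartialCompactQuantumGroup.frame (G : PartialCompactQuantumGroup I A) :
    Frame I A (MinTensor A A) where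
  u := G.unit
  proj := G.isStarProjection_unit
  orth := G.unit_mul_unit
  dense_u := G.dense_span_unit_mul
  unit_ne := G.unit_self_ne_zero
  t := MinTensor.tmul
  dense_t := by
    have h := dense_span_tmul (A := A) (B := A)
    have h' : {z : MinTensor A A | ∃ a b, z = MinTensor.tmul a b} =
        Set.range fun i : A × A => MinTensor.tmul i.1 i.2 :=
      Set.ext fun z => ⟨fun ⟨a, b, hz⟩ => ⟨(a, b), hz.symm⟩, fun ⟨i, hz⟩ => ⟨i.1, i.2, hz.symm⟩⟩
    rwa [h']
  t_mul _ _ _ _ := MinTensor.tmul_mul _ _ _ _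
  star_t := MinTensor.star_tmul
  norm_t_le := MinTensor.norm_tmul_le
  t_add_left := MinTensor.tmul_add_left
  t_add_right := MinTensor.tmul_add_right
  t_smul_left := MinTensor.tmul_smul_left
  t_smul_right c a b := MinTensor.tmul_smul_right c a b
  sl := sliceLeft
  sr := sliceRight
  sl_t := sliceLeft_tmul
  sr_t := sliceRight_tmul
  norm_sl_le := norm_sliceLeft_le
  norm_sr_le := norm_sliceRight_le
  sl_nonneg _ hω _ hz := sliceLeft_nonneg hω hz
  sr_nonneg _ hω _ hz := sliceRight_nonneg hω hz
  l a := multTensor (a : 𝓜(ℂ, A)) (1 : 𝓜(ℂ, A))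
  r a := multTensor (1 : 𝓜(ℂ, A)) (a : 𝓜(ℂ, A))
  l_fst c a b := multTensor_fst_tmul _ _ _ _
  l_snd c a b := multTensor_snd_tmul _ _ _ _
  r_fst c a b := multTensor_fst_tmul _ _ _ _
  r_snd c a b := multTensor_snd_tmul _ _ _ _
  Δ := G.comul
  comul_self := G.comul_fst_cell
  comul_ne j k k' m a hk := G.comul_fst_eq_zero hk j m a
  assoc j k m n j' k' m' n' ω χ ψ := G.conv_assoc j k m n j' k' m' n' ω χ ψ
  mem_l c a := by
    have h : multTensor (c : 𝓜(ℂ, A)) (1 : 𝓜(ℂ, A)) * G.comul a ∈ closure (Submodule.span ℂ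
        {Y | ∃ a b : A, Y = multTensor (a : 𝓜(ℂ, A)) (1 : 𝓜(ℂ, A)) * G.comul b} :
        Set 𝓜(ℂ, MinTensor A A)) := subset_closure (Submodule.subset_span ⟨c, a, rfl⟩)
    rw [← G.density_left] at h
    obtain ⟨z, hz⟩ := h
    exact ⟨_, hz.trans (coe_mul_multiplier _ _)⟩
  mem_r c a := by
    have h : multTensor (1 : 𝓜(ℂ, A)) (c : 𝓜(ℂ, A)) * G.comul a ∈ closure (Submodule.span ℂ
        {Y | ∃ a b : A, Y = multTensor (1 : 𝓜(ℂ, A)) (a : 𝓜(ℂ, A)) * G.comul b} :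
        Set 𝓜(ℂ, MinTensor A A)) := subset_closure (Submodule.subset_span ⟨c, a, rfl⟩)
    rw [← G.density_right] at h
    obtain ⟨z, hz⟩ := h
    exact ⟨_, hz.trans (coe_mul_multiplier _ _)⟩
  E := G.comulOne
  E_fst := G.comulOne_fst
  dens_l z := by
    rw [← G.density_left]
    exact ⟨z, rfl⟩
  dens_r z := by
    rw [← G.density_right]
    exact ⟨z, rfl⟩
  dens_diag_l θ h := by
    refine functional_eq_zero_of_range_eq G.density_diag_left θ fun x ⟨ω, b, hx⟩ =>
      h ω (compress G.diag b) x (fun i j hij => ?_) hx.symm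
    have hn : (i, j) ∉ Set.range fun k : I => (k, k) := by
      rintro ⟨k, hk⟩
      rw [Prod.mk.injEq] at hk
      exact hij (hk.1.symm.trans hk.2)
    rw [G.isUnitSum_diag.unit_mul_compress, G.isUnitSum_diag.compress_mul_unit,
      G.isUnitSum_diag.snd_notMem hn, G.isUnitSum_diag.fst_notMem (i, j) hn, zero_mul, mul_zero,
      map_zero]
    exact ⟨rfl, rfl⟩
  dens_diag_r θ h := by
    refine functional_eq_zero_of_range_eq G.density_diag_right θ fun x ⟨ω, b, hx⟩ =>
      h ω (compress G.diag b) x (fun i j hij => ?_) hx.symm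
    have hn : (i, j) ∉ Set.range fun k : I => (k, k) := by
      rintro ⟨k, hk⟩
      rw [Prod.mk.injEq] at hk
      exact hij (hk.1.symm.trans hk.2)
    rw [G.isUnitSum_diag.unit_mul_compress, G.isUnitSum_diag.compress_mul_unit,
      G.isUnitSum_diag.snd_notMem hn, G.isUnitSum_diag.fst_notMem (i, j) hn, zero_mul, mul_zero,
      map_zero]
    exact ⟨rfl, rfl⟩

end StrictSums

/-! ### The weight of a Haar system -/

section HaarWeight

open Topology

namespace Frame

variable {I A B : Type*} [NonUnitalCStarAlgebra A] [PartialOrder A]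
    [StarOrderedRing A] [NonUnitalCStarAlgebra B] [PartialOrder B] [StarOrderedRing B]
    {G : Frame I A B} {φ : I → I → A →L[ℂ] ℂ}

/-- The strictly continuous extension of a bounded functional, as a sum over the corners. -/
theorem hasSum_evalMult (G : Frame I A B) (ω : A →L[ℂ] ℂ) (m : 𝓜(ℂ, A)) :
    HasSum (fun p : I × I => ω (m.fst (G.u p.1 p.2))) (evalMult ω m) := by
  classical
  have hinc := CStarAlgebra.increasingApproximateUnit A
  have hω := tendsto_norm_sub_mulRightFun G.isStarProjection_pSum G.tendsto_pSum_mul ω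
  have hbd : ∀ χ : A →L[ℂ] ℂ, ∀ᶠ e in CStarAlgebra.approximateUnit A,
      ‖χ (m.fst e)‖ ≤ ‖χ‖ * ‖m‖ :=
    fun χ => hinc.eventually_norm.mono fun e he => (χ.le_opNorm _).trans
      (mul_le_mul_of_nonneg_left ((norm_multiplier_fst_le _ _).trans
        (mul_le_of_le_one_right (norm_nonneg _) he)) (norm_nonneg _))
  have h1 : ∀ s, Tendsto (fun e => mulRightFun ω (G.pSum s) (m.fst e))
      (CStarAlgebra.approximateUnit A) (𝓝 (ω (m.fst (G.pSum s)))) := by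
    intro s
    refine ((ω.continuous.tendsto _).comp ((m.fst.continuous.tendsto _).comp
      (hinc.tendsto_mul_right (G.pSum s)))).congr fun e => ?_
    rw [mulRightFun_apply, ← multiplier_fst_mul]
    rfl
  have hcau : CauchySeq fun s => ω (m.fst (G.pSum s)) := by
    have h2 : ∀ s s', ‖ω (m.fst (G.pSum s)) - ω (m.fst (G.pSum s'))‖ ≤
        ‖mulRightFun ω (G.pSum s) - mulRightFun ω (G.pSum s')‖ * ‖m‖ := fun s s' =>
      le_of_tendsto ((h1 s).sub (h1 s')).norm (hbd (mulRightFun ω (G.pSum s) -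
        mulRightFun ω (G.pSum s')))
    have hlim : Tendsto (fun s => mulRightFun ω (G.pSum s)) atTop (𝓝 ω) := by
      rw [tendsto_iff_norm_sub_tendsto_zero]
      exact hω.congr fun s => norm_sub_rev _ _
    rw [Metric.cauchySeq_iff]
    intro ε hε
    obtain ⟨N, hN⟩ := Metric.cauchySeq_iff.1 hlim.cauchySeq (ε / (‖m‖ + 1)) (by positivity)
    refine ⟨N, fun s hs s' hs' => ?_⟩
    have h3 := hN s hs s' hs'
    rw [dist_eq_norm] at h3 ⊢
    calc _ ≤ _ := h2 s s'
      _ ≤ ‖mulRightFun ω (G.pSum s) - mulRightFun ω (G.pSum s')‖ * (‖m‖ + 1) := by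
        gcongr; linarith
      _ < ε / (‖m‖ + 1) * (‖m‖ + 1) := by gcongr
      _ = ε := by field_simp
  obtain ⟨L, hL⟩ := cauchySeq_tendsto_of_complete hcau
  have hδ : Tendsto (fun s => ‖ω - mulRightFun ω (G.pSum s)‖ * ‖m‖) atTop (𝓝 0) := by
    simpa using hω.mul_const ‖m‖
  have hev : evalMult ω m = L := Tendsto.limUnder_eq
    (tendsto_of_uniform_approx h1 hL hδ fun s => hbd (ω - mulRightFun ω (G.pSum s)))
  rw [hev]
  refine hL.congr fun s => ?_
  rw [pSum, map_sum, map_sum]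

namespace IsHaarSystem

theorem apply_eq_zero_of_mul (h : IsHaarSystem G φ) {k m : I} {a : A}
    (ha : G.u k m * (a * G.u k m) = 0) : φ k m a = 0 := by
  rw [← h.supp, ha, map_zero]

theorem apply_unit_ne (h : IsHaarSystem G φ) {k m k' m' : I} (hne : (k, m) ≠ (k', m')) :
    φ k m (G.u k' m') = 0 :=
  h.apply_eq_zero_of_mul (by rw [← mul_assoc, G.orth _ _ _ _ hne, zero_mul])

/-- The Haar state of a diagonal corner is a state of the algebra. -/
theorem isState (h : IsHaarSystem G φ) (k : I) : IsState (φ k k) := by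
  have hs := h.state k k (G.unit_ne k)
  refine ⟨hs.pos, le_antisymm ?_ ?_⟩
  · exact ContinuousLinearMap.opNorm_le_bound _ zero_le_one fun a => by
      rw [one_mul]
      exact hs.norm_apply_le a
  · have h1 := (φ k k).le_opNorm (G.u k k)
    rw [hs.unit, norm_one] at h1
    exact h1.trans (mul_le_of_le_one_right (norm_nonneg _) ((G.proj k k).norm_le _))

end IsHaarSystem

theorem ofReal_re_eq_tsum {ι : Type*} {f : ι → ℂ} {z : ℂ} (hf : ∀ i, 0 ≤ f i) (h : HasSum f z) :
    ENNReal.ofReal z.re = ∑' i, ENNReal.ofReal (f i).re := by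
  have h1 := Complex.hasSum_re h
  rw [← h1.tsum_eq]
  exact ENNReal.ofReal_tsum_of_nonneg (fun i => (Complex.le_def.1 (hf i)).1) h1.summable

theorem ofReal_re_mul {z w : ℂ} (hz : 0 ≤ z) (hw : 0 ≤ w) :
    ENNReal.ofReal (z * w).re = ENNReal.ofReal z.re * ENNReal.ofReal w.re := by
  have h1 := Complex.le_def.1 hz
  have h2 := Complex.le_def.1 hw
  rw [← ENNReal.ofReal_mul h1.1, Complex.mul_re, ← h1.2, Complex.zero_im, zero_mul, sub_zero]

/-- Left invariance of the sum of the functionals of a Haar system. -/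
theorem IsHaarSystem.tsum_slice (h : IsHaarSystem G φ) {ω : A →L[ℂ] ℂ} (hω : IsPos ω) {a x : A}
    (ha : 0 ≤ a)
    (hx : strictExt (fun z : B => ((G.sl ω z : A) : 𝓜(ℂ, A))) (G.Δ a) = x) :
    ∑' l, ∑' m, ENNReal.ofReal (φ l m x).re =
      ∑' k, (∑' l, ENNReal.ofReal (ω (G.u k l)).re) * ∑' m, ENNReal.ofReal (φ k m a).re := by
  have hu : ∀ k l, 0 ≤ ω (G.u k l) := fun k l => hω _ (G.proj k l).nonneg
  have hφ : ∀ k m, 0 ≤ φ k m a := fun k m => h.isPos k m a ha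
  have h1 : ∀ l m, ENNReal.ofReal (φ l m x).re =
      ∑' k, ENNReal.ofReal (ω (G.u k l)).re * ENNReal.ofReal (φ k m a).re := fun l m => by
    rw [ofReal_re_eq_tsum (fun k => mul_nonneg (hu k l) (hφ k m)) (h.hasSum_slice hx l m)]
    exact tsum_congr fun k => ofReal_re_mul (hu k l) (hφ k m)
  simp only [h1]
  calc _ = ∑' l, ∑' k, ∑' m, ENNReal.ofReal (ω (G.u k l)).re * ENNReal.ofReal (φ k m a).re :=
        tsum_congr fun l => ENNReal.tsum_comm
    _ = ∑' k, ∑' l, ∑' m, ENNReal.ofReal (ω (G.u k l)).re * ENNReal.ofReal (φ k m a).re :=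
        ENNReal.tsum_comm
    _ = _ := tsum_congr fun k => by
        simp only [ENNReal.tsum_mul_left, ENNReal.tsum_mul_right]

/-- The weight given by the sum of the functionals of a Haar system. -/
noncomputable def IsHaarSystem.weight (h : IsHaarSystem G φ) : Weight A where
  toFun a := ∑' p : I × I, ENNReal.ofReal (φ p.1 p.2 a).re
  map_add' a b := by
    rw [← ENNReal.tsum_add]
    refine tsum_congr fun p => ?_
    rw [map_add, Complex.add_re, ENNReal.ofReal_add (Complex.le_def.1 (h.isPos _ _ _ a.2)).1
      (Complex.le_def.1 (h.isPos _ _ _ b.2)).1]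
  map_smul' c a := by
    rw [← ENNReal.tsum_mul_left]
    refine tsum_congr fun p => ?_
    change ENNReal.ofReal (φ p.1 p.2 ((c : ℝ) • (a : A))).re = _
    rw [← Complex.coe_smul, map_smul, smul_eq_mul, Complex.re_ofReal_mul,
      ENNReal.ofReal_mul c.coe_nonneg, ENNReal.ofReal_coe_nnreal]

theorem IsHaarSystem.weight_apply (h : IsHaarSystem G φ) (a : {a : A // 0 ≤ a}) :
    h.weight a = ∑' p : I × I, ENNReal.ofReal (φ p.1 p.2 a).re := rfl

end Frame

/-! ### Existence and uniqueness of the invariant integral -/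

theorem Weight.ext {A : Type u} [NonUnitalCStarAlgebra A] [PartialOrder A] [StarOrderedRing A]
    {φ ψ : Weight A} (h : ∀ a, φ a = ψ a) : φ = ψ := by
  cases φ
  cases ψ
  congr
  exact funext h

namespace PartialCompactQuantumGroup

variable {I : Type v} {A : Type u} [NonUnitalCStarAlgebra A] [PartialOrder A] [StarOrderedRing A]
  {G : PartialCompactQuantumGroup I A} {φ : I → I → A →L[ℂ] ℂ}

open PartialCompactQuantumSemigroup

theorem apply_compress_of_mem (h : G.frame.IsHaarSystem φ) {S : Set (I × I)} {m : 𝓜(ℂ, A)}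
    (hm : G.IsUnitSum S m) {k l : I} (hq : (k, l) ∈ S) (a : A) :
    φ k l (compress m a) = φ k l a := by
  rw [← h.supp, ← h.supp k l a]
  change φ k l (G.unit k l * (compress m a * G.unit k l)) = φ k l (G.unit k l * (a * G.unit k l))
  rw [hm.unit_mul_compress_mul_unit, hm.snd_mem hq, hm.fst_mem _ hq]

theorem apply_compress_of_notMem (h : G.frame.IsHaarSystem φ) {S : Set (I × I)} {m : 𝓜(ℂ, A)}
    (hm : G.IsUnitSum S m) {k l : I} (hq : (k, l) ∉ S) (a : A) :
    φ k l (compress m a) = 0 := by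
  refine h.apply_eq_zero_of_mul ?_
  change G.unit k l * (compress m a * G.unit k l) = 0
  rw [hm.unit_mul_compress_mul_unit, hm.snd_notMem hq, zero_mul]

/-- Compressing by the projection onto the corners over the range of `f` restricts the sum that
defines the weight. -/
theorem weight_compressPos (h : G.frame.IsHaarSystem φ) {ι : Type*} {f : ι → I × I}
    (hf : Function.Injective f) {m : 𝓜(ℂ, A)} (hm : G.IsUnitSum (Set.range f) m)
    (a : {a : A // 0 ≤ a}) :
    h.weight (compressPos m a) = ∑' i, ENNReal.ofReal (φ (f i).1 (f i).2 a).re := by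
  rw [h.weight_apply, ← hf.tsum_eq]
  · exact tsum_congr fun i => congrArg (fun z => ENNReal.ofReal (Complex.re z))
      (apply_compress_of_mem h hm ⟨i, rfl⟩ a)
  · intro p hp
    by_contra hn
    refine hp ?_
    change ENNReal.ofReal (φ p.1 p.2 (compress m a)).re = 0
    rw [apply_compress_of_notMem h hm hn, Complex.zero_re, ENNReal.ofReal_zero]

theorem ofReal_evalMult {ω : A →L[ℂ] ℂ} (hω : IsPos ω) {ι : Type*} {f : ι → I × I}
    (hf : Function.Injective f) {m : 𝓜(ℂ, A)} (hm : G.IsUnitSum (Set.range f) m) :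
    ENNReal.ofReal (evalMult ω m).re =
      ∑' i, ENNReal.ofReal (ω (G.unit (f i).1 (f i).2)).re := by
  have h1 := (hf.hasSum_iff fun p hp => ?_).2 (G.frame.hasSum_evalMult ω m)
  · have h2 : ∀ i, ((fun p : I × I => ω (m.fst (G.frame.u p.1 p.2))) ∘ f) i =
        ω (G.unit (f i).1 (f i).2) := fun i => congrArg ω (hm.fst_mem _ ⟨i, rfl⟩)
    rw [Frame.ofReal_re_eq_tsum (fun i => ?_) h1]
    · exact tsum_congr fun i => by rw [h2]
    · rw [h2]
      exact hω _ (G.isStarProjection_unit _ _).nonneg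
  · exact (congrArg ω (hm.fst_notMem _ hp)).trans (map_zero ω)

theorem isInvariantIntegral_weight (h : G.frame.IsHaarSystem φ) :
    G.IsInvariantIntegral h.weight where
  unit_eq_one k m hkm := by
    rw [h.weight_apply, tsum_eq_single (k, m)]
    · change ENNReal.ofReal (φ k m (G.frame.u k m)).re = 1
      rw [(h.state k m hkm).unit, Complex.one_re, ENNReal.ofReal_one]
    · intro p hp
      change ENNReal.ofReal (φ p.1 p.2 (G.frame.u k m)).re = 0
      rw [h.apply_unit_ne hp, Complex.zero_re, ENNReal.ofReal_zero]
  eq_tsum a := by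
    rw [h.weight_apply]
    refine tsum_congr fun p => ?_
    have h1 := isUnitSum_coe (G := G.toPartialCompactQuantumSemigroup) p.1 p.2
    rw [← Set.range_const (ι := Unit)] at h1
    rw [weight_compressPos h (fun _ _ _ => rfl) h1, tsum_fintype, Fintype.sum_unique]
  left_invariant a ω hω := by
    obtain ⟨x, hx, -⟩ := G.frame.exists_slice ω (a : A)
    refine ⟨⟨x, G.frame.slice_nonneg hω.1 a.2 hx⟩, hx.symm, ?_⟩
    rw [h.weight_apply, ENNReal.tsum_prod', h.tsum_slice hω.1 a.2 hx]
    refine tsum_congr fun k => ?_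
    have hk : Function.Injective fun m : I => (k, m) := fun _ _ h => congrArg Prod.snd h
    rw [ofReal_evalMult hω.1 hk (G.isUnitSum_source k),
      weight_compressPos h hk (G.isUnitSum_source k)]
    rfl
  right_invariant a ω hω := by
    obtain ⟨x, hx, -⟩ := G.frame.op.exists_slice ω (a : A)
    refine ⟨⟨x, G.frame.op.slice_nonneg hω.1 a.2 hx⟩, hx.symm, ?_⟩
    rw [h.weight_apply, ENNReal.tsum_prod', ENNReal.tsum_comm, h.op.tsum_slice hω.1 a.2 hx]
    refine tsum_congr fun m => ?_
    have hm : Function.Injective fun k : I => (k, m) := fun _ _ h => congrArg Prod.fst h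
    rw [ofReal_evalMult hω.1 hm (G.isUnitSum_target m),
      weight_compressPos h hm (G.isUnitSum_target m)]
    rfl

/-- Left invariance with respect to the Haar state at `(k, k)` determines an invariant integral on
the corner at `(k, m)`. -/
theorem IsInvariantIntegral.apply_compressPos (h : G.frame.IsHaarSystem φ) {Φ : Weight A}
    (hΦ : G.IsInvariantIntegral Φ) (a : {a : A // 0 ≤ a}) (k m : I) :
    Φ (compressPos (G.unit k m : 𝓜(ℂ, A)) a) = ENNReal.ofReal (φ k m a).re := by
  set a' := compressPos (G.unit k m : 𝓜(ℂ, A)) a with ha'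
  have hunit := isUnitSum_coe (G := G.toPartialCompactQuantumSemigroup) k m
  have hφa : φ k m a' = φ k m a := apply_compress_of_mem h hunit rfl a
  by_cases h0 : G.unit k m = 0
  · have h1 : a' = ⟨((0 : NNReal) : ℝ) • (a : A), smul_nonneg NNReal.zero_le_coe a.2⟩ := by
      refine Subtype.ext ?_
      change (star (G.unit k m : 𝓜(ℂ, A))).fst (a * G.unit k m) = ((0 : NNReal) : ℝ) • (a : A)
      rw [h0, mul_zero, map_zero, NNReal.coe_zero, zero_smul]
    rw [h1, Φ.map_smul', h.eq_zero k m h0, ENNReal.coe_zero, zero_mul]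
    exact ENNReal.ofReal_zero.symm
  have hs := h.state k k (G.unit_self_ne_zero k)
  have hcorner : G.unit k m * ((a' : A) * G.unit k m) = a' := by
    have h1 : (a' : A) = G.unit k m * (a * G.unit k m) := by
      change (star (G.unit k m : 𝓜(ℂ, A))).fst (a * G.unit k m) = _
      rw [← coe_mult_star, star_unit]
      rfl
    rw [h1, mul_assoc, mul_assoc, unit_idem, ← mul_assoc, unit_idem]
  obtain ⟨x, hx, hΦx⟩ := hΦ.left_invariant a' (φ k k) (h.isState k)
  have hxu : (x : A) = φ k m a' • G.unit k m := h.slice_corner hcorner hx.symm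
  have hpos := Complex.le_def.1 (h.isPos k m _ a'.2)
  have hreal : φ k m a' = (((φ k m a').re : ℝ) : ℂ) := Complex.ext rfl hpos.2.symm
  have hx' : x = ⟨((⟨(φ k m a').re, hpos.1⟩ : NNReal) : ℝ) • G.unit k m,
      smul_nonneg hpos.1 (G.isStarProjection_unit k m).nonneg⟩ := by
    refine Subtype.ext ?_
    change (x : A) = (φ k m a').re • G.unit k m
    rw [hxu, ← Complex.coe_smul, ← hreal]
  have hleft : Φ x = ENNReal.ofReal (φ k m a').re := by
    rw [hx']
    refine (Φ.map_smul' ⟨_, hpos.1⟩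
      ⟨G.unit k m, (G.isStarProjection_unit k m).nonneg⟩).trans ?_
    rw [hΦ.unit_eq_one k m h0, mul_one, ENNReal.ofReal, Real.toNNReal_of_nonneg hpos.1]
    rfl
  have hsrc : ∀ i, ENNReal.ofReal (evalMult (φ k k) (G.source i)).re =
      ∑' j, ENNReal.ofReal (φ k k (G.unit i j)).re := fun i =>
    ofReal_evalMult hs.pos (fun _ _ h => congrArg Prod.snd h) (G.isUnitSum_source i)
  have hright : ∑' i : I, ENNReal.ofReal (evalMult (φ k k) (G.source i)).re *
      Φ (compressPos (G.source i) a') = Φ a' := by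
    rw [tsum_eq_single k]
    · have h1 : compressPos (G.source k) a' = a' :=
        Subtype.ext ((G.isUnitSum_source k).compress_of_mem ⟨m, rfl⟩ hcorner)
      rw [h1, hsrc, tsum_eq_single k]
      · change ENNReal.ofReal (φ k k (G.frame.u k k)).re * _ = _
        rw [hs.unit, Complex.one_re, ENNReal.ofReal_one, one_mul]
      · intro j hj
        change ENNReal.ofReal (φ k k (G.frame.u k j)).re = 0
        rw [h.apply_unit_ne (by simpa using hj.symm), Complex.zero_re, ENNReal.ofReal_zero]
    · intro i hi
      rw [hsrc, ENNReal.tsum_eq_zero.2, zero_mul]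
      intro j
      change ENNReal.ofReal (φ k k (G.frame.u i j)).re = 0
      rw [h.apply_unit_ne (fun hc => hi (congrArg Prod.fst hc).symm), Complex.zero_re,
        ENNReal.ofReal_zero]
  rw [← hright, ← hΦx, hleft, hφa]

theorem IsInvariantIntegral.eq_weight (h : G.frame.IsHaarSystem φ) {Φ : Weight A}
    (hΦ : G.IsInvariantIntegral Φ) : Φ = h.weight := by
  refine Weight.ext fun a => ?_
  rw [hΦ.eq_tsum a, h.weight_apply]
  exact tsum_congr fun p => IsInvariantIntegral.apply_compressPos h hΦ a p.1 p.2

end PartialCompactQuantumGroup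

end HaarWeight

end PartialCQG

theorem mainTheorem1 {I : Type v} {A : Type u} [NonUnitalCStarAlgebra A] [PartialOrder A]
    [StarOrderedRing A] (G : PartialCQG.PartialCompactQuantumGroup I A) :
    ∃! φ : PartialCQG.Weight A,
      G.toPartialCompactQuantumSemigroup.IsInvariantIntegral φ := by
  obtain ⟨φ, h⟩ := PartialCQG.Frame.exists_isHaarSystem G.frame
  exact ⟨h.weight, PartialCQG.PartialCompactQuantumGroup.isInvariantIntegral_weight h, fun Φ hΦ =>
    PartialCQG.PartialCompactQuantumGroup.IsInvariantIntegral.eq_weight h hΦ⟩
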